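/- Let $\tau=\tau_1+\mathrm{i}\tau_2\in\mathbb{H}$, $q=e^{2\pi\mathrm{i}\tau}$ (so $q^r=e^{2\pi\mathrm{i} r\tau}$), $\operatorname{sgn}(0)=0$. *Error functions.* Let $\operatorname{Erf}(x)=\frac{2}{\sqrt\pi}\int_0^x e^{-t^2}\,dt$, $\operatorname{Erfc}=1-\operatorname{Erf}$, $E_1(u)=\operatorname{Erf}(u\sqrt{\pi})$, $M_1(u)=-\operatorname{sgn}(u)\operatorname{Erfc}(|u|\sqrt\pi)$. For $\alpha,u_1,u_2\in\mathbb{R}$ with $u_1\ne0$, $u_2\neq\alpha u_1$ let $$M_2(\alpha;u_1,u_2)=-\frac1{\pi^2}\int_{\mathbb{R}-\mathrm{i}u_1}dz_1\int_{\mathbb{R}-\mathrm{i}u_2}dz_2\,\frac{e^{-\pi z_1^2-\pi z_2^2-2\pi\mathrm{i}(u_1z_1+u_2z_2)}}{z_1(z_2-\alpha z_1)},$$ $$E_2(\alpha;u_1,u_2)=M_2(\alpha;u_1,u_2)+\operatorname{sgn}(u_1)M_1(u_2)+\operatorname{sgn}(u_2-\alpha u_1)M_1\Bigl(\tfrac{u_1+\alpha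 u_2}{\sqrt{1+\alpha^2}}\Bigr)+\operatorname{sgn}(u_2)\operatorname{sgn}(u_1+\alpha u_2),$$ and extend $E_2(\alpha;\cdot,\cdot)$ continuously to $\mathbb{R}^2$. *Appell–Lerch sums.* Let $\Theta(v,\tau)=\sum_{k_1,k_2\in\mathbb{Z}}e^{2\pi\mathrm{i}v(k_1+2k_2)}q^{k_1^2+k_2^2+k_1k_2}$. For $u\notin\tau\mathbb{Z}+\mathbb{Z}$ and $v$ with $\Theta(v,\tau)\neq0$ put $$\mu_{2,1}(u,v,\tau)=\frac12+\frac{e^{\pi\mathrm{i}u}}{\Theta(v,\tau)}\sum_{k_1,k_2\in\mathbb{Z}}\frac{e^{2\pi\mathrm{i}v(k_1+2k_2)}q^{k_1^2+k_2^2+k_1k_2+2k_1+k_2}}{1-e^{2\pi\mathrm{i}u}q^{2k_1+k_2}},$$ $$\mu_{2,2}(u,v,\tau)=\frac14+\frac{e^{2\pi\mathrm{i}u}}{\Theta(v,\tau)}\sum_{k_1,k_2\in\mathbb{Z}}\frac{e^{2\pi\mathrm{i}v(k_1+2k_2)}q^{k_1^2+k_2^2+k_1k_2+2k_1+k_2}}{(1-e^{2\pi\mathrm{i}u}q^{2k_1+k_2})(1-e^{2\pi\mathrm{i}u}q^{k_2-k_1})}.$$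 *Correction terms.* For $w\in\mathbb{C}$ put $a=\operatorname{Im}(w)/\tau_2$ and $$R_{1,j}(w,\tau)=\sum_{\ell\in\mathbb{Z}+\frac j2}\Bigl[\operatorname{sgn}(\ell)-E_1\bigl(\sqrt{3\tau_2}\,(2\ell-a)\bigr)\Bigr]e^{6\pi\mathrm{i}\ell w}q^{-3\ell^2}\qquad(j=0,1),$$ $$R_2(w,\tau)=\lim_{N\to\infty}\sum_{|k_3|,|k_4|\le N}\Bigl\{\operatorname{sgn}(k_3)\operatorname{sgn}(k_4)-2\bigl[\operatorname{sgn}(k_4)-E_1(\sqrt{3\tau_2}(k_4-a))\bigr]\operatorname{sgn}(2k_3-k_4)-E_2\bigl(\tfrac1{\sqrt3};\sqrt{\tau_2}(2k_3-k_4-a),\sqrt{3\tau_2}(k_4-a)\bigr)\Bigr\}e^{2\pi\mathrm{i}(k_3+k_4)w}q^{-k_3^2-k_4^2+k_3k_4},$$ where $k_3,k_4$ range over integers, and $$R_{2,2}(u,v,\tau)=R_2(u-v,\tau)+4\Bigl[\tfrac12+e^{\pi\mathrm{i}u}\bigl(\mu_{2,1}(u,v,\tau)-\tfrac12\bigr)\Bigr]R_{1,0}(u-v,\tau)+4e^{\pi\mathrm{i}v}q^{-\frac14}\bigl(\mu_{2,1}(u,v-\tau,\tau)-\tfrac12\bigr)R_{1,1}(u-v,\tau).$$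 **Theorem.** For $u\notin\tau\mathbb{Z}+\mathbb{Z}$ and $\Theta(v,\tau)\ne0$ the series $\Theta$, $\mu_{2,1}$, $\mu_{2,2}$, $R_{1,j}$ above converge absolutely and the limit $R_2$ exists. The function $$\widehat\mu_{2,2}(u,v,\tau)=\mu_{2,2}(u,v,\tau)-\tfrac14R_{2,2}(u,v,\tau)$$ transforms as a two-variable Jacobi form of weight $1$ for $\Gamma_0(3)$ with multiplier $\left(\frac d3\right)$ and matrix index $m=\begin{pmatrix}-1&1\\1&-1\end{pmatrix}$. That is, the domain $\{u\notin\tau\mathbb{Z}+\mathbb{Z},\ \Theta(v,\tau)\neq0\}$ is stable under the substitutions below, and on it, with $z=(u,v)^T$, for all $\begin{pmatrix}a&b\\c&d\end{pmatrix}\in\Gamma_0(3)$ and all $\lambda,\nu\in\mathbb{Z}^2$, $$\widehat\mu_{2,2}\Bigl(\frac{z}{c\tau+d},\frac{a\tau+b}{c\tau+d}\Bigr)=\Bigl(\frac d3\Bigr)(c\tau+d)\,e^{2\pi\mathrm{i}\frac{c\,z^Tmz}{c\tau+d}}\,\widehat\mu_{2,2}(z,\tau),$$ $$\widehat\mu_{2,2}(z+\lambda\tau+\nu,\tau)=e^{-2\pi\mathrm{i}(\lambda^Tm\lambda\,\tau+2\lambda^Tmz)}\,\widehat\mu_{2,2}(z,\tau).$$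 -/

import Mathlib

open Complex Filter Topology
open scoped UpperHalfPlane

noncomputable section

namespace AppellLerch

/-! ### Error functions -/

/-- `Erf x = (2/√π) ∫₀ˣ exp(-t²) dt`. -/
def Erf (x : ℝ) : ℝ := 2 / √Real.pi * ∫ t in (0 : ℝ)..x, Real.exp (-t ^ 2)

/-- The complementary error function. -/
def Erfc (x : ℝ) : ℝ := 1 - Erf x

/-- `E₁(u) = Erf(u√π)`. -/
def E1 (u : ℝ) : ℝ := Erf (u * √Real.pi)

/-- `M₁(u) = -sgn(u) Erfc(|u|√π)`, with `sgn 0 = 0`. -/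
def M1 (u : ℝ) : ℝ := -Real.sign u * Erfc (|u| * √Real.pi)

/-- The integrand of `M₂`, as a function of the two complex integration variables. -/
def M2Integrand (α u₁ u₂ : ℝ) (z₁ z₂ : ℂ) : ℂ :=
  cexp (-Real.pi * z₁ ^ 2 - Real.pi * z₂ ^ 2 - 2 * Real.pi * I * (u₁ * z₁ + u₂ * z₂)) /
    (z₁ * (z₂ - α * z₁))

/-- The complementary double error function `M₂(α; u₁, u₂)`: the contours `ℝ - i u₁`, `ℝ - i u₂`
are parametrized by `z₁ = x₁ - i u₁`, `z₂ = x₂ - i u₂`. Meaningful for `u₁ ≠ 0`, `u₂ ≠ α u₁`. -/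
def M2 (α u₁ u₂ : ℝ) : ℂ :=
  -(1 / (Real.pi : ℂ) ^ 2) *
    ∫ x₁ : ℝ, ∫ x₂ : ℝ, M2Integrand α u₁ u₂ (x₁ - I * u₁) (x₂ - I * u₂)

/-- The double error function off the lines `u₁ = 0` and `u₂ = α u₁`. -/
def E2Generic (α : ℝ) (p : ℝ × ℝ) : ℂ :=
  M2 α p.1 p.2 + ((Real.sign p.1 * M1 p.2
    + Real.sign (p.2 - α * p.1) * M1 ((p.1 + α * p.2) / √(1 + α ^ 2))
    + Real.sign p.2 * Real.sign (p.1 + α * p.2) : ℝ) : ℂ)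

/-- The double error function `E₂(α; u₁, u₂)` on all of `ℝ²`: the continuous extension of
`E2Generic` across the two excluded lines. -/
def E2 (α u₁ u₂ : ℝ) : ℂ :=
  extendFrom {p : ℝ × ℝ | p.1 ≠ 0 ∧ p.2 ≠ α * p.1} (E2Generic α) (u₁, u₂)

/-! ### The `A₂` theta function and the generalized Appell-Lerch sums -/

/-- `e(x) = exp(2πi x)`; in particular `q ^ r = e(r τ)`. -/
def e (x : ℂ) : ℂ := cexp (2 * Real.pi * I * x)

/-- `e^{2πi v (k₁ + 2 k₂)} q^{k₁² + k₂² + k₁ k₂}`. -/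
def ThetaTerm (v : ℂ) (τ : ℍ) (k : ℤ × ℤ) : ℂ :=
  e (v * (k.1 + 2 * k.2)) * e ((k.1 ^ 2 + k.2 ^ 2 + k.1 * k.2) * τ)

/-- The cubic theta function `Θ(v, τ)`. -/
def Theta (v : ℂ) (τ : ℍ) : ℂ := ∑' k : ℤ × ℤ, ThetaTerm v τ k

def mu21Term (u v : ℂ) (τ : ℍ) (k : ℤ × ℤ) : ℂ :=
  e (v * (k.1 + 2 * k.2)) * e ((k.1 ^ 2 + k.2 ^ 2 + k.1 * k.2 + 2 * k.1 + k.2) * τ) /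
    (1 - e u * e ((2 * k.1 + k.2) * τ))

/-- The generalized Appell-Lerch sum of signature `(2, 1)`. -/
def mu21 (u v : ℂ) (τ : ℍ) : ℂ :=
  1 / 2 + e (u / 2) / Theta v τ * ∑' k : ℤ × ℤ, mu21Term u v τ k

def mu22Term (u v : ℂ) (τ : ℍ) (k : ℤ × ℤ) : ℂ :=
  e (v * (k.1 + 2 * k.2)) * e ((k.1 ^ 2 + k.2 ^ 2 + k.1 * k.2 + 2 * k.1 + k.2) * τ) /
    ((1 - e u * e ((2 * k.1 + k.2) * τ)) * (1 - e u * e ((k.2 - k.1) * τ)))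

/-- The generalized Appell-Lerch sum of signature `(2, 2)`. -/
def mu22 (u v : ℂ) (τ : ℍ) : ℂ :=
  1 / 4 + e u / Theta v τ * ∑' k : ℤ × ℤ, mu22Term u v τ k

/-! ### The non-holomorphic correction -/

/-- The summand of `R_{1,j}(u, τ)` at `ℓ ∈ ℤ + j/2`, with `a = Im u / Im τ`. -/
def R1Term (u : ℂ) (τ : ℍ) (l : ℝ) : ℂ :=
  ((Real.sign l - E1 (√(3 * τ.im) * (2 * l - u.im / τ.im)) : ℝ) : ℂ) *
    (e (3 * l * u) * e (-3 * l ^ 2 * τ))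

/-- `R_{1,j}(u, τ)`, the sum over `ℓ ∈ ℤ + j/2`. -/
def R1 (j : ℕ) (u : ℂ) (τ : ℍ) : ℂ := ∑' n : ℤ, R1Term u τ (n + j / 2)

/-- The summand of `R₂(u, τ)` at `(k₃, k₄)`, with `a = Im u / Im τ`. -/
def R2Term (u : ℂ) (τ : ℍ) (k₃ k₄ : ℤ) : ℂ :=
  (((Real.sign k₃ * Real.sign k₄
      - 2 * (Real.sign k₄ - E1 (√(3 * τ.im) * (k₄ - u.im / τ.im))) * Real.sign (2 * k₃ - k₄) : ℝ) : ℂ)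
    - E2 (1 / √3) (√τ.im * (2 * k₃ - k₄ - u.im / τ.im)) (√(3 * τ.im) * (k₄ - u.im / τ.im))) *
    (e ((k₃ + k₄) * u) * e ((-k₃ ^ 2 - k₄ ^ 2 + k₃ * k₄) * τ))

/-- Partial sums of the double series `R₂` over the squares `|k₃|, |k₄| ≤ N`. -/
def R2Partial (u : ℂ) (τ : ℍ) (N : ℕ) : ℂ :=
  ∑ k₃ ∈ Finset.Icc (-(N : ℤ)) N, ∑ k₄ ∈ Finset.Icc (-(N : ℤ)) N, R2Term u τ k₃ k₄

/-- `R₂(u, τ)`. The double series does not converge unconditionally (the part of the summand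
that does not decay is antisymmetric under `k₃ ↔ k₄`); it is summed over squares. -/
def R2 (u : ℂ) (τ : ℍ) : ℂ := limUnder atTop (R2Partial u τ)

/-- `R_{2,2}(u, v, τ)`. -/
def R22 (u v : ℂ) (τ : ℍ) : ℂ :=
  R2 (u - v) τ
    + 4 * (1 / 2 + e (u / 2) * (mu21 u v τ - 1 / 2)) * R1 0 (u - v) τ
    + 4 * e (v / 2) * e (-τ / 4) * (mu21 u (v - τ) τ - 1 / 2) * R1 1 (u - v) τ

/-- The completed function `μ̂_{2,2} = μ_{2,2} - R_{2,2} / 4`. -/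
def muHat22 (u v : ℂ) (τ : ℍ) : ℂ := mu22 u v τ - 1 / 4 * R22 u v τ

/-- The domain: `u` is not in `ℤτ + ℤ`, and `v` is not a zero of `Θ(·, τ)`. -/
def Domain : Set ((Fin 2 → ℂ) × ℍ) :=
  {p | (∀ m n : ℤ, p.1 0 ≠ m * p.2 + n) ∧ Theta (p.1 1) p.2 ≠ 0}

/-- Every series entering the definition of `μ̂_{2,2}(u, v, τ)` converges. -/
structure SeriesConverge (u v : ℂ) (τ : ℍ) : Prop where
  theta : Summable (ThetaTerm v τ)
  theta_shift : Summable (ThetaTerm (v - τ) τ)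
  mu21 : Summable (mu21Term u v τ)
  mu21_shift : Summable (mu21Term u (v - τ) τ)
  mu22 : Summable (mu22Term u v τ)
  R1 : ∀ j ∈ ({0, 1} : Set ℕ), Summable fun n : ℤ => R1Term (u - v) τ (n + j / 2)
  R2 : ∃ L : ℂ, Tendsto (R2Partial (u - v) τ) atTop (𝓝 L)

/-! ### Two-variable Jacobi transformation laws -/

/-- `f`, a function on the domain `D`, transforms as a two-variable Jacobi form of weight `k` and
matrix-valued index `m` for the group `Γ` with multiplier `χ`. With `e(x) = exp(2πi x)` this means
`f(z/(cτ+d), γτ) = χ(γ) (cτ+d)^k e(c zᵀmz/(cτ+d)) f(z, τ)` for `γ ∈ Γ`, and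
`f(z + lτ + n, τ) = e(-(lᵀml τ + 2 lᵀmz)) f(z, τ)` for `l, n ∈ ℤ²`;
moreover `D` is stable under these substitutions. -/
structure TransformsAsJacobiForm (D : Set ((Fin 2 → ℂ) × ℍ)) (f : (Fin 2 → ℂ) → ℍ → ℂ)
    (k : ℤ) (Γ : Subgroup (Matrix.SpecialLinearGroup (Fin 2) ℤ))
    (χ : Matrix.SpecialLinearGroup (Fin 2) ℤ → ℂ) (m : Matrix (Fin 2) (Fin 2) ℂ) : Prop where
  modular_mem : ∀ γ ∈ Γ, ∀ (z : Fin 2 → ℂ) (τ : ℍ), (z, τ) ∈ D →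
    ((fun i => z i / ((γ 1 0 : ℂ) * τ + (γ 1 1 : ℂ))), γ • τ) ∈ D
  modular : ∀ γ ∈ Γ, ∀ (z : Fin 2 → ℂ) (τ : ℍ), (z, τ) ∈ D →
    f (fun i => z i / ((γ 1 0 : ℂ) * τ + (γ 1 1 : ℂ))) (γ • τ) =
      χ γ * ((γ 1 0 : ℂ) * τ + (γ 1 1 : ℂ)) ^ k *
        e ((γ 1 0 : ℂ) * (z ⬝ᵥ m.mulVec z) / ((γ 1 0 : ℂ) * τ + (γ 1 1 : ℂ))) * f z τ
  elliptic_mem : ∀ (l n : Fin 2 → ℤ) (z : Fin 2 → ℂ) (τ : ℍ), (z, τ) ∈ D →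
    ((fun i => z i + l i * τ + n i), τ) ∈ D
  elliptic : ∀ (l n : Fin 2 → ℤ) (z : Fin 2 → ℂ) (τ : ℍ), (z, τ) ∈ D →
    f (fun i => z i + l i * τ + n i) τ =
      e (-(((fun i => (l i : ℂ)) ⬝ᵥ m.mulVec (fun i => (l i : ℂ))) * τ
          + 2 * ((fun i => (l i : ℂ)) ⬝ᵥ m.mulVec z))) * f z τ

end AppellLerch

end

/-! Write w = u - v. Multiplication by Θ(v) removes all denominators. `Theta_mul_muHat22` identifies
Θ(v) μ̂_{2,2} with `FF`, which is the symmetric sum `ff` of Θ-terms times A₀(u + n₁τ) A₀(u + n₂τ),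
where A₀(x) = (i/2) cot πx, minus correction terms in w. Since Θ has weight 1 and character χ =
(d/3) with χ² = 1, it suffices that `FF` has weight 2 and the matching index.

The elliptic laws are direct. Translating u by τ produces lower-depth error terms in `ff`, in the
depth-one sums `gg` and in the corrections, and these cancel (`FF_add_tau`).

The modular law is a Liouville argument in u with v fixed, `eq_zero_of_negative_index`. Suppose a
function is holomorphic off ℤτ + ℤ, has singularities weaker than simple poles there, and has
negative index. Then its absolute value times a Gaussian in Im(u - v) is doubly periodic and
bounded, so the function extends to an entire bounded function that decays, and it vanishes. This is
applied to the difference of the two sides of the transformation law, which calls for three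
verifications.

Holomorphy. E₂ is a Gaussian average of a sign and an E₁ (`E2_eq_E2Gauss`), so differentiation
lowers its depth by one. The A₂ form splits orthogonally as n²/4 + 3m²/4 with n ≡ m mod 2. Hence the
antiholomorphic derivative of `FF` is a pairing of the theta vector at (3v, 3τ), the 2×2 matrix `hM`
of completed depth-one Appell sums, and a conjugated theta vector at (3w, 3τ) (`hasDbarAt_FF`). The
matrix transforms as M · hM · Mᴴ, where M acts on theta vectors. For τ ↦ -1/τ this is `hC_S`, proved
by the same Liouville theorem, the antiholomorphic derivative of `hM` being a rank-one matrix. If N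
is the analogue of M at 3τ, then NᵀM = χj on Γ₀(3), with j = cτ + d, so the pairing transforms by a
scalar (`IsLevelThree.bilinear`).

Principal part. At u = 0, `FF` behaves like -1/(4π²u²) + (i/π) `pHat` / u. The number `pHat` is also
the constant term of the trace of `hM` at (3v, 3τ), and the trace is insensitive to conjugation.
This gives the law `pHat_modular`, whose anomaly cancels the term that the automorphy factor
extracts from the double pole.

Translations. The defect inherits the elliptic law of `FF`, because the action of Γ₀(3) permutes
lattice vectors.

The relation NᵀM = χj is checked for translations and for lower triangular elements with c divisible
by 3. A Euclidean descent shows that these generate Γ₀(3) (`isJacobi_of_mem`). The series R₂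
converges over squares because its non-decaying part is antisymmetric under k₃ ↔ k₄; the symmetrized
series converges absolutely (`R2Partial_eq`). -/

open Complex Filter Topology
open scoped UpperHalfPlane

noncomputable section

namespace AppellLerch

section

open MeasureTheory Set

/-! ### The error function -/

/-- The Gaussian `exp(-π x²)`. -/
def gauss (x : ℝ) : ℝ := Real.exp (-Real.pi * x ^ 2)

lemma gauss_pos (x : ℝ) : 0 < gauss x := Real.exp_pos _

lemma gauss_le_one (x : ℝ) : gauss x ≤ 1 := by
  unfold gauss
  rw [Real.exp_le_one_iff]
  have := Real.pi_pos
  nlinarith [sq_nonneg x, mul_nonneg this.le (sq_nonneg x)]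

@[fun_prop]
lemma continuous_gauss : Continuous gauss := by unfold gauss; fun_prop

lemma gauss_neg (x : ℝ) : gauss (-x) = gauss x := by simp [gauss]

lemma integrable_gauss : Integrable gauss := by
  unfold gauss; exact integrable_exp_neg_mul_sq Real.pi_pos

lemma integral_gauss : ∫ x, gauss x = 1 := by
  unfold gauss
  rw [integral_gaussian, div_self Real.pi_ne_zero, Real.sqrt_one]

lemma integral_gauss_Ioi : ∫ x in Ioi (0 : ℝ), gauss x = 1 / 2 := by
  unfold gauss
  rw [integral_gaussian_Ioi, div_self Real.pi_ne_zero, Real.sqrt_one]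

lemma integrable_gauss_sub (b : ℝ) : Integrable fun x => gauss (x - b) :=
  integrable_gauss.comp_sub_right b

lemma integral_gauss_sub (b : ℝ) : ∫ x, gauss (x - b) = 1 := by
  rw [integral_sub_right_eq_self, integral_gauss]

lemma E1_eq (u : ℝ) : E1 u = 2 * ∫ t in (0 : ℝ)..u, gauss t := by
  have h := intervalIntegral.integral_comp_mul_right (a := 0) (b := u)
    (fun t : ℝ => Real.exp (-t ^ 2)) (c := √Real.pi) (by positivity)
  have h2 : (∫ t in (0 : ℝ)..u, gauss t) = ∫ t in (0 : ℝ)..u, Real.exp (-(t * √Real.pi) ^ 2) := by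
    congr 1; ext t; unfold gauss; congr 1
    rw [mul_pow, Real.sq_sqrt Real.pi_pos.le]; ring
  rw [E1, Erf, h2, h, zero_mul, smul_eq_mul]
  ring

lemma hasDerivAt_E1 (u : ℝ) : HasDerivAt E1 (2 * gauss u) u := by
  have : E1 = fun u => 2 * ∫ t in (0 : ℝ)..u, gauss t := funext E1_eq
  rw [this]
  exact (intervalIntegral.integral_hasDerivAt_right (continuous_gauss.intervalIntegrable _ _)
    (continuous_gauss.stronglyMeasurableAtFilter _ _) continuous_gauss.continuousAt).const_mul 2

@[fun_prop]
lemma continuous_E1 : Continuous E1 :=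
  continuous_iff_continuousAt.2 fun u => (hasDerivAt_E1 u).continuousAt

lemma E1_zero : E1 0 = 0 := by simp [E1_eq]

lemma E1_neg (u : ℝ) : E1 (-u) = -E1 u := by
  rw [E1_eq, E1_eq, ← neg_zero, ← intervalIntegral.integral_comp_neg, neg_zero]
  simp only [gauss_neg]
  rw [intervalIntegral.integral_symm]; ring

lemma one_sub_E1 (b : ℝ) : 1 - E1 b = 2 * ∫ s in Ioi (0 : ℝ), gauss (s + b) := by
  have h1 := intervalIntegral.integral_interval_add_Ioi (a := 0) (b := b)
    integrable_gauss.integrableOn integrable_gauss.integrableOn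
  have h2 : ∫ s in Ioi (0 : ℝ), gauss (s + b) = ∫ s in Ioi b, gauss s := by
    have h := (measurePreserving_add_right (volume : Measure ℝ) b).setIntegral_preimage_emb
      (measurableEmbedding_addRight b) gauss (Ioi b)
    simpa using h
  rw [integral_gauss_Ioi] at h1
  rw [h2, E1_eq]
  linarith

lemma E1_le_one (b : ℝ) : E1 b ≤ 1 := by
  have h : 0 ≤ ∫ s in Ioi (0 : ℝ), gauss (s + b) := integral_nonneg fun s => (gauss_pos _).le
  linarith [one_sub_E1 b]

lemma abs_E1_le (b : ℝ) : |E1 b| ≤ 1 := by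
  rw [abs_le]
  have := E1_le_one (-b)
  rw [E1_neg] at this
  exact ⟨by linarith, E1_le_one b⟩

/-- Expand -π(s + x - β)² = -πx² + 2πβx - 2πsx - π(s - β)² and drop the term in sx. The constant 2
is uniform in β, as needed when the imaginary part of the elliptic variable moves. -/
lemma one_sub_E1_le {x : ℝ} (hx : 0 < x) (β : ℝ) :
    1 - E1 (x - β) ≤ 2 * Real.exp (-Real.pi * x ^ 2 + 2 * Real.pi * β * x) := by
  rw [one_sub_E1]
  have h : ∫ s in Ioi (0 : ℝ), gauss (s + (x - β)) ≤
      ∫ s in Ioi (0 : ℝ), Real.exp (-Real.pi * x ^ 2 + 2 * Real.pi * β * x) * gauss (s - β) := by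
    refine setIntegral_mono_on (integrable_gauss.comp_add_right _).integrableOn
      ((integrable_gauss_sub β).const_mul _).integrableOn measurableSet_Ioi fun s hs => ?_
    unfold gauss
    rw [← Real.exp_add, Real.exp_le_exp]
    have : 0 ≤ Real.pi * (s * x) := by have := Real.pi_pos; have : 0 < s := hs; positivity
    nlinarith
  rw [integral_const_mul] at h
  have h2 : ∫ s in Ioi (0 : ℝ), gauss (s - β) ≤ 1 := by
    rw [← integral_gauss_sub β]
    exact setIntegral_le_integral (integrable_gauss_sub β)
      (Eventually.of_forall fun s => (gauss_pos _).le)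
  have := mul_le_mul_of_nonneg_left h2
    (Real.exp_pos (-Real.pi * x ^ 2 + 2 * Real.pi * β * x)).le
  linarith

/-- The basic decay estimate for the completed sign function. -/
lemma abs_sign_sub_E1_le (x β : ℝ) :
    |Real.sign x - E1 (x - β)| ≤ 2 * Real.exp (-Real.pi * x ^ 2 + 2 * Real.pi * β * x) := by
  rcases lt_trichotomy x 0 with hx | rfl | hx
  · rw [Real.sign_of_neg hx]
    have h := one_sub_E1_le (neg_pos.2 hx) (-β)
    rw [show -x - -β = -(x - β) by ring, E1_neg] at h
    rw [abs_of_nonpos (by have := E1_le_one (-(x-β)); rw [E1_neg] at this; linarith)]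
    calc _ ≤ _ := by linarith
      _ ≤ _ := h
      _ = _ := by ring_nf
  · simpa using (abs_E1_le (-β)).trans one_le_two
  · rw [Real.sign_of_pos hx, abs_of_nonneg (by linarith [E1_le_one (x - β)])]
    exact one_sub_E1_le hx β

lemma M1_eq (u : ℝ) : M1 u = E1 u - Real.sign u := by
  have h : ∀ x : ℝ, Erfc (x * √Real.pi) = 1 - E1 x := fun x => rfl
  rcases lt_trichotomy u 0 with hx | rfl | hx
  · rw [M1, Real.sign_of_neg hx, h, abs_of_neg hx, E1_neg]; ring
  · simp [M1, E1_zero]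
  · rw [M1, Real.sign_of_pos hx, h, abs_of_pos hx]; ring

lemma measurable_sign : Measurable Real.sign := by
  unfold Real.sign
  exact Measurable.ite measurableSet_Iio measurable_const
    (Measurable.ite measurableSet_Ioi measurable_const measurable_const)

lemma abs_sign_le (x : ℝ) : |Real.sign x| ≤ 1 := by
  rcases lt_trichotomy x 0 with hx | rfl | hx
  · simp [Real.sign_of_neg hx]
  · simp
  · simp [Real.sign_of_pos hx]

lemma sign_mul_of_pos {c : ℝ} (hc : 0 < c) (x : ℝ) : Real.sign (c * x) = Real.sign x := by
  rcases lt_trichotomy x 0 with hx | rfl | hx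
  · rw [Real.sign_of_neg hx, Real.sign_of_neg (mul_neg_of_pos_of_neg hc hx)]
  · simp
  · rw [Real.sign_of_pos hx, Real.sign_of_pos (mul_pos hc hx)]

/-- Splitting an integral against the sign function into its two halves. -/
lemma integral_sign_mul {f : ℝ → ℝ} (hf : Integrable f) :
    ∫ y, Real.sign y * f y = (∫ y in Ioi 0, f y) - ∫ y in Iic 0, f y := by
  have hi : Integrable fun y => Real.sign y * f y :=
    hf.bdd_mul (c := 1) measurable_sign.aestronglyMeasurable
      (Eventually.of_forall fun y => by simpa using abs_sign_le y)
  rw [← integral_add_compl (measurableSet_Ioi (a := (0 : ℝ))) hi, compl_Ioi,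
    setIntegral_congr_fun (g := f) measurableSet_Ioi (fun y hy => by
      simp [Real.sign_of_pos (show (0 : ℝ) < y from hy)]),
    setIntegral_congr_ae (g := fun y => -f y) measurableSet_Iic ?_, integral_neg]
  · ring
  · have : ∀ᵐ y : ℝ, y ≠ 0 := by simp [ae_iff, measure_singleton]
    filter_upwards [this] with y hy hy'
    rw [Real.sign_of_neg (lt_of_le_of_ne hy' hy)]; ring

lemma integrable_sign_mul {f : ℝ → ℝ} (hf : Integrable f) :
    Integrable fun y => Real.sign y * f y :=
  hf.bdd_mul (c := 1) measurable_sign.aestronglyMeasurable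
    (Eventually.of_forall fun y => by simpa using abs_sign_le y)

lemma integral_sign_mul_gauss (u : ℝ) : ∫ y, Real.sign y * gauss (y - u) = E1 u := by
  rw [integral_sign_mul (integrable_gauss_sub u)]
  have h1 := one_sub_E1 (-u)
  have h2 := one_sub_E1 u
  have h3 : ∫ y in Iic (0 : ℝ), gauss (y - u) = ∫ y in Ioi (0 : ℝ), gauss (y + u) := by
    rw [← neg_zero, ← integral_comp_neg_Ioi, neg_zero]
    congr 1; ext y; rw [← gauss_neg]; ring_nf
  rw [E1_neg] at h1
  simp only [← sub_eq_add_neg] at h1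
  rw [h3]; linarith

/-- Scaled version of `integral_sign_mul_gauss`. -/
lemma integral_sign_mul_gauss_mul {c : ℝ} (hc : 0 < c) (u : ℝ) :
    ∫ y, Real.sign y * gauss (c * y - u) = c⁻¹ * E1 u := by
  have h := Measure.integral_comp_mul_left (fun y => Real.sign y * gauss (y - u)) c
  simp only [sign_mul_of_pos hc, integral_sign_mul_gauss, smul_eq_mul] at h
  rw [h, abs_of_pos (by positivity)]

/-- A rotation of the plane: (y - u₂)² + (u₁ + αy)² is rewritten in the orthonormal coordinates
along and across the direction (1, α). -/
lemma gauss_mul_gauss (α u₁ u₂ y : ℝ) :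
    gauss (y - u₂) * gauss (u₁ + α * y) = gauss ((u₁ + α * u₂) / √(1 + α ^ 2)) *
      gauss (√(1 + α ^ 2) * y - (u₂ - α * u₁) / √(1 + α ^ 2)) := by
  have h : (0 : ℝ) < 1 + α ^ 2 := by positivity
  have hc : √(1 + α ^ 2) ^ 2 = 1 + α ^ 2 := Real.sq_sqrt h.le
  have hc0 : √(1 + α ^ 2) ≠ 0 := by positivity
  unfold gauss
  rw [← Real.exp_add, ← Real.exp_add, ← mul_add, ← mul_add]
  congr 2
  generalize √(1 + α ^ 2) = c at *
  field_simp
  linear_combination (-((u₁ + α * y) ^ 2 + (y-u₂)^2)+ y ^ 2 * (c^2 + 1 + α ^ 2)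
    + 2 * u₁ ^ 2 + 2 * u₂ ^ 2 - 2 * y * (u₂ - α * u₁) - 2 * y ^ 2 * c ^ 2) * hc

lemma integral_gauss_mul_sub {c : ℝ} (hc : 0 < c) (b : ℝ) :
    ∫ y, gauss (c * y - b) = c⁻¹ := by
  have h := Measure.integral_comp_mul_left (fun y => gauss (y - b)) c
  rw [h, integral_gauss_sub, abs_of_pos (by positivity), smul_eq_mul, mul_one]

lemma integrable_gauss_mul_E1 (α u₁ u₂ : ℝ) :
    Integrable fun y => gauss (y - u₂) * E1 (u₁ + α * y) :=
  (integrable_gauss_sub u₂).mul_bdd (c := 1)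
    (by exact (by fun_prop : Continuous fun y => E1 (u₁ + α * y)).aestronglyMeasurable)
    (Eventually.of_forall fun y => by simpa using abs_E1_le _)

lemma integrable_gauss_mul_gauss (α u₁ u₂ : ℝ) :
    Integrable fun y => gauss (y - u₂) * gauss (u₁ + α * y) :=
  (integrable_gauss_sub u₂).mul_bdd (c := 1)
    (by exact (by fun_prop : Continuous fun y => gauss (u₁ + α * y)).aestronglyMeasurable)
    (Eventually.of_forall fun y => by
      rw [Real.norm_eq_abs, abs_of_pos (gauss_pos _)]; exact gauss_le_one _)

/-- By `gauss_mul_gauss` both sides have the same derivative in u₁. At u₁ = -αu₂ both vanish, since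
E₁ is odd. -/
lemma integral_gauss_mul_E1 (α u₁ u₂ : ℝ) :
    ∫ y, gauss (y - u₂) * E1 (u₁ + α * y) = E1 ((u₁ + α * u₂) / √(1 + α ^ 2)) := by
  set c := √(1 + α ^ 2) with hc
  have hc0 : 0 < c := by positivity
  have key : ∀ x, HasDerivAt (fun x => (∫ y, gauss (y - u₂) * E1 (x + α * y))
      - E1 ((x + α * u₂) / c)) 0 x := by
    intro x
    have h1 : HasDerivAt (fun x => ∫ y, gauss (y - u₂) * E1 (x + α * y))
        (∫ y, gauss (y - u₂) * (2 * gauss (x + α * y))) x := by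
      refine (hasDerivAt_integral_of_dominated_loc_of_deriv_le (s := univ)
        (F := fun x y => gauss (y - u₂) * E1 (x + α * y))
        (F' := fun x y => gauss (y - u₂) * (2 * gauss (x + α * y)))
        (bound := fun y => gauss (y - u₂) * 2) Filter.univ_mem
        (Eventually.of_forall fun x => (integrable_gauss_mul_E1 α x u₂).aestronglyMeasurable)
        (integrable_gauss_mul_E1 α x u₂) ?_ ?_ ((integrable_gauss_sub u₂).mul_const 2) ?_).2
      · exact (by fun_prop : Continuous fun y =>
          gauss (y - u₂) * (2 * gauss (x + α * y))).aestronglyMeasurable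
      · refine Eventually.of_forall fun y x _ => ?_
        rw [Real.norm_eq_abs, abs_of_pos (by have := gauss_pos (y - u₂);
                                             have := gauss_pos (x + α * y); positivity)]
        have := gauss_le_one (x + α * y)
        have := gauss_pos (y - u₂)
        nlinarith
      · refine Eventually.of_forall fun y x _ => ?_
        exact ((hasDerivAt_E1 _).comp_add_const x (α * y)).const_mul _
    have h2 : HasDerivAt (fun x => E1 ((x + α * u₂) / c))
        (2 * gauss ((x + α * u₂) / c) * (1 / c)) x :=
      (hasDerivAt_E1 _).comp x (((hasDerivAt_id x).add_const (α * u₂)).div_const c)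
    refine (h1.sub h2).congr_deriv ?_
    have : ∀ y, gauss (y - u₂) * (2 * gauss (x + α * y)) = 2 * gauss ((x + α * u₂) / c) *
        gauss (c * y - (u₂ - α * x) / c) := fun y => by
      rw [mul_left_comm, gauss_mul_gauss, mul_assoc]
    simp_rw [this]
    rw [integral_const_mul, integral_gauss_mul_sub hc0, one_div, sub_self]
  have hconst := is_const_of_deriv_eq_zero (fun x => (key x).differentiableAt)
    (fun x => (key x).deriv) u₁ (-(α * u₂))
  simp only [neg_add_cancel, zero_div, E1_zero, sub_zero] at hconst
  have hodd : ∫ y, gauss (y - u₂) * E1 (-(α * u₂) + α * y) = 0 := by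
    have h1 : ∫ y, gauss (y - u₂) * E1 (-(α * u₂) + α * y) = ∫ y, gauss y * E1 (α * y) := by
      rw [← integral_sub_right_eq_self (fun y => gauss y * E1 (α * y)) u₂]
      congr 1; ext y; ring_nf
    have h2 : ∫ y, gauss y * E1 (α * y) = -∫ y, gauss y * E1 (α * y) := by
      have h := integral_neg_eq_self (fun y => gauss y * E1 (α * y)) volume
      simp only [gauss_neg, mul_neg, E1_neg, integral_neg] at h
      exact h.symm
    rw [h1]; linarith
  rw [hodd] at hconst
  linarith

/-! ### The double error function as a Gaussian integral -/

/-- The double error function as the Gaussian average of a product of two signs. -/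
def E2Gauss (α u₁ u₂ : ℝ) : ℝ := ∫ y, Real.sign y * (gauss (y - u₂) * E1 (u₁ + α * y))

lemma abs_mul_gauss_le (z : ℝ) : |z| * gauss z ≤ Real.exp (-(Real.pi / 2) * z ^ 2) := by
  have h1 : |z| ≤ Real.exp (Real.pi / 2 * z ^ 2) := by
    have h := Real.add_one_le_exp (Real.pi / 2 * z ^ 2)
    have h3 := Real.pi_gt_three
    have : |z| ≤ 1 + z ^ 2 := by
      rw [← sq_abs]; nlinarith [sq_nonneg (|z| - 1), abs_nonneg z]
    nlinarith [sq_nonneg z]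
  calc |z| * gauss z ≤ Real.exp (Real.pi / 2 * z ^ 2) * gauss z :=
        mul_le_mul_of_nonneg_right h1 (gauss_pos z).le
    _ = _ := by unfold gauss; rw [← Real.exp_add]; ring_nf

/-- Integration by parts, the derivative of sgn being twice the Dirac mass at 0. -/
lemma integral_sign_mul_deriv {k k' : ℝ → ℝ} (hk : ∀ y, HasDerivAt k (k' y) y)
    (hk' : Integrable k') (h0 : Tendsto k atTop (𝓝 0)) (h1 : Tendsto k atBot (𝓝 0)) :
    ∫ y, Real.sign y * k' y = -2 * k 0 := by
  rw [integral_sign_mul hk',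
    integral_Ioi_of_hasDerivAt_of_tendsto' (fun y _ => hk y) hk'.integrableOn h0,
    integral_Iic_of_hasDerivAt_of_tendsto' (fun y _ => hk y) hk'.integrableOn h1]
  ring

lemma tendsto_gauss_atTop : Tendsto gauss atTop (𝓝 0) := by
  unfold gauss
  refine Real.tendsto_exp_atBot.comp ?_
  exact (tendsto_pow_atTop two_ne_zero).const_mul_atTop_of_neg (by linarith [Real.pi_pos])

lemma tendsto_gauss_atBot : Tendsto gauss atBot (𝓝 0) := by
  have := tendsto_gauss_atTop.comp tendsto_neg_atBot_atTop
  refine this.congr fun x => gauss_neg x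

lemma hasDerivAt_gauss (x : ℝ) : HasDerivAt gauss (-2 * Real.pi * x * gauss x) x := by
  unfold gauss
  convert ((hasDerivAt_pow 2 x).const_mul (-Real.pi)).exp using 1
  simp; ring

lemma integrable_mul_gauss_mul_E1 (α u₁ u₂ : ℝ) :
    Integrable fun y => (y - u₂) * gauss (y - u₂) * E1 (u₁ + α * y) := by
  refine Integrable.mul_bdd (c := 1) ?_
    (by exact (by fun_prop : Continuous fun y => E1 (u₁ + α * y)).aestronglyMeasurable)
    (Eventually.of_forall fun y => by simpa using abs_E1_le _)
  have h : Integrable fun y : ℝ => y * gauss y := by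
    unfold gauss; exact integrable_mul_exp_neg_mul_sq Real.pi_pos
  exact h.comp_sub_right u₂

/-- Differentiation lowers the depth: along any line only products of a Gaussian and an E₁ survive.
The first product is the boundary term at the jump of sgn, the second is a Gaussian integral
evaluated after the rotation `gauss_mul_gauss`. -/
lemma hasDerivAt_E2Gauss (α p₁ s₁ p₂ s₂ a : ℝ) :
    HasDerivAt (fun a => E2Gauss α (p₁ + s₁ * a) (p₂ + s₂ * a))
      (2 * s₂ * gauss (p₂ + s₂ * a) * E1 (p₁ + s₁ * a) +
        2 * ((s₁ + α * s₂) / √(1 + α ^ 2)) *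
          gauss ((p₁ + s₁ * a + α * (p₂ + s₂ * a)) / √(1 + α ^ 2)) *
          E1 ((p₂ + s₂ * a - α * (p₁ + s₁ * a)) / √(1 + α ^ 2))) a := by
  set c := √(1 + α ^ 2) with hc
  have hc0 : 0 < c := by positivity
  have hd : ∀ y x, HasDerivAt (fun x => gauss (y - (p₂ + s₂ * x)) * E1 (p₁ + s₁ * x + α * y))
      (2 * Real.pi * s₂ * ((y - (p₂ + s₂ * x)) * gauss (y - (p₂ + s₂ * x))
          * E1 (p₁ + s₁ * x + α * y))
        + 2 * s₁ * (gauss (y - (p₂ + s₂ * x)) * gauss (p₁ + s₁ * x + α * y))) x := by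
    intro y x
    have h1 : HasDerivAt (fun x => y - (p₂ + s₂ * x)) (-s₂) x := by
      simpa using (((hasDerivAt_id x).const_mul s₂).const_add p₂).const_sub y
    have h2 : HasDerivAt (fun x => p₁ + s₁ * x + α * y) s₁ x := by
      simpa using (((hasDerivAt_id x).const_mul s₁).const_add p₁).add_const (α * y)
    have := ((hasDerivAt_gauss _).comp x h1).mul ((hasDerivAt_E1 _).comp x h2)
    refine this.congr_deriv ?_
    simp only [Function.comp]
    ring
  have hmain := (hasDerivAt_integral_of_dominated_loc_of_deriv_le (s := Metric.ball a 1)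
    (μ := volume) (x₀ := a)
    (F := fun x y => Real.sign y * (gauss (y - (p₂ + s₂ * x)) * E1 (p₁ + s₁ * x + α * y)))
    (F' := fun x y => Real.sign y *
      (2 * Real.pi * s₂ * ((y - (p₂ + s₂ * x)) * gauss (y - (p₂ + s₂ * x))
          * E1 (p₁ + s₁ * x + α * y))
        + 2 * s₁ * (gauss (y - (p₂ + s₂ * x)) * gauss (p₁ + s₁ * x + α * y))))
    (bound := fun y => (2 * Real.pi * |s₂| + 2 * |s₁|) * (Real.exp (Real.pi / 2 * s₂ ^ 2) *
      Real.exp (-(Real.pi / 4) * (y - (p₂ + s₂ * a)) ^ 2)))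
    (Metric.ball_mem_nhds a one_pos)
    (Eventually.of_forall fun x =>
      (integrable_sign_mul (integrable_gauss_mul_E1 α _ _)).aestronglyMeasurable)
    (integrable_sign_mul (integrable_gauss_mul_E1 α _ _)) ?_ ?_ ?_ ?_).2
  · have hk : ∀ y, HasDerivAt (fun y => gauss (y - (p₂ + s₂ * a)) * E1 (p₁ + s₁ * a + α * y))
        (-2 * Real.pi * ((y - (p₂ + s₂ * a)) * gauss (y - (p₂ + s₂ * a))
          * E1 (p₁ + s₁ * a + α * y))
        + 2 * α * (gauss (y - (p₂ + s₂ * a)) * gauss (p₁ + s₁ * a + α * y))) y := by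
      intro y
      have h1 : HasDerivAt (fun y => y - (p₂ + s₂ * a)) 1 y := (hasDerivAt_id y).sub_const _
      have h2 : HasDerivAt (fun y => p₁ + s₁ * a + α * y) α y := by
        simpa using ((hasDerivAt_id y).const_mul α).const_add (p₁ + s₁ * a)
      have := ((hasDerivAt_gauss _).comp y h1).mul ((hasDerivAt_E1 _).comp y h2)
      refine this.congr_deriv ?_
      simp only [Function.comp]
      ring
    have hk' := ((integrable_mul_gauss_mul_E1 α (p₁ + s₁ * a) (p₂ + s₂ * a)).const_mul
      (-2 * Real.pi)).add
      ((integrable_gauss_mul_gauss α (p₁ + s₁ * a) (p₂ + s₂ * a)).const_mul (2 * α))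
    have hz : ∀ l : Filter ℝ, Tendsto (fun y => gauss (y - (p₂ + s₂ * a))) l (𝓝 0) →
        Tendsto (fun y => gauss (y - (p₂ + s₂ * a)) * E1 (p₁ + s₁ * a + α * y)) l (𝓝 0) := by
      intro l hl
      refine squeeze_zero_norm (fun y => ?_) hl
      rw [norm_mul, Real.norm_eq_abs, abs_of_pos (gauss_pos _), Real.norm_eq_abs]
      exact mul_le_of_le_one_right (gauss_pos _).le (abs_E1_le _)
    have hI := integral_sign_mul_deriv hk hk'
      (hz _ (tendsto_gauss_atTop.comp (tendsto_atTop_add_const_right _ _ tendsto_id)))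
      (hz _ (tendsto_gauss_atBot.comp (tendsto_atBot_add_const_right _ _ tendsto_id)))
    have hG : ∫ y, Real.sign y * (gauss (y - (p₂ + s₂ * a)) * gauss (p₁ + s₁ * a + α * y)) =
        gauss ((p₁ + s₁ * a + α * (p₂ + s₂ * a)) / c) *
          (c⁻¹ * E1 ((p₂ + s₂ * a - α * (p₁ + s₁ * a)) / c)) := by
      simp_rw [gauss_mul_gauss, mul_left_comm (Real.sign _)]
      rw [integral_const_mul, integral_sign_mul_gauss_mul hc0]
    refine hmain.congr_deriv ?_
    -- The derivative in the parameter is -s₂ times the derivative in y, up to a product of two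
    -- Gaussians. The first part integrates to the boundary term, and the multiples of (y - u₂)
    -- disappear.
    have hsplit : ∀ y, Real.sign y *
      (2 * Real.pi * s₂ * ((y - (p₂ + s₂ * a)) * gauss (y - (p₂ + s₂ * a))
          * E1 (p₁ + s₁ * a + α * y))
        + 2 * s₁ * (gauss (y - (p₂ + s₂ * a)) * gauss (p₁ + s₁ * a + α * y))) =
        -s₂ * (Real.sign y * (-2 * Real.pi * ((y - (p₂ + s₂ * a)) * gauss (y - (p₂ + s₂ * a))
          * E1 (p₁ + s₁ * a + α * y))
        + 2 * α * (gauss (y - (p₂ + s₂ * a)) * gauss (p₁ + s₁ * a + α * y)))) +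
        2 * (s₁ + α * s₂) * (Real.sign y *
          (gauss (y - (p₂ + s₂ * a)) * gauss (p₁ + s₁ * a + α * y))) := fun y => by ring
    simp_rw [hsplit]
    have hk'' := integrable_sign_mul hk'
    simp only [Pi.add_apply] at hk''
    rw [integral_add (hk''.const_mul _)
      ((integrable_sign_mul (integrable_gauss_mul_gauss _ _ _)).const_mul _),
      integral_const_mul, integral_const_mul, hG, hI, mul_zero, add_zero, zero_sub, gauss_neg]
    field_simp
  · exact (integrable_sign_mul (((integrable_mul_gauss_mul_E1 α _ _).const_mul _).add
      ((integrable_gauss_mul_gauss α _ _).const_mul _))).aestronglyMeasurable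
  · refine Eventually.of_forall fun y x hx => ?_
    rw [Metric.mem_ball, Real.dist_eq] at hx
    set z := y - (p₂ + s₂ * x) with hz
    have hzb : Real.exp (-(Real.pi / 2) * z ^ 2) ≤ Real.exp (Real.pi / 2 * s₂ ^ 2) *
        Real.exp (-(Real.pi / 4) * (y - (p₂ + s₂ * a)) ^ 2) := by
      rw [← Real.exp_add, Real.exp_le_exp]
      have h1 : y - (p₂ + s₂ * a) = z + s₂ * (x - a) := by rw [hz]; ring
      have h2 : (s₂ * (x - a)) ^ 2 ≤ s₂ ^ 2 := by
        rw [mul_pow]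
        have : (x - a) ^ 2 ≤ 1 := by rw [← sq_abs]; nlinarith [abs_nonneg (x - a)]
        nlinarith [sq_nonneg s₂]
      rw [h1]
      have h3 : (z + s₂ * (x - a)) ^ 2 ≤ 2 * z ^ 2 + 2 * s₂ ^ 2 := by
        nlinarith [sq_nonneg (z - s₂ * (x - a))]
      nlinarith [Real.pi_pos]
    have hz1 := abs_mul_gauss_le z
    have hz2 : gauss z ≤ Real.exp (-(Real.pi / 2) * z ^ 2) := by
      unfold gauss; rw [Real.exp_le_exp]; nlinarith [Real.pi_pos, mul_nonneg Real.pi_pos.le (sq_nonneg z)]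
    rw [norm_mul, Real.norm_eq_abs]
    refine (mul_le_of_le_one_left (norm_nonneg _) (abs_sign_le y)).trans ?_
    refine (norm_add_le _ _).trans ?_
    have e1 : ‖2 * Real.pi * s₂ * (z * gauss z * E1 (p₁ + s₁ * x + α * y))‖ ≤
        2 * Real.pi * |s₂| * (|z| * gauss z) := by
      rw [norm_mul, norm_mul (z * gauss z), norm_mul z, norm_mul (2 * Real.pi)]
      simp only [Real.norm_eq_abs, abs_of_pos (gauss_pos z), abs_of_pos Real.two_pi_pos]
      refine mul_le_mul_of_nonneg_left ?_ (by positivity)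
      exact mul_le_of_le_one_right (mul_nonneg (abs_nonneg _) (gauss_pos _).le) (abs_E1_le _)
    have e2 : ‖2 * s₁ * (gauss z * gauss (p₁ + s₁ * x + α * y))‖ ≤ 2 * |s₁| * gauss z := by
      rw [norm_mul, norm_mul 2, norm_mul (gauss z)]
      simp only [Real.norm_eq_abs, abs_of_pos (gauss_pos _), abs_two]
      refine mul_le_mul_of_nonneg_left ?_ (by positivity)
      exact mul_le_of_le_one_right (gauss_pos _).le (gauss_le_one _)
    calc _ ≤ 2 * Real.pi * |s₂| * (|z| * gauss z) + 2 * |s₁| * gauss z := add_le_add e1 e2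
      _ ≤ 2 * Real.pi * |s₂| * Real.exp (-(Real.pi / 2) * z ^ 2) +
          2 * |s₁| * Real.exp (-(Real.pi / 2) * z ^ 2) := by gcongr
      _ = (2 * Real.pi * |s₂| + 2 * |s₁|) * Real.exp (-(Real.pi / 2) * z ^ 2) := by ring
      _ ≤ _ := mul_le_mul_of_nonneg_left hzb (by positivity)
  · exact (((integrable_exp_neg_mul_sq (by positivity : 0 < Real.pi / 4)).comp_sub_right
      (p₂ + s₂ * a)).const_mul _).const_mul _
  · exact Eventually.of_forall fun y x _ => (hd y x).const_mul _

lemma continuousAt_sign {x : ℝ} (hx : x ≠ 0) : ContinuousAt Real.sign x := by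
  rcases lt_or_gt_of_ne hx with h | h
  · refine (continuousAt_const (y := (-1 : ℝ))).congr ?_
    filter_upwards [Iio_mem_nhds h] with y hy using (Real.sign_of_neg hy).symm
  · refine (continuousAt_const (y := (1 : ℝ))).congr ?_
    filter_upwards [Ioi_mem_nhds h] with y hy using (Real.sign_of_pos hy).symm

/-- With the shift moved from the Gaussian into the sign, `gauss` dominates the integrand for all
parameters at once. This gives continuity, the jump of sgn being a null set. -/
lemma E2Gauss_eq_shift (α u₁ u₂ : ℝ) : E2Gauss α u₁ u₂ =
    ∫ y, Real.sign (y + u₂) * (gauss y * E1 (u₁ + α * (y + u₂))) := by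
  rw [E2Gauss, ← integral_add_right_eq_self _ u₂]
  simp

lemma continuous_E2Gauss (α : ℝ) : Continuous fun p : ℝ × ℝ => E2Gauss α p.1 p.2 := by
  simp_rw [E2Gauss_eq_shift]
  refine continuous_iff_continuousAt.2 fun p => ?_
  refine continuousAt_of_dominated (bound := gauss) ?_ ?_ integrable_gauss ?_
  · refine Eventually.of_forall fun p => ?_
    refine AEStronglyMeasurable.mul
      (measurable_sign.comp (measurable_id.add_const _)).aestronglyMeasurable ?_
    exact (by fun_prop : Continuous fun y => gauss y * E1 (p.1 + α * (y + p.2))).aestronglyMeasurable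
  · refine Eventually.of_forall fun p => Eventually.of_forall fun y => ?_
    rw [norm_mul, norm_mul, Real.norm_eq_abs, Real.norm_eq_abs, Real.norm_eq_abs,
      abs_of_pos (gauss_pos y)]
    exact (mul_le_of_le_one_left (by have := gauss_pos y; positivity) (abs_sign_le _)).trans
      (mul_le_of_le_one_right (gauss_pos y).le (abs_E1_le _))
  · have : ∀ᵐ y : ℝ, y ≠ -p.2 := by simp [ae_iff, measure_singleton]
    filter_upwards [this] with y hy
    have hs : ContinuousAt (fun q : ℝ × ℝ => Real.sign (y + q.2)) p :=
      ContinuousAt.comp (f := fun q : ℝ × ℝ => y + q.2)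
        (continuousAt_sign fun h => hy (by linarith)) (by fun_prop)
    exact hs.mul (by fun_prop)

end

section

open MeasureTheory Set

/-! ### Identification of the double error function -/

/-- The reciprocal 1/(x - ζ) is a Laplace integral over t > 0, with σ chosen by the half-plane
containing ζ. After exchanging the integrals, the x-integral is the Fourier transform of a Gaussian.
-/
lemma integral_cexp_div_sub {σ : ℝ} {ζ : ℂ} (hζ : 0 < σ * ζ.im) (b : ℝ) :
    ∫ x : ℝ, cexp (-Real.pi * x ^ 2 - 2 * Real.pi * I * b * x) / (x - ζ) =
      2 * Real.pi * I * σ *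
        ∫ t in Ioi (0 : ℝ), cexp (2 * Real.pi * I * σ * t * ζ) * (gauss (σ * t + b) : ℂ) := by
  have hre : ∀ x : ℝ, (-(2 * Real.pi * I * σ * (x - ζ))).re = -(2 * Real.pi * (σ * ζ.im)) := by
    intro x; simp; ring
  have hπ : (0 : ℝ) < 2 * Real.pi * (σ * ζ.im) := by have := Real.pi_pos; positivity
  have hinv : ∀ x : ℝ, ((x : ℂ) - ζ)⁻¹ = 2 * Real.pi * I * σ *
      ∫ t in Ioi (0 : ℝ), cexp (-(2 * Real.pi * I * σ * (x - ζ)) * t) := by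
    intro x
    have ha : (-(2 * Real.pi * I * σ * (x - ζ))).re < 0 := by rw [hre]; linarith
    have hne : (-(2 * Real.pi * I * σ * (x - ζ))) ≠ 0 := fun h => by simp [h] at ha
    rw [integral_exp_mul_complex_Ioi ha]
    simp only [ofReal_zero, mul_zero, Complex.exp_zero]
    have h1 : (2 * Real.pi * I * σ : ℂ) ≠ 0 := fun h => by simp [h] at hne
    have h2 : (x : ℂ) - ζ ≠ 0 := fun h => by simp [h] at hne
    rw [neg_div_neg_eq, ← mul_div_assoc, mul_one, div_mul_cancel_left₀ h1]
  have hint : Integrable (Function.uncurry fun (x t : ℝ) =>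
      cexp (-Real.pi * x ^ 2 - 2 * Real.pi * I * b * x) *
        cexp (-(2 * Real.pi * I * σ * (x - ζ)) * t))
      ((volume : Measure ℝ).prod (volume.restrict (Ioi 0))) := by
    have hg : Integrable (fun z : ℝ × ℝ => gauss z.1 * Real.exp (-(2 * Real.pi * (σ * ζ.im)) * z.2))
        ((volume : Measure ℝ).prod (volume.restrict (Ioi 0))) :=
      integrable_gauss.mul_prod (integrableOn_exp_mul_Ioi (by linarith) 0)
    refine hg.mono (by fun_prop) (Eventually.of_forall fun z => ?_)
    simp only [Function.uncurry]
    rw [norm_mul, norm_exp, norm_exp, norm_mul, Real.norm_eq_abs, abs_of_pos (gauss_pos _),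
      Real.norm_eq_abs, Real.abs_exp]
    refine le_of_eq ?_
    congr 2
    · have h3 : (-(Real.pi : ℂ) * z.1 ^ 2 - 2 * Real.pi * I * b * z.1) =
          ((-Real.pi * z.1 ^ 2 : ℝ) : ℂ) + ((-2 * Real.pi * b * z.1 : ℝ) : ℂ) * I := by
        push_cast; ring
      rw [h3, add_re, ofReal_re, re_ofReal_mul, I_re]; ring
    · rw [re_mul_ofReal, hre]
  calc _ = ∫ x : ℝ, 2 * Real.pi * I * σ * ∫ t in Ioi (0 : ℝ),
        cexp (-Real.pi * x ^ 2 - 2 * Real.pi * I * b * x) *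
        cexp (-(2 * Real.pi * I * σ * (x - ζ)) * t) := by
        congr 1; ext x
        rw [div_eq_mul_inv, hinv, integral_const_mul]; ring
    _ = 2 * Real.pi * I * σ * ∫ t in Ioi (0 : ℝ), ∫ x : ℝ,
        cexp (-Real.pi * x ^ 2 - 2 * Real.pi * I * b * x) *
        cexp (-(2 * Real.pi * I * σ * (x - ζ)) * t) := by
        rw [integral_const_mul, integral_integral_swap hint]
    _ = _ := by
        congr 1
        refine setIntegral_congr_fun measurableSet_Ioi fun t _ => ?_
        have h := fourierIntegral_gaussian (b := Real.pi) (by simpa using Real.pi_pos)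
          (-(2 * Real.pi * (b + σ * t)))
        rw [div_self (by simp [Real.pi_ne_zero]), one_cpow, one_mul] at h
        have hg : cexp (-(-(2 * Real.pi * (b + σ * t))) ^ 2 / (4 * Real.pi)) =
            (gauss (σ * t + b) : ℂ) := by
          unfold gauss; push_cast; congr 1
          have : (Real.pi : ℂ) ≠ 0 := by simp [Real.pi_ne_zero]
          field_simp; ring
        rw [← hg, ← h, ← integral_const_mul]
        congr 1; ext x
        rw [← Complex.exp_add, ← Complex.exp_add, ← Complex.exp_add]
        congr 1; ring

lemma sigma_sub_E1 {σ : ℝ} (hσ : σ = 1 ∨ σ = -1) (b : ℝ) :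
    2 * σ * ∫ s in Ioi (0 : ℝ), gauss (b + σ * s) = σ - E1 b := by
  rcases hσ with rfl | rfl
  · have := one_sub_E1 b
    simp only [one_mul, mul_one, add_comm b]
    linarith
  · have h := one_sub_E1 (-b)
    have : ∀ s : ℝ, gauss (b + -1 * s) = gauss (s + -b) := fun s => by rw [← gauss_neg]; ring_nf
    simp only [this]
    rw [E1_neg] at h
    linarith

/-- On the contour z = x - iu the exponent -πz² - 2πiuz equals -πx² - πu². The zero frequency is
written out so that the inner integral matches `integral_cexp_div_sub`. -/
lemma M2Integrand_contour (α u₁ u₂ x₁ x₂ : ℝ) :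
    M2Integrand α u₁ u₂ (x₁ - I * u₁) (x₂ - I * u₂) =
      gauss u₁ * gauss u₂ * (cexp (-Real.pi * x₁ ^ 2) / (x₁ - I * u₁) *
      (cexp (-Real.pi * x₂ ^ 2 - 2 * Real.pi * I * (0 : ℝ) * x₂) /
        (x₂ - (α * x₁ + I * (u₂ - α * u₁))))) := by
  unfold M2Integrand gauss
  push_cast
  rw [div_mul_div_comm, ← Complex.exp_add, ← Complex.exp_add, ← mul_div_assoc, ← Complex.exp_add]
  congr 2
  · linear_combination (Real.pi * (u₁ ^ 2 + u₂ ^ 2) : ℂ) * I_sq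
  · ring

/-- Both contour integrals are evaluated with `integral_cexp_div_sub`. The signs σ₂ and σ₁ record on
which side of the real axis the poles in x₂ and x₁ lie, and the remaining double integral is an
iterated Gaussian tail. -/
lemma M2_eq_of_sigma {α u₁ u₂ σ₁ σ₂ : ℝ} (h1 : σ₁ = 1 ∨ σ₁ = -1) (h2 : σ₂ = 1 ∨ σ₂ = -1)
    (hu : 0 < σ₁ * u₁) (hδ : 0 < σ₂ * (u₂ - α * u₁)) :
    M2 α u₁ u₂ = ((2 * σ₂ * ∫ t in Ioi (0 : ℝ),
      gauss (u₂ + σ₂ * t) * (σ₁ - E1 (u₁ - α * (σ₂ * t))) : ℝ) : ℂ) := by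
  have hs2 : σ₂ ^ 2 = 1 := by rcases h2 with rfl | rfl <;> norm_num
  have hu0 : u₁ ≠ 0 := fun h => by simp [h] at hu
  have hin : ∀ x₁ : ℝ, ∫ x₂ : ℝ, M2Integrand α u₁ u₂ (x₁ - I * u₁) (x₂ - I * u₂) =
      gauss u₁ * gauss u₂ * (2 * Real.pi * I * σ₂) * ∫ t in Ioi (0 : ℝ),
        cexp (-Real.pi * x₁ ^ 2) / (x₁ - I * u₁) *
          (cexp (2 * Real.pi * I * σ₂ * t * (α * x₁ + I * (u₂ - α * u₁))) *
            (gauss (σ₂ * t + 0) : ℂ)) := by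
    intro x₁
    simp_rw [M2Integrand_contour]
    rw [integral_const_mul, integral_const_mul, integral_cexp_div_sub (by simpa using hδ),
      integral_const_mul]
    ring
  have hne : ∀ x : ℝ, (x : ℂ) - I * u₁ ≠ 0 := fun x h => hu0 (by simpa using congrArg Complex.im h)
  have hcont : Continuous fun z : ℝ × ℝ => cexp (-Real.pi * z.1 ^ 2) / (z.1 - I * u₁) *
          (cexp (2 * Real.pi * I * σ₂ * z.2 * (α * z.1 + I * (u₂ - α * u₁))) *
            (gauss (σ₂ * z.2 + 0) : ℂ)) := by
    refine Continuous.mul (Continuous.div (by fun_prop) (by fun_prop) fun z => hne _) ?_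
    fun_prop
  have hint : Integrable (Function.uncurry fun (x₁ t : ℝ) =>
      cexp (-Real.pi * x₁ ^ 2) / (x₁ - I * u₁) *
          (cexp (2 * Real.pi * I * σ₂ * t * (α * x₁ + I * (u₂ - α * u₁))) *
            (gauss (σ₂ * t + 0) : ℂ)))
      ((volume : Measure ℝ).prod (volume.restrict (Ioi 0))) := by
    have hg : Integrable (fun z : ℝ × ℝ => gauss z.1 * |u₁|⁻¹ * gauss z.2)
        ((volume : Measure ℝ).prod (volume.restrict (Ioi 0))) :=
      (integrable_gauss.mul_const _).mul_prod integrable_gauss.integrableOn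
    refine hg.mono hcont.aestronglyMeasurable ?_
    have : ∀ᵐ z ∂((volume : Measure ℝ).prod (volume.restrict (Ioi (0 : ℝ)))), z.2 ∈ Ioi (0 : ℝ) :=
      Measure.quasiMeasurePreserving_snd.ae (ae_restrict_mem measurableSet_Ioi)
    filter_upwards [this] with z hz
    simp only [Function.uncurry]
    have e1 : ‖(gauss (σ₂ * z.2 + 0) : ℂ)‖ = gauss z.2 := by
      rw [norm_real, Real.norm_eq_abs, abs_of_pos (gauss_pos _)]
      unfold gauss; rw [add_zero, mul_pow, hs2, one_mul]
    have e2 : ‖cexp (2 * Real.pi * I * σ₂ * z.2 * (α * z.1 + I * (u₂ - α * u₁)))‖ ≤ 1 := by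
      rw [norm_exp, Real.exp_le_one_iff]
      have : (2 * Real.pi * I * σ₂ * z.2 * (α * z.1 + I * (u₂ - α * u₁))).re =
          -(2 * Real.pi * z.2 * (σ₂ * (u₂ - α * u₁))) := by simp; ring
      rw [this]
      have := Real.pi_pos
      have hz' : 0 < z.2 := hz
      have := mul_pos (mul_pos Real.two_pi_pos hz') hδ
      linarith
    have e3 : ‖cexp (-Real.pi * z.1 ^ 2) / (z.1 - I * u₁)‖ ≤ gauss z.1 * |u₁|⁻¹ := by
      rw [norm_div, norm_exp, div_eq_mul_inv]
      have h3 : (-(Real.pi : ℂ) * z.1 ^ 2).re = -Real.pi * z.1 ^ 2 := by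
        rw [← ofReal_pow, ← ofReal_neg, ← ofReal_mul, ofReal_re]
      rw [h3]
      refine mul_le_mul_of_nonneg_left ?_ (Real.exp_pos _).le
      refine inv_anti₀ (abs_pos.2 hu0) ?_
      have := abs_im_le_norm ((z.1 : ℂ) - I * u₁)
      simpa using this
    rw [norm_mul, norm_mul, norm_mul, e1, Real.norm_eq_abs, Real.norm_eq_abs,
      abs_of_pos (gauss_pos z.2), abs_of_nonneg (by have := gauss_pos z.1; positivity)]
    refine mul_le_mul e3 (mul_le_of_le_one_left (gauss_pos _).le e2)
      (mul_nonneg (norm_nonneg _) (gauss_pos _).le) (by have := gauss_pos z.1; positivity)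
  unfold M2
  simp_rw [hin]
  rw [integral_const_mul, integral_integral_swap hint]
  have hstep : ∀ t : ℝ, ∫ x₁ : ℝ, cexp (-Real.pi * x₁ ^ 2) / (x₁ - I * u₁) *
          (cexp (2 * Real.pi * I * σ₂ * t * (α * x₁ + I * (u₂ - α * u₁))) *
            (gauss (σ₂ * t + 0) : ℂ)) =
      (2 * Real.pi * I * σ₁) * ((gauss (σ₂ * t) * Real.exp (-2 * Real.pi * (σ₂ * t * (u₂ - α * u₁))) *
        ∫ s in Ioi (0 : ℝ), Real.exp (-2 * Real.pi * (σ₁ * s * u₁)) * gauss (σ₁ * s - σ₂ * t * α) : ℝ) : ℂ) := by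
    intro t
    have h := integral_cexp_div_sub (ζ := I * u₁) (by simpa using hu) (-(σ₂ * t * α))
    have e1 : ∀ x₁ : ℝ, cexp (-Real.pi * x₁ ^ 2) / (x₁ - I * u₁) *
          (cexp (2 * Real.pi * I * σ₂ * t * (α * x₁ + I * (u₂ - α * u₁))) *
            (gauss (σ₂ * t + 0) : ℂ)) =
        ((gauss (σ₂ * t) * Real.exp (-2 * Real.pi * (σ₂ * t * (u₂ - α * u₁))) : ℝ) : ℂ) *
        (cexp (-Real.pi * x₁ ^ 2 - 2 * Real.pi * I * (-(σ₂ * t * α) : ℝ) * x₁) / (x₁ - I * u₁)) := by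
      intro x₁
      rw [add_zero]
      push_cast
      rw [div_mul_eq_mul_div, mul_div_assoc']
      congr 1
      rw [mul_comm (cexp (2 * Real.pi * I * σ₂ * t * (α * x₁ + I * (u₂ - α * u₁)))),
        mul_left_comm, ← Complex.exp_add, mul_assoc (gauss (σ₂ * t) : ℂ), ← Complex.exp_add]
      congr 2
      linear_combination (2 * Real.pi * σ₂ * t * (u₂ - α * u₁) : ℂ) * I_sq
    simp_rw [e1]
    rw [integral_const_mul, h]
    have e2 : ∫ s in Ioi (0 : ℝ), cexp (2 * Real.pi * I * σ₁ * s * (I * u₁)) *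
        (gauss (σ₁ * s + -(σ₂ * t * α)) : ℂ) =
        ((∫ s in Ioi (0 : ℝ), Real.exp (-2 * Real.pi * (σ₁ * s * u₁)) *
          gauss (σ₁ * s - σ₂ * t * α) : ℝ) : ℂ) := by
      rw [← integral_complex_ofReal]
      congr 1; ext s
      push_cast
      rw [sub_eq_add_neg]
      congr 2
      linear_combination (2 * Real.pi * σ₁ * s * u₁ : ℂ) * I_sq
    rw [e2]
    push_cast
    ring
  simp_rw [hstep]
  rw [integral_const_mul, integral_complex_ofReal]
  have hfin : (2 * σ₂ * ∫ t in Ioi (0 : ℝ), gauss (u₂ + σ₂ * t) * (σ₁ - E1 (u₁ - α * (σ₂ * t)))) =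
      4 * σ₁ * σ₂ * (gauss u₁ * gauss u₂ * ∫ t in Ioi (0 : ℝ),
        gauss (σ₂ * t) * Real.exp (-2 * Real.pi * (σ₂ * t * (u₂ - α * u₁))) *
        ∫ s in Ioi (0 : ℝ), Real.exp (-2 * Real.pi * (σ₁ * s * u₁)) * gauss (σ₁ * s - σ₂ * t * α)) := by
    simp_rw [← sigma_sub_E1 h1, ← integral_const_mul]
    refine setIntegral_congr_fun measurableSet_Ioi fun t _ => ?_
    refine setIntegral_congr_fun measurableSet_Ioi fun s _ => ?_
    have : gauss (u₂ + σ₂ * t) * gauss (u₁ - α * (σ₂ * t) + σ₁ * s) = gauss u₁ * gauss u₂ *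
        (gauss (σ₂ * t) * Real.exp (-2 * Real.pi * (σ₂ * t * (u₂ - α * u₁))) *
        (Real.exp (-2 * Real.pi * (σ₁ * s * u₁)) * gauss (σ₁ * s - σ₂ * t * α))) := by
      unfold gauss
      simp only [← Real.exp_add]
      congr 1; ring
    linear_combination (4 * σ₁ * σ₂) * this
  rw [hfin]
  have hπ : (Real.pi : ℂ) ≠ 0 := by simp [Real.pi_ne_zero]
  generalize (∫ t in Ioi (0 : ℝ), gauss (σ₂ * t) * Real.exp (-2 * Real.pi * (σ₂ * t * (u₂ - α * u₁))) *
        ∫ s in Ioi (0 : ℝ), Real.exp (-2 * Real.pi * (σ₁ * s * u₁)) *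
          gauss (σ₁ * s - σ₂ * t * α)) = J
  push_cast
  field_simp
  linear_combination (-4 * (σ₁ : ℂ) * σ₂ * gauss u₁ * gauss u₂ * J) * I_sq

/-- The complementary double error function, as a Gaussian integral over all arguments. -/
def M2Gauss (α u₁ u₂ : ℝ) : ℝ :=
  ∫ y, (Real.sign (u₂ - α * u₁) - Real.sign y) *
    (gauss (y - u₂) * (Real.sign u₁ - E1 (u₁ + α * y)))

lemma M2Gauss_eq (α u₁ u₂ : ℝ) : M2Gauss α u₁ u₂ =
    Real.sign u₁ * Real.sign (u₂ - α * u₁)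
      - Real.sign (u₂ - α * u₁) * E1 ((u₁ + α * u₂) / √(1 + α ^ 2))
      - Real.sign u₁ * E1 u₂ + E2Gauss α u₁ u₂ := by
  unfold M2Gauss
  generalize Real.sign (u₂ - α * u₁) = ε₂
  generalize Real.sign u₁ = ε₁
  have h1 := (integrable_gauss_sub u₂).const_mul (ε₁ * ε₂)
  have h2 := (integrable_gauss_mul_E1 α u₁ u₂).const_mul ε₂
  have h3 := (integrable_sign_mul (integrable_gauss_sub u₂)).const_mul ε₁
  have h4 := integrable_sign_mul (integrable_gauss_mul_E1 α u₁ u₂)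
  have : ∀ y, (ε₂ - Real.sign y) * (gauss (y - u₂) * (ε₁ - E1 (u₁ + α * y))) =
      ε₁ * ε₂ * gauss (y - u₂) - ε₂ * (gauss (y - u₂) * E1 (u₁ + α * y))
      - ε₁ * (Real.sign y * gauss (y - u₂))
      + Real.sign y * (gauss (y - u₂) * E1 (u₁ + α * y)) := fun y => by ring
  simp_rw [this]
  have h12 := h1.sub h2
  have h123 := h12.sub h3
  simp only [Pi.sub_def] at h12 h123
  rw [integral_add h123 h4, integral_sub h12 h3, integral_sub h1 h2,
    integral_const_mul, integral_const_mul, integral_const_mul, integral_gauss_sub,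
    integral_gauss_mul_E1, integral_sign_mul_gauss, mul_one, E2Gauss]

lemma sign_eq_or {x : ℝ} (hx : x ≠ 0) : Real.sign x = 1 ∨ Real.sign x = -1 := by
  rcases lt_or_gt_of_ne hx with h | h
  · exact Or.inr (Real.sign_of_neg h)
  · exact Or.inl (Real.sign_of_pos h)

lemma sign_mul_self_pos {x : ℝ} (hx : x ≠ 0) : 0 < Real.sign x * x := by
  rcases lt_or_gt_of_ne hx with h | h
  · rw [Real.sign_of_neg h]; linarith
  · rw [Real.sign_of_pos h]; linarith

/-- The difference sgn(u₂ - αu₁) - sgn y vanishes on one half-line and is ±2 on the other. That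
half-line is parametrized by y = -σ₂t in `M2_eq_of_sigma`. -/
lemma M2_eq_M2Gauss {α u₁ u₂ : ℝ} (h1 : u₁ ≠ 0) (h2 : u₂ ≠ α * u₁) :
    M2 α u₁ u₂ = (M2Gauss α u₁ u₂ : ℂ) := by
  have h2' : u₂ - α * u₁ ≠ 0 := sub_ne_zero.2 h2
  rw [M2_eq_of_sigma (sign_eq_or h1) (sign_eq_or h2') (sign_mul_self_pos h1)
    (sign_mul_self_pos h2')]
  congr 1
  unfold M2Gauss
  generalize Real.sign u₁ = ε₁
  have hK : Integrable fun y => gauss (y - u₂) * (ε₁ - E1 (u₁ + α * y)) := by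
    have := ((integrable_gauss_sub u₂).const_mul ε₁).sub (integrable_gauss_mul_E1 α u₁ u₂)
    refine this.congr (Eventually.of_forall fun y => ?_)
    simp only [Pi.sub_apply]; ring
  have hs := integral_sign_mul hK
  have hsum := integral_add_compl (measurableSet_Ioi (a := (0 : ℝ))) hK
  rw [compl_Ioi] at hsum
  simp_rw [sub_mul]
  rw [integral_sub (hK.const_mul _) (integrable_sign_mul hK), integral_const_mul, hs, ← hsum]
  rcases sign_eq_or h2' with h | h <;> rw [h]
  · have : ∫ y in Iic (0 : ℝ), gauss (y - u₂) * (ε₁ - E1 (u₁ + α * y)) =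
        ∫ t in Ioi (0 : ℝ), gauss (u₂ + 1 * t) * (ε₁ - E1 (u₁ - α * (1 * t))) := by
      rw [← neg_zero, ← integral_comp_neg_Ioi, neg_zero]
      congr 1; ext y; rw [← gauss_neg]; ring_nf
    rw [← this]; ring
  · have : ∫ y in Ioi (0 : ℝ), gauss (y - u₂) * (ε₁ - E1 (u₁ + α * y)) =
        ∫ t in Ioi (0 : ℝ), gauss (u₂ + -1 * t) * (ε₁ - E1 (u₁ - α * (-1 * t))) := by
      congr 1; ext y; rw [← gauss_neg]; ring_nf
    rw [← this]; ring

/-- If adding αu₂ changes the sign of u₁ ≠ 0, then αu₂ and u₁ have opposite signs. Hence -αu₁ and u₂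
have the same sign, and subtracting αu₁ leaves sgn u₂ unchanged. This reconciles the sign products
in the definition of E₂ with those in `M2Gauss_eq`. -/
lemma sign_sub_mul_sign_sub_eq_zero (α u₁ u₂ : ℝ) :
    (Real.sign u₁ - Real.sign (u₁ + α * u₂)) * (Real.sign (u₂ - α * u₁) - Real.sign u₂) = 0 := by
  rcases lt_trichotomy u₁ 0 with h1 | rfl | h1
  · by_cases h : u₁ + α * u₂ < 0
    · rw [Real.sign_of_neg h1, Real.sign_of_neg h]; ring
    · push Not at h
      have hpos : 0 < α * u₂ := by linarith
      have : Real.sign (u₂ - α * u₁) = Real.sign u₂ := by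
        rcases pos_and_pos_or_neg_and_neg_of_mul_pos hpos with ⟨ha, hb⟩ | ⟨ha, hb⟩
        · have := mul_pos ha (neg_pos.2 h1)
          rw [Real.sign_of_pos hb, Real.sign_of_pos (by linarith)]
        · have := mul_pos (neg_pos.2 ha) (neg_pos.2 h1)
          rw [Real.sign_of_neg hb, Real.sign_of_neg (by linarith)]
      rw [this]; ring
  · simp
  · by_cases h : 0 < u₁ + α * u₂
    · rw [Real.sign_of_pos h1, Real.sign_of_pos h]; ring
    · push Not at h
      have hneg : 0 < -α * u₂ := by linarith
      have : Real.sign (u₂ - α * u₁) = Real.sign u₂ := by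
        rcases pos_and_pos_or_neg_and_neg_of_mul_pos hneg with ⟨ha, hb⟩ | ⟨ha, hb⟩
        · have := mul_pos ha h1
          rw [Real.sign_of_pos hb, Real.sign_of_pos (by linarith)]
        · have := mul_pos (neg_pos.2 ha) h1
          rw [Real.sign_of_neg hb, Real.sign_of_neg (by linarith)]
      rw [this]; ring

lemma E2Generic_eq {α : ℝ} {p : ℝ × ℝ} (h : p.1 ≠ 0 ∧ p.2 ≠ α * p.1) :
    E2Generic α p = (E2Gauss α p.1 p.2 : ℂ) := by
  unfold E2Generic
  rw [M2_eq_M2Gauss h.1 h.2, ← ofReal_add]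
  congr 1
  have hsq : Real.sign ((p.1 + α * p.2) / √(1 + α ^ 2)) = Real.sign (p.1 + α * p.2) := by
    rw [div_eq_inv_mul, sign_mul_of_pos (by positivity)]
  rw [M2Gauss_eq, M1_eq, M1_eq, hsq]
  linear_combination sign_sub_mul_sign_sub_eq_zero α p.1 p.2

lemma eventually_add_ne_zero (c : ℝ) : ∀ᶠ t in 𝓝[≠] (0 : ℝ), c + t ≠ 0 := by
  rcases eq_or_ne c 0 with rfl | hc
  · filter_upwards [self_mem_nhdsWithin] with t ht
    simpa using ht
  · have : ∀ᶠ t in 𝓝 (0 : ℝ), c + t ≠ 0 := by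
      have : ContinuousAt (fun t : ℝ => c + t) 0 := by fun_prop
      exact this.eventually_ne (by simpa using hc)
    exact this.filter_mono nhdsWithin_le_nhds

theorem E2_eq_E2Gauss (α u₁ u₂ : ℝ) : E2 α u₁ u₂ = (E2Gauss α u₁ u₂ : ℂ) := by
  unfold E2
  refine extendFrom_eq ?_ ?_
  -- The direction (1, α + 1) is transverse to both excluded lines: along it u₁ and u₂ - αu₁ both
  -- move with unit speed.
  · have ht : Tendsto (fun t : ℝ => (u₁ + t, u₂ + (α + 1) * t)) (𝓝[≠] 0) (𝓝 (u₁, u₂)) := by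
      have : Continuous fun t : ℝ => (u₁ + t, u₂ + (α + 1) * t) := by fun_prop
      have := this.tendsto 0
      simp only [add_zero, mul_zero] at this
      exact this.mono_left nhdsWithin_le_nhds
    refine mem_closure_of_tendsto ht ?_
    filter_upwards [eventually_add_ne_zero u₁, eventually_add_ne_zero (u₂ - α * u₁)] with t h1 h2
    refine ⟨h1, fun h => h2 ?_⟩
    linarith
  · have hc : Tendsto (fun p : ℝ × ℝ => (E2Gauss α p.1 p.2 : ℂ))
        (𝓝[{p : ℝ × ℝ | p.1 ≠ 0 ∧ p.2 ≠ α * p.1}] (u₁, u₂)) (𝓝 (E2Gauss α u₁ u₂ : ℂ)) :=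
      ((continuous_ofReal.comp (continuous_E2Gauss α)).tendsto (u₁, u₂)).mono_left
        nhdsWithin_le_nhds
    refine hc.congr' ?_
    filter_upwards [self_mem_nhdsWithin] with p hp using (E2Generic_eq hp).symm

/-- The sign factor vanishes where y(u₂ - αu₁) > 0. Elsewhere the exponent -π(y - u₂)² - πu₁² -
2παyu₁ equals -π(y² + u₁² + u₂²) + 2πy(u₂ - αu₁), and its last term is nonpositive. -/
lemma abs_M2Gauss_le (α u₁ u₂ : ℝ) : |M2Gauss α u₁ u₂| ≤ 4 * (gauss u₁ * gauss u₂) := by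
  unfold M2Gauss
  have hb : ∀ y, ‖(Real.sign (u₂ - α * u₁) - Real.sign y) *
      (gauss (y - u₂) * (Real.sign u₁ - E1 (u₁ + α * y)))‖ ≤
      4 * (gauss u₁ * gauss u₂) * gauss y := by
    intro y
    have h1 : |Real.sign u₁ - E1 (u₁ + α * y)| ≤
        2 * Real.exp (-Real.pi * u₁ ^ 2 - 2 * Real.pi * (α * y) * u₁) := by
      have := abs_sign_sub_E1_le u₁ (-(α * y))
      rw [sub_neg_eq_add] at this
      refine this.trans (le_of_eq ?_)
      ring_nf
    by_cases hy : (u₂ - α * u₁) * y ≤ 0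
    · have h2 : |Real.sign (u₂ - α * u₁) - Real.sign y| ≤ 2 := by
        have h3 := abs_sign_le (u₂ - α * u₁)
        have h4 := abs_sign_le y
        rw [abs_le] at *
        constructor <;> linarith
      rw [norm_mul, norm_mul, Real.norm_eq_abs, Real.norm_eq_abs, Real.norm_eq_abs,
        abs_of_pos (gauss_pos _)]
      calc _ ≤ 2 * (gauss (y - u₂) *
            (2 * Real.exp (-Real.pi * u₁ ^ 2 - 2 * Real.pi * (α * y) * u₁))) := by
            have := gauss_pos (y - u₂)
            gcongr
        _ = 4 * (gauss (y - u₂) * Real.exp (-Real.pi * u₁ ^ 2 - 2 * Real.pi * (α * y) * u₁)) := by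
            ring
        _ ≤ 4 * (gauss u₁ * gauss u₂ * gauss y) := by
            refine mul_le_mul_of_nonneg_left ?_ (by norm_num)
            unfold gauss
            rw [← Real.exp_add, ← Real.exp_add, ← Real.exp_add, Real.exp_le_exp]
            nlinarith [Real.pi_pos, mul_nonneg Real.pi_pos.le (neg_nonneg.2 hy)]
        _ = _ := by ring
    · push Not at hy
      have : Real.sign (u₂ - α * u₁) = Real.sign y := by
        rcases pos_and_pos_or_neg_and_neg_of_mul_pos hy with ⟨ha, hb⟩ | ⟨ha, hb⟩
        · rw [Real.sign_of_pos ha, Real.sign_of_pos hb]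
        · rw [Real.sign_of_neg ha, Real.sign_of_neg hb]
      rw [this, sub_self, zero_mul, norm_zero]
      have := gauss_pos u₁; have := gauss_pos u₂; have := gauss_pos y
      positivity
  have := norm_integral_le_of_norm_le (integrable_gauss.const_mul (4 * (gauss u₁ * gauss u₂)))
    (Eventually.of_forall hb)
  rwa [integral_const_mul, integral_gauss, mul_one] at this

end

section

open MeasureTheory Set

/-! ### Gaussian majorants -/

lemma summable_exp_neg_sq (κ B : ℝ) {c : ℝ} (hc : 0 < c) :
    Summable fun n : ℤ => Real.exp (-c * (n + κ) ^ 2 + B * |(n : ℝ) + κ|) := by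
  have hT : 0 < c / Real.pi := div_pos hc Real.pi_pos
  have h := (summable_pow_mul_jacobiTheta₂_term_bound
    ((2 * c * |κ| + |B|) / (2 * Real.pi)) hT 0).mul_left (Real.exp (|B| * |κ|))
  refine h.of_nonneg_of_le (fun n => (Real.exp_pos _).le) fun n => ?_
  rw [pow_zero, one_mul, ← Real.exp_add, Real.exp_le_exp]
  have e1 : -Real.pi * (c / Real.pi * (n : ℝ) ^ 2 -
      2 * ((2 * c * |κ| + |B|) / (2 * Real.pi)) * |(n : ℤ)|) =
      -c * (n : ℝ) ^ 2 + (2 * c * |κ| + |B|) * |(n : ℝ)| := by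
    push_cast
    have := Real.pi_ne_zero
    field_simp
    ring
  rw [e1]
  have h1 : B * |(n : ℝ) + κ| ≤ |B| * (|(n : ℝ)| + |κ|) :=
    mul_le_mul (le_abs_self B) (abs_add_le _ _) (abs_nonneg _) (abs_nonneg _)
  have h2 : -((n : ℝ) * κ) ≤ |κ| * |(n : ℝ)| := by
    rw [← abs_mul, mul_comm]; exact neg_le_abs _
  nlinarith [sq_nonneg κ]

lemma summable_exp_neg_sq_prod (B : ℝ) {c : ℝ} (hc : 0 < c) :
    Summable fun k : ℤ × ℤ =>
      Real.exp (-c * ((k.1 : ℝ) ^ 2 + (k.2 : ℝ) ^ 2) + B * (|(k.1 : ℝ)| + |(k.2 : ℝ)|)) := by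
  have h := summable_exp_neg_sq 0 B hc
  have := h.mul_of_nonneg h (fun n => (Real.exp_pos _).le) (fun n => (Real.exp_pos _).le)
  refine this.congr fun k => ?_
  rw [← Real.exp_add]
  simp only [add_zero]
  congr 1; ring

/-! ### The exponential -/

lemma e_add (x y : ℂ) : e (x + y) = e x * e y := by
  unfold e; rw [mul_add, Complex.exp_add]

lemma e_zero : e 0 = 1 := by simp [e]

lemma e_ne_zero (x : ℂ) : e x ≠ 0 := Complex.exp_ne_zero _

lemma e_neg (x : ℂ) : e (-x) = (e x)⁻¹ := by
  unfold e; rw [mul_neg, Complex.exp_neg]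

lemma e_int (n : ℤ) : e n = 1 := by
  unfold e
  rw [show 2 * Real.pi * I * (n : ℂ) = n * (2 * Real.pi * I) by ring]
  exact Complex.exp_int_mul_two_pi_mul_I n

lemma e_one : e 1 = 1 := by simpa using e_int 1

lemma e_half : e (1 / 2) = -1 := by
  unfold e
  rw [show 2 * Real.pi * I * (1 / 2 : ℂ) = Real.pi * I by ring, Complex.exp_pi_mul_I]

lemma e_eq_one_iff (x : ℂ) : e x = 1 ↔ ∃ n : ℤ, x = n := by
  unfold e
  rw [Complex.exp_eq_one_iff]
  refine exists_congr fun n => ?_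
  rw [mul_comm (n : ℂ), mul_right_inj' Complex.two_pi_I_ne_zero]

lemma norm_e (x : ℂ) : ‖e x‖ = Real.exp (-(2 * Real.pi * x.im)) := by
  unfold e
  rw [Complex.norm_exp]
  congr 1
  simp

lemma e_nsmul (x : ℂ) (n : ℕ) : e (n * x) = e x ^ n := by
  unfold e; rw [← Complex.exp_nat_mul]; congr 1; ring

lemma conj_e (x : ℂ) : (starRingEnd ℂ) (e x) = e (-(starRingEnd ℂ) x) := by
  unfold e
  rw [← Complex.exp_conj]
  congr 1
  simp [show (starRingEnd ℂ) 2 = 2 from Complex.conj_ofNat 2]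

lemma hasDerivAt_e (x : ℂ) : HasDerivAt e (2 * Real.pi * I * e x) x := by
  unfold e
  have := ((hasDerivAt_id x).const_mul (2 * Real.pi * I : ℂ)).cexp
  refine this.congr_deriv ?_
  simp; ring

lemma differentiable_e : Differentiable ℂ e := fun x => (hasDerivAt_e x).differentiableAt

@[fun_prop]
lemma continuous_e : Continuous e := differentiable_e.continuous

/-! ### The antiholomorphic derivative -/

/-- `f` is real differentiable at `w`, with antiholomorphic derivative `g`. -/
def HasDbarAt (f : ℂ → ℂ) (g : ℂ) (w : ℂ) : Prop :=
  ∃ p : ℂ, HasFDerivAt f (p • (ContinuousLinearMap.id ℝ ℂ) + g • (conjCLE : ℂ →L[ℝ] ℂ)) w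

lemma HasDbarAt.congr {f : ℂ → ℂ} {g g' w : ℂ} (h : HasDbarAt f g w) (hg : g = g') :
    HasDbarAt f g' w := hg ▸ h

lemma HasDbarAt.continuousAt {f : ℂ → ℂ} {g w : ℂ} (h : HasDbarAt f g w) : ContinuousAt f w :=
  let ⟨_, hp⟩ := h; hp.continuousAt

lemma _root_.HasDerivAt.hasDbarAt {f : ℂ → ℂ} {f' w : ℂ} (h : HasDerivAt f f' w) :
    HasDbarAt f 0 w := by
  refine ⟨f', ?_⟩
  refine (h.hasFDerivAt.restrictScalars ℝ).congr_fderiv ?_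
  ext; simp [mul_comm]

lemma _root_.DifferentiableAt.hasDbarAt {f : ℂ → ℂ} {w : ℂ} (h : DifferentiableAt ℂ f w) :
    HasDbarAt f 0 w := h.hasDerivAt.hasDbarAt

/-- The Cauchy–Riemann criterion. It is the way back from the real-analytic completions to
holomorphic functions, and it requires only the antiholomorphic derivative to be known. -/
lemma HasDbarAt.differentiableAt {f : ℂ → ℂ} {w : ℂ} (h : HasDbarAt f 0 w) :
    DifferentiableAt ℂ f w := by
  obtain ⟨p, hp⟩ := h
  refine (hasFDerivAt_of_restrictScalars ℝ (f' := p • ContinuousLinearMap.id ℂ ℂ) hp ?_).differentiableAt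
  ext; simp

lemma HasDbarAt.add {f₁ f₂ : ℂ → ℂ} {g₁ g₂ w : ℂ} (h₁ : HasDbarAt f₁ g₁ w)
    (h₂ : HasDbarAt f₂ g₂ w) : HasDbarAt (fun x => f₁ x + f₂ x) (g₁ + g₂) w := by
  obtain ⟨p₁, hp₁⟩ := h₁
  obtain ⟨p₂, hp₂⟩ := h₂
  refine ⟨p₁ + p₂, (hp₁.add hp₂).congr_fderiv ?_⟩
  module

lemma HasDbarAt.mul {f₁ f₂ : ℂ → ℂ} {g₁ g₂ w : ℂ} (h₁ : HasDbarAt f₁ g₁ w)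
    (h₂ : HasDbarAt f₂ g₂ w) :
    HasDbarAt (fun x => f₁ x * f₂ x) (f₁ w * g₂ + g₁ * f₂ w) w := by
  obtain ⟨p₁, hp₁⟩ := h₁
  obtain ⟨p₂, hp₂⟩ := h₂
  refine ⟨f₁ w * p₂ + p₁ * f₂ w, (hp₁.mul hp₂).congr_fderiv ?_⟩
  ext; simp; ring

lemma HasDbarAt.holo_mul {F f : ℂ → ℂ} {g w : ℂ} (hF : DifferentiableAt ℂ F w)
    (h : HasDbarAt f g w) : HasDbarAt (fun x => F x * f x) (F w * g) w :=
  (hF.hasDbarAt.mul h).congr (by ring)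

lemma HasDbarAt.const_mul {f : ℂ → ℂ} {g w : ℂ} (c : ℂ) (h : HasDbarAt f g w) :
    HasDbarAt (fun x => c * f x) (c * g) w :=
  HasDbarAt.holo_mul (F := fun _ => c) (differentiableAt_const c) h

lemma HasDbarAt.sub {f₁ f₂ : ℂ → ℂ} {g₁ g₂ w : ℂ} (h₁ : HasDbarAt f₁ g₁ w)
    (h₂ : HasDbarAt f₂ g₂ w) : HasDbarAt (fun x => f₁ x - f₂ x) (g₁ - g₂) w := by
  have h := h₁.add (h₂.const_mul (-1))
  simp only [neg_mul, one_mul, ← sub_eq_add_neg] at h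
  exact h

lemma HasDbarAt.sum {ι : Type*} (s : Finset ι) {f : ι → ℂ → ℂ} {g : ι → ℂ} {w : ℂ}
    (h : ∀ i ∈ s, HasDbarAt (f i) (g i) w) :
    HasDbarAt (fun x => ∑ i ∈ s, f i x) (∑ i ∈ s, g i) w := by
  classical
  induction s using Finset.induction_on with
  | empty => simpa using (differentiableAt_const (0 : ℂ)).hasDbarAt
  | insert i s hi ih =>
    simp only [Finset.sum_insert hi]
    exact (h i (Finset.mem_insert_self i s)).add
      (ih fun j hj => h j (Finset.mem_insert_of_mem hj))

lemma HasDbarAt.comp_affine {f : ℂ → ℂ} {g w : ℂ} (c d : ℂ) (h : HasDbarAt f g (c * w + d)) :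
    HasDbarAt (fun x => f (c * x + d)) (g * (starRingEnd ℂ) c) w := by
  obtain ⟨p, hp⟩ := h
  refine ⟨p * c, ?_⟩
  have h1 : HasFDerivAt (fun x : ℂ => c * x + d) (c • ContinuousLinearMap.id ℝ ℂ) w := by
    have : HasDerivAt (fun x : ℂ => c * x + d) c w := by
      simpa using ((hasDerivAt_id w).const_mul c).add_const d
    refine (this.hasFDerivAt.restrictScalars ℝ).congr_fderiv ?_
    ext; simp [mul_comm]
  refine (hp.comp w h1).congr_fderiv ?_
  ext; simp; ring

/-- The antiholomorphic derivative of Im w is i/2 and the exponential is holomorphic, so only φ'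
enters the second coefficient. -/
lemma hasDbarAt_term {φ : ℝ → ℝ} {φ' t : ℝ} (m : ℝ) (C : ℂ) {w : ℂ}
    (hφ : HasDerivAt φ φ' (w.im / t)) :
    HasFDerivAt (fun w : ℂ => (φ (w.im / t) : ℂ) * (C * e (m * w)))
      (((φ (w.im / t) : ℂ) * (2 * Real.pi * I * m) * (C * e (m * w))
        - I / (2 * t) * (φ' * (C * e (m * w)))) • (ContinuousLinearMap.id ℝ ℂ)
        + (I / (2 * t) * (φ' * (C * e (m * w)))) • (conjCLE : ℂ →L[ℝ] ℂ)) w := by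
  have h1 : HasFDerivAt (fun w : ℂ => w.im / t) (t⁻¹ • Complex.imCLM) w := by
    have := (Complex.imCLM.hasFDerivAt (x := w)).const_mul t⁻¹
    refine this.congr_of_eventuallyEq (Eventually.of_forall fun w => ?_)
    simp [div_eq_inv_mul]
  have h2 : HasFDerivAt (fun w : ℂ => (φ (w.im / t) : ℂ))
      (Complex.ofRealCLM.comp (φ' • (t⁻¹ • Complex.imCLM))) w :=
    (Complex.ofRealCLM.hasFDerivAt).comp w (hφ.comp_hasFDerivAt w h1)
  have h3 : HasDerivAt (fun w : ℂ => C * e (m * w)) (2 * Real.pi * I * m * (C * e (m * w))) w := by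
    have h4 : HasDerivAt (fun w : ℂ => (m : ℂ) * w) m w := by
      simpa using (hasDerivAt_id w).const_mul (m : ℂ)
    refine (((hasDerivAt_e (m * w)).comp w h4).const_mul C).congr_deriv ?_
    ring
  refine (h2.mul (h3.hasFDerivAt.restrictScalars ℝ)).congr_fderiv ?_
  ext z
  simp only [add_apply, smul_apply,
    ContinuousLinearMap.coe_restrictScalars', ContinuousLinearMap.toSpanSingleton_apply,
    ContinuousLinearMap.comp_apply, Complex.imCLM_apply, Complex.ofRealCLM_apply, smul_eq_mul,
    ContinuousLinearMap.coe_id', id_eq, ContinuousLinearEquiv.coe_coe, Complex.conjCLE_apply,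
    ofReal_mul, ofReal_inv]
  have hz : (z.im : ℂ) = I / 2 * ((starRingEnd ℂ) z - z) := by
    apply Complex.ext <;> simp; ring
  rw [hz]
  ring

/-- Termwise antiholomorphic derivative of a series of terms `φ(Im w / t) C e(m w)`. -/
lemma hasDbarAt_tsum {ι : Type*} {t : ℝ} (ht : 0 < t) {φ φ' : ι → ℝ → ℝ} {m : ι → ℝ} {C : ι → ℂ}
    (hφ : ∀ k a, HasDerivAt (φ k) (φ' k a) a)
    (hb : ∀ B : ℝ, ∃ b : ι → ℝ, Summable b ∧ ∀ k (w : ℂ), ‖w‖ ≤ B →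
      (1 + |m k|) * |φ k (w.im / t)| * ‖C k * e (m k * w)‖ ≤ b k ∧
      |φ' k (w.im / t)| * ‖C k * e (m k * w)‖ ≤ b k) (w : ℂ) :
    (Summable fun k => (φ k (w.im / t) : ℂ) * (C k * e (m k * w))) ∧
    HasDbarAt (fun w : ℂ => ∑' k, (φ k (w.im / t) : ℂ) * (C k * e (m k * w)))
      (I / (2 * t) * ∑' k, (φ' k (w.im / t) : ℂ) * (C k * e (m k * w))) w := by
  obtain ⟨b, hbs, hbb⟩ := hb (‖w‖ + 1)
  have hmem : ∀ x ∈ Metric.ball (0 : ℂ) (‖w‖ + 1), ‖x‖ ≤ ‖w‖ + 1 := fun x hx => by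
    rw [mem_ball_zero_iff] at hx; exact hx.le
  have hw : w ∈ Metric.ball (0 : ℂ) (‖w‖ + 1) := by rw [mem_ball_zero_iff]; linarith
  have hnφ : ∀ k x, x ∈ Metric.ball (0 : ℂ) (‖w‖ + 1) →
      ‖(φ k (x.im / t) : ℂ) * (C k * e (m k * x))‖ ≤ b k := by
    intro k x hx
    rw [norm_mul, norm_real, Real.norm_eq_abs]
    refine le_trans ?_ (hbb k x (hmem x hx)).1
    rw [mul_assoc]
    refine le_mul_of_one_le_left (by positivity) ?_
    linarith [abs_nonneg (m k)]
  have hnφ' : ∀ k x, x ∈ Metric.ball (0 : ℂ) (‖w‖ + 1) →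
      ‖(φ' k (x.im / t) : ℂ) * (C k * e (m k * x))‖ ≤ b k := by
    intro k x hx
    rw [norm_mul, norm_real, Real.norm_eq_abs]
    exact (hbb k x (hmem x hx)).2
  have hnm : ∀ k x, x ∈ Metric.ball (0 : ℂ) (‖w‖ + 1) →
      ‖(φ k (x.im / t) : ℂ) * (2 * Real.pi * I * m k) * (C k * e (m k * x))‖ ≤
        2 * Real.pi * b k := by
    intro k x hx
    have h := (hbb k x (hmem x hx)).1
    have h2 : |m k| * |φ k (x.im / t)| * ‖C k * e (m k * x)‖ ≤
        (1 + |m k|) * |φ k (x.im / t)| * ‖C k * e (m k * x)‖ := by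
      gcongr; linarith
    have h3 : ‖(φ k (x.im / t) : ℂ) * (2 * Real.pi * I * m k) * (C k * e (m k * x))‖ =
        2 * Real.pi * (|m k| * |φ k (x.im / t)| * ‖C k * e (m k * x)‖) := by
      simp only [norm_mul, norm_real, norm_I, Real.norm_eq_abs, abs_of_pos Real.pi_pos, norm_ofNat]
      ring
    rw [h3]
    exact mul_le_mul_of_nonneg_left (h2.trans h) Real.two_pi_pos.le
  have hnI : ‖I / (2 * (t : ℂ))‖ = 1 / (2 * t) := by
    simp [abs_of_pos ht]
  have hnG : ∀ k x, x ∈ Metric.ball (0 : ℂ) (‖w‖ + 1) →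
      ‖I / (2 * (t : ℂ)) * ((φ' k (x.im / t) : ℂ) * (C k * e (m k * x)))‖ ≤ 1 / (2 * t) * b k := by
    intro k x hx
    rw [norm_mul, hnI]
    exact mul_le_mul_of_nonneg_left (hnφ' k x hx) (by positivity)
  have hs : Summable fun k => (φ k (w.im / t) : ℂ) * (C k * e (m k * w)) :=
    Summable.of_norm_bounded hbs fun k => hnφ k w hw
  refine ⟨hs, ?_⟩
  have key := hasFDerivAt_tsum_of_isPreconnected
    (u := fun k => (2 * Real.pi + 1 / (2 * t)) * b k + 1 / (2 * t) * b k)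
    ((hbs.mul_left _).add (hbs.mul_left _)) Metric.isOpen_ball
    (convex_ball (0 : ℂ) (‖w‖ + 1)).isPreconnected
    (fun k x _ => hasDbarAt_term (t := t) (m k) (C k) (hφ k (x.im / t))) ?_ hw hs hw
  · have hsP : Summable fun k => (φ k (w.im / t) : ℂ) * (2 * Real.pi * I * m k) * (C k * e (m k * w))
        - I / (2 * t) * (φ' k (w.im / t) * (C k * e (m k * w))) :=
      (Summable.of_norm_bounded (hbs.mul_left (2 * Real.pi)) fun k => hnm k w hw).sub
        (Summable.of_norm_bounded (hbs.mul_left (1 / (2 * t))) fun k => hnG k w hw)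
    have hsG : Summable fun k => I / (2 * (t : ℂ)) * (φ' k (w.im / t) * (C k * e (m k * w))) :=
      Summable.of_norm_bounded (hbs.mul_left (1 / (2 * t))) fun k => hnG k w hw
    refine ⟨∑' k, ((φ k (w.im / t) : ℂ) * (2 * Real.pi * I * m k) * (C k * e (m k * w))
        - I / (2 * t) * (φ' k (w.im / t) * (C k * e (m k * w)))), key.congr_fderiv ?_⟩
    rw [(hsP.smul_const _).tsum_add (hsG.smul_const _), hsP.tsum_smul_const, hsG.tsum_smul_const,
      tsum_mul_left]
  · intro k x hx
    refine (norm_add_le _ _).trans (add_le_add ?_ ?_)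
    · rw [norm_smul]
      refine (mul_le_of_le_one_right (norm_nonneg _) ContinuousLinearMap.norm_id_le).trans ?_
      refine (norm_sub_le _ _).trans ?_
      have := add_le_add (hnm k x hx) (hnG k x hx)
      linarith
    · rw [norm_smul]
      refine (mul_le_of_le_one_right (norm_nonneg _) ?_).trans (hnG k x hx)
      refine ContinuousLinearMap.opNorm_le_bound _ zero_le_one fun z => ?_
      simp

/-! ### The lattice and a Liouville theorem -/

/-- `u` does not lie in the lattice `ℤτ + ℤ`. -/
def OffLattice (τ : ℍ) (u : ℂ) : Prop := ∀ m n : ℤ, u ≠ m * τ + n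

lemma offLattice_add_iff (τ : ℍ) (u : ℂ) (m n : ℤ) :
    OffLattice τ (u + (m * τ + n)) ↔ OffLattice τ u := by
  constructor
  · intro h a b hu
    apply h (a + m) (b + n)
    rw [hu]; push_cast; ring
  · intro h a b hu
    apply h (a - m) (b - n)
    push_cast
    linear_combination hu

lemma mem_lattice_iff (τ : ℍ) (u : ℂ) : (∃ m n : ℤ, u = m * τ + n) ↔
    (u.im / τ.im ∈ range ((↑) : ℤ → ℝ) ∧
      u.re - u.im / τ.im * τ.re ∈ range ((↑) : ℤ → ℝ)) := by
  have hτ := τ.im_pos.ne'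
  constructor
  · rintro ⟨m, n, rfl⟩
    have h1 : ((m : ℂ) * τ + n).im / τ.im = m := by
      simp; field_simp
    refine ⟨⟨m, h1.symm⟩, ⟨n, ?_⟩⟩
    rw [h1]; simp
  · rintro ⟨⟨m, hm⟩, ⟨n, hn⟩⟩
    refine ⟨m, n, ?_⟩
    rw [← hm] at hn
    have h2 : u.im = m * τ.im := by rw [hm]; field_simp
    apply Complex.ext
    · simp; linarith
    · simp [h2]

lemma isOpen_offLattice (τ : ℍ) : IsOpen {u | OffLattice τ u} := by
  have h : {u | OffLattice τ u} = {u : ℂ | u.im / τ.im ∈ range ((↑) : ℤ → ℝ) ∧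
      u.re - u.im / τ.im * τ.re ∈ range ((↑) : ℤ → ℝ)}ᶜ := by
    ext u
    rw [mem_compl_iff, mem_ofPred_eq, mem_ofPred_eq, ← mem_lattice_iff]
    simp [OffLattice]
  rw [h, isOpen_compl_iff]
  have hc : IsClosed (range ((↑) : ℤ → ℝ)) := Int.isClosedEmbedding_coe_real.isClosed_range
  exact (hc.preimage (by fun_prop : Continuous fun u : ℂ => u.im / τ.im)).inter
    (hc.preimage (by fun_prop : Continuous fun u : ℂ => u.re - u.im / τ.im * τ.re))

lemma eventually_offLattice_zero (τ : ℍ) : ∀ᶠ u in 𝓝[≠] (0 : ℂ), OffLattice τ u := by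
  have hb : Metric.ball (0 : ℂ) (min τ.im 1) ∈ 𝓝 (0 : ℂ) :=
    Metric.ball_mem_nhds _ (lt_min τ.im_pos one_pos)
  filter_upwards [mem_nhdsWithin_of_mem_nhds hb, self_mem_nhdsWithin] with u hu hu0 m n h
  rw [mem_ball_zero_iff, lt_min_iff] at hu
  have h1 := (abs_im_le_norm u).trans_lt hu.1
  have h2 := (abs_re_le_norm u).trans_lt hu.2
  have hm : m = 0 := by
    rw [h] at h1
    simp only [add_im, mul_im, intCast_re, intCast_im, UpperHalfPlane.coe_im, zero_mul, add_zero,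
      abs_mul, abs_of_pos τ.im_pos] at h1
    have h4 : |(m : ℝ)| < 1 := by
      by_contra hc
      push Not at hc
      nlinarith [τ.im_pos]
    rw [← Int.cast_abs] at h4
    have h5 : |m| < 1 := by exact_mod_cast h4
    exact Int.abs_lt_one_iff.1 h5
  subst hm
  have hn : n = 0 := by
    rw [h] at h2
    simp at h2
    have h5 : |n| < 1 := by exact_mod_cast h2
    exact Int.abs_lt_one_iff.1 h5
  subst hn
  exact hu0 (by simpa using h)

lemma tendsto_sub_punctured (p : ℂ) : Tendsto (fun u : ℂ => u - p) (𝓝[≠] p) (𝓝[≠] 0) := by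
  refine tendsto_nhdsWithin_iff.2 ⟨?_, ?_⟩
  · have : Continuous fun u : ℂ => u - p := by fun_prop
    have := this.tendsto p
    rw [sub_self] at this
    exact this.mono_left nhdsWithin_le_nhds
  · filter_upwards [self_mem_nhdsWithin] with u hu
    simpa [sub_eq_zero] using hu

lemma eventually_offLattice (τ : ℍ) (p : ℂ) : ∀ᶠ u in 𝓝[≠] p, OffLattice τ u := by
  by_cases hp : OffLattice τ p
  · exact ((isOpen_offLattice τ).eventually_mem hp).filter_mono nhdsWithin_le_nhds
  · unfold OffLattice at hp
    push Not at hp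
    obtain ⟨m, n, rfl⟩ := hp
    filter_upwards [(tendsto_sub_punctured _).eventually (eventually_offLattice_zero τ)] with u hu
    have := (offLattice_add_iff τ (u - (m * τ + n)) m n).2 hu
    simpa using this

/-- A family of functions holomorphic off the lattice, with singularities at the lattice points
weaker than simple poles, that transforms with negative index, vanishes. -/
theorem eq_zero_of_negative_index {ι : Type*} [Fintype ι] (τ : ℍ) {m : ℝ} (hm : 0 < m) (v : ℂ)
    {D : ι → ℂ → ℂ} (hd : ∀ i u, OffLattice τ u → DifferentiableAt ℂ (D i) u)
    (h0 : ∀ i, Tendsto (fun u => u * D i u) (𝓝[≠] 0) (𝓝 0))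
    (h1 : ∀ u, OffLattice τ u → ∑ i, ‖D i (u + 1)‖ = ∑ i, ‖D i u‖)
    (hτ : ∀ u, OffLattice τ u → ∑ i, ‖D i (u + τ)‖ =
      Real.exp (-(2 * Real.pi * m * (τ.im + 2 * (u - v).im))) * ∑ i, ‖D i u‖) :
    ∀ i u, OffLattice τ u → D i u = 0 := by
  classical
  have hτ0 := τ.im_pos
  -- This Gaussian weight compensates the multiplier of `hτ`, so that `b` below is doubly periodic.
  -- Only the total norm of the family enters, so translations may permute its members, as they do
  -- for `defectS`.
  set W : ℂ → ℝ := fun u => Real.exp (2 * Real.pi * m * (u - v).im ^ 2 / τ.im) with hW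
  have hWpos : ∀ u, 0 < W u := fun u => Real.exp_pos _
  set b : ℂ → ℝ := fun u => if OffLattice τ u then (∑ i, ‖D i u‖) * W u else 0 with hbdef
  have hb1 : Function.Periodic b 1 := by
    intro u
    have hiff := offLattice_add_iff τ u 0 1
    simp only [Int.cast_zero, zero_mul, Int.cast_one, zero_add] at hiff
    simp only [hbdef, hiff]
    split_ifs with hu
    · rw [h1 u hu]
      simp [hW]
    · rfl
  have hbτ : Function.Periodic b τ := by
    intro u
    have hiff := offLattice_add_iff τ u 1 0
    simp only [Int.cast_zero, one_mul, Int.cast_one, add_zero] at hiff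
    simp only [hbdef, hiff]
    split_ifs with hu
    · rw [hτ u hu, mul_right_comm, hW, ← Real.exp_add, mul_comm]
      congr 2
      simp only [sub_im, add_im, UpperHalfPlane.coe_im]
      field_simp
      ring
    · rfl
  have hbL : ∀ (k l : ℤ) u, b (u - (k * τ + l)) = b u := by
    intro k l u
    have e1 := hb1.int_mul l (u - (k * τ + l))
    have e2 := hbτ.int_mul k (u - (k * τ + l) + l * 1)
    rw [← e1, ← e2]
    congr 1; ring
  have hDb : ∀ i u, OffLattice τ u → ‖D i u‖ * W u ≤ b u := by
    intro i u hu
    simp only [hbdef, if_pos hu]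
    exact mul_le_mul_of_nonneg_right
      (Finset.single_le_sum (f := fun i => ‖D i u‖) (fun j _ => norm_nonneg _) (Finset.mem_univ i))
      (hWpos u).le
  have hWone : ∀ u, 1 ≤ W u := fun u => Real.one_le_exp (by have := Real.pi_pos; positivity)
  have hWcont : Continuous W := by
    simp only [hW]
    fun_prop
  -- the singularity at an arbitrary point is weak
  have hsing : ∀ i p, Tendsto (fun u => (u - p) * D i u) (𝓝[≠] p) (𝓝 0) := by
    intro i p
    by_cases hp : OffLattice τ p
    · have hc : ContinuousAt (fun u => (u - p) * D i u) p :=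
        (by fun_prop : ContinuousAt (fun u : ℂ => u - p) p).mul (hd i p hp).continuousAt
      have := hc.tendsto
      rw [sub_self, zero_mul] at this
      exact this.mono_left nhdsWithin_le_nhds
    · unfold OffLattice at hp
      push Not at hp
      obtain ⟨k, l, hkl⟩ := hp
      -- The assumption at 0 is carried to an arbitrary lattice point by the periodicity of `b`,
      -- using W ≥ 1.
      have hz : Tendsto (fun u => (∑ j, ‖u * D j u‖) * W u) (𝓝[≠] 0) (𝓝 0) := by
        have hs : Tendsto (fun u => ∑ j, ‖u * D j u‖) (𝓝[≠] 0) (𝓝 0) := by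
          have := tendsto_finsetSum (Finset.univ : Finset ι) fun j _ => (h0 j).norm
          simpa using this
        have := hs.mul ((hWcont.tendsto 0).mono_left (nhdsWithin_le_nhds (s := {0}ᶜ)))
        rwa [zero_mul] at this
      refine squeeze_zero_norm' ?_ (hz.comp (tendsto_sub_punctured p))
      filter_upwards [eventually_offLattice τ p] with u hu
      have hu' : OffLattice τ (u - p) := by
        have := (offLattice_add_iff τ (u - p) k l).1
        rw [← hkl, sub_add_cancel] at this
        exact this hu
      have e1 := hbL k l u
      rw [← hkl] at e1
      have e2 : b (u - p) = (∑ i, ‖D i (u - p)‖) * W (u - p) := by simp only [hbdef, if_pos hu']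
      simp only [Function.comp]
      simp_rw [norm_mul]
      rw [← Finset.mul_sum, mul_assoc, ← e2, e1]
      refine mul_le_mul_of_nonneg_left ?_ (norm_nonneg _)
      refine le_trans ?_ (hDb i u hu)
      exact le_mul_of_one_le_right (norm_nonneg _) (hWone u)
  -- The extension over the lattice: the punctured limit agrees with D off the lattice and is
  -- holomorphic by the removable singularity theorem.
  set G : ι → ℂ → ℂ := fun i u => limUnder (𝓝[≠] u) (D i) with hG
  have hGoff : ∀ i u, OffLattice τ u → G i u = D i u := fun i u hu =>
    (((hd i u hu).continuousAt.tendsto).mono_left nhdsWithin_le_nhds).limUnder_eq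
  have hGd : ∀ i, Differentiable ℂ (G i) := by
    intro i p
    obtain ⟨s, hs, hsoff⟩ := (mem_nhdsWithin_iff_exists_mem_nhds_inter).1 (eventually_offLattice τ p)
    have hdo : DifferentiableOn ℂ (D i) (s \ {p}) := fun z hz =>
      (hd i z (hsoff ⟨hz.1, hz.2⟩)).differentiableWithinAt
    have ho : (fun z => D i z - D i p) =o[𝓝[≠] p] fun z => (z - p)⁻¹ := by
      rw [Asymptotics.isLittleO_iff_tendsto']
      · have h2 : Tendsto (fun u : ℂ => (u - p) * D i p) (𝓝[≠] p) (𝓝 0) := by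
          have : Continuous fun u : ℂ => (u - p) * D i p := by fun_prop
          have := this.tendsto p
          rw [sub_self, zero_mul] at this
          exact this.mono_left nhdsWithin_le_nhds
        have := (hsing i p).sub h2
        rw [sub_zero] at this
        refine this.congr fun u => ?_
        rw [div_inv_eq_mul]; ring
      · filter_upwards [self_mem_nhdsWithin] with z hz h
        exact absurd (sub_eq_zero.1 (inv_eq_zero.1 h)) hz
    have hup := Complex.differentiableOn_update_limUnder_of_isLittleO hs hdo ho
    refine (hup.differentiableAt hs).congr_of_eventuallyEq ?_
    filter_upwards [hs] with z hz
    by_cases hzp : z = p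
    · subst hzp; simp [hG]
    · rw [Function.update_of_ne hzp]
      exact hGoff i z (hsoff ⟨hz, hzp⟩)
  -- a compact fundamental domain
  set K : Set ℂ := (fun p : ℝ × ℝ => (p.1 : ℂ) * τ + p.2) '' (Icc 0 1 ×ˢ Icc 0 1) with hK
  have hKc : IsCompact K := (isCompact_Icc.prod isCompact_Icc).image (by fun_prop)
  obtain ⟨C, hC⟩ := hKc.exists_bound_of_continuousOn
    (f := fun u => (∑ i, ‖G i u‖) * W u)
    (Continuous.continuousOn (by
      refine Continuous.mul ?_ hWcont
      exact continuous_finsetSum _ fun i _ => (hGd i).continuous.norm))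
  have hbC : ∀ u, OffLattice τ u → b u ≤ C := by
    intro u hu
    set x := u.im / τ.im with hx
    set y := u.re - x * τ.re with hy
    have hu_eq : u = (x : ℂ) * τ + y := by
      apply Complex.ext
      · simp [hy]
      · simp [hx]; field_simp
    have hmem : u - ((⌊x⌋ : ℤ) * τ + (⌊y⌋ : ℤ)) ∈ K := by
      refine ⟨(Int.fract x, Int.fract y), ⟨⟨Int.fract_nonneg _, (Int.fract_lt_one _).le⟩,
        ⟨Int.fract_nonneg _, (Int.fract_lt_one _).le⟩⟩, ?_⟩
      simp only [Int.fract]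
      conv_rhs => rw [hu_eq]
      push_cast
      ring
    have hoff : OffLattice τ (u - ((⌊x⌋ : ℤ) * τ + (⌊y⌋ : ℤ))) := by
      rw [← offLattice_add_iff τ _ ⌊x⌋ ⌊y⌋, sub_add_cancel]
      exact hu
    rw [← hbL ⌊x⌋ ⌊y⌋ u]
    have := hC _ hmem
    simp only [hbdef, if_pos hoff]
    rw [Real.norm_eq_abs] at this
    refine le_trans (le_of_eq ?_) ((le_abs_self _).trans this)
    congr 1
    exact Finset.sum_congr rfl fun i _ => by rw [hGoff i _ hoff]
  have hGb : ∀ i u, ‖G i u‖ * W u ≤ C := by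
    intro i u
    have hc : Tendsto (fun z => ‖G i z‖ * W z) (𝓝[≠] u) (𝓝 (‖G i u‖ * W u)) :=
      (((hGd i).continuous.norm.mul hWcont).tendsto u).mono_left nhdsWithin_le_nhds
    refine le_of_tendsto hc ?_
    filter_upwards [eventually_offLattice τ u] with z hz
    rw [hGoff i z hz]
    exact (hDb i z hz).trans (hbC z hz)
  intro i u hu
  rw [← hGoff i u hu]
  -- Since W ≥ 1, the bound on ‖G‖ W bounds G itself, so G is constant. Along v + it the weight
  -- tends to infinity, and the constant is 0.
  have hconst := (hGd i).apply_eq_apply_of_bounded (isBounded_iff_forall_norm_le.2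
    ⟨C, by
      rintro _ ⟨z, rfl⟩
      exact le_trans (le_mul_of_one_le_right (norm_nonneg _) (hWone z)) (hGb i z)⟩)
  have hlim : Tendsto (fun t : ℝ => C * Real.exp (-(2 * Real.pi * m / τ.im * t ^ 2))) atTop (𝓝 0) := by
    have h2 : Tendsto (fun t : ℝ => 2 * Real.pi * m / τ.im * t ^ 2) atTop atTop :=
      (tendsto_pow_atTop two_ne_zero).const_mul_atTop (by have := Real.pi_pos; positivity)
    have := (Real.tendsto_exp_neg_atTop_nhds_zero.comp h2).const_mul C
    simpa using this
  have hle : ∀ t : ℝ, ‖G i u‖ ≤ C * Real.exp (-(2 * Real.pi * m / τ.im * t ^ 2)) := by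
    intro t
    have h2 := hGb i (v + I * t)
    rw [hconst (v + I * t) u] at h2
    have h3 : W (v + I * t) = Real.exp (2 * Real.pi * m / τ.im * t ^ 2) := by
      simp only [hW]
      congr 1
      simp
      ring
    rw [h3] at h2
    rw [Real.exp_neg, ← div_eq_mul_inv, le_div_iff₀ (Real.exp_pos _)]
    exact h2
  exact norm_le_zero_iff.1 (ge_of_tendsto hlim (Eventually.of_forall hle))

end

section

open Set

/-! ### The building blocks `A₀` and `A₁` -/

/-- `A₀(x) = 1/2 + e(x)/(1 - e(x))`. -/
def A0 (x : ℂ) : ℂ := 1 / 2 + e x / (1 - e x)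

/-- `A₁(x) = e(x/2)/(1 - e(x))`. -/
def A1 (x : ℂ) : ℂ := e (x / 2) / (1 - e x)

/-- The pair `(A₀, A₁)`. -/
def A (j : Fin 2) : ℂ → ℂ := ![A0, A1] j

@[simp] lemma A_zero : A 0 = A0 := rfl
@[simp] lemma A_one : A 1 = A1 := rfl

lemma e_add_one (x : ℂ) : e (x + 1) = e x := by rw [e_add, e_one, mul_one]

lemma A0_add_one (x : ℂ) : A0 (x + 1) = A0 x := by simp [A0, e_add_one]

lemma A1_add_one (x : ℂ) : A1 (x + 1) = -A1 x := by
  rw [A1, e_add_one, add_div, e_add, e_half, A1]; ring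

lemma e_half_sq (x : ℂ) : e (x / 2) * e (x / 2) = e x := by rw [← e_add, add_halves]

/-- Multiplication by e(-x/2) exchanges A₀ and A₁ up to an elementary term. Translating u by τ has
this effect in the Appell sums, which is why they come in pairs. -/
lemma A0_mul_e {x : ℂ} (hx : e x ≠ 1) : A0 x * e (-(x / 2)) = A1 x + 1 / 2 * e (-(x / 2)) := by
  have h1 : 1 - e x ≠ 0 := sub_ne_zero.2 (Ne.symm hx)
  have h2 := e_half_sq x
  have h3 := e_ne_zero (x / 2)
  rw [A0, A1, e_neg]
  field_simp
  linear_combination -2 * h2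

lemma A1_mul_e {x : ℂ} (hx : e x ≠ 1) : A1 x * e (-(x / 2)) = A0 x + 1 / 2 := by
  have h1 : 1 - e x ≠ 0 := sub_ne_zero.2 (Ne.symm hx)
  have h3 := e_ne_zero (x / 2)
  rw [A0, A1, e_neg]
  field_simp
  ring

lemma A0_mul_e_neg {x : ℂ} (hx : e x ≠ 1) : A0 x * e (-x) = A0 x + 1 / 2 * (1 + e (-x)) := by
  have h1 : 1 - e x ≠ 0 := sub_ne_zero.2 (Ne.symm hx)
  have h3 := e_ne_zero x
  rw [A0, e_neg]
  field_simp
  ring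

/-- This duplication formula turns the trace of the matrix of Appell sums into a single sum of A₀.
-/
lemma A0_add_A1 {x : ℂ} (hx : e x ≠ 1) : A0 x + A1 x = A0 (x / 2) := by
  have h1 : 1 - e x ≠ 0 := sub_ne_zero.2 (Ne.symm hx)
  have h2 := e_half_sq x
  have h3 : 1 - e (x / 2) ≠ 0 := by
    intro h
    have : e (x / 2) = 1 := by linear_combination -h
    rw [this, one_mul] at h2
    exact hx h2.symm
  rw [A0, A1, A0]
  rw [← h2] at h1 ⊢
  generalize e (x / 2) = y at *
  have h4 : 1 + y ≠ 0 := fun h => h1 (by linear_combination (1 - y) * h)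
  rw [show 1 - y * y = (1 - y) * (1 + y) by ring]
  field_simp
  ring

lemma norm_A_le {j : Fin 2} {x : ℂ} (hx : 1 ≤ |x.im|) : ‖A j x‖ ≤ 3 := by
  have hπ := Real.pi_gt_three
  have key : ‖e x‖ ≤ 1 / 2 ∨ 2 ≤ ‖e x‖ := by
    rw [norm_e]
    rcases le_abs.1 hx with h | h
    · left
      have h1 : Real.exp (-(2 * Real.pi * x.im)) ≤ Real.exp (-1) := by
        rw [Real.exp_le_exp]; nlinarith
      refine h1.trans ?_
      rw [Real.exp_neg, one_div]
      exact inv_anti₀ (by norm_num) (by have := Real.add_one_le_exp (1 : ℝ); linarith)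
    · right
      have := Real.add_one_le_exp (-(2 * Real.pi * x.im))
      nlinarith
  have hh : ‖e (x / 2)‖ ^ 2 = ‖e x‖ := by rw [sq, ← norm_mul, e_half_sq]
  have hle : ‖e x‖ ≤ 2 * ‖1 - e x‖ ∧ ‖e (x / 2)‖ ≤ 2 * ‖1 - e x‖ ∧ 0 < ‖1 - e x‖ := by
    rcases key with h | h
    · have h1 : 1 - ‖e x‖ ≤ ‖1 - e x‖ := by simpa using norm_sub_norm_le 1 (e x)
      refine ⟨by linarith, ?_, by linarith⟩
      have : ‖e (x / 2)‖ ≤ 1 := by nlinarith [norm_nonneg (e (x / 2))]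
      linarith
    · have h1 : ‖e x‖ - 1 ≤ ‖1 - e x‖ := by
        rw [norm_sub_rev]; simpa using norm_sub_norm_le (e x) 1
      refine ⟨by linarith, ?_, by linarith⟩
      have : ‖e (x / 2)‖ ≤ ‖e x‖ := by nlinarith [norm_nonneg (e (x / 2))]
      linarith
  have h0 : ‖A0 x‖ ≤ 3 := by
    rw [A0]
    refine (norm_add_le _ _).trans ?_
    rw [norm_div (e x)]
    have : ‖e x‖ / ‖1 - e x‖ ≤ 2 := by rw [div_le_iff₀ hle.2.2]; exact hle.1
    have : ‖(1 / 2 : ℂ)‖ = 1 / 2 := by norm_num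
    linarith
  have h1 : ‖A1 x‖ ≤ 3 := by
    rw [A1, norm_div]
    have : ‖e (x / 2)‖ / ‖1 - e x‖ ≤ 2 := by rw [div_le_iff₀ hle.2.2]; exact hle.2.1
    linarith
  fin_cases j
  · exact h0
  · exact h1

lemma differentiableAt_A {j : Fin 2} {x : ℂ} (hx : e x ≠ 1) : DifferentiableAt ℂ (A j) x := by
  have h1 : 1 - e x ≠ 0 := sub_ne_zero.2 (Ne.symm hx)
  have he : DifferentiableAt ℂ e x := differentiable_e x
  have he2 : DifferentiableAt ℂ (fun x => e (x / 2)) x :=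
    DifferentiableAt.comp (g := e) x (differentiable_e (x / 2)) (by fun_prop : DifferentiableAt ℂ (fun x : ℂ => x / 2) x)
  have h0 : DifferentiableAt ℂ A0 x := by
    unfold A0
    exact (differentiableAt_const _).add (he.div ((differentiableAt_const _).sub he) h1)
  have h1 : DifferentiableAt ℂ A1 x := by
    unfold A1
    exact he2.div ((differentiableAt_const _).sub he) h1
  fin_cases j
  · exact h0
  · exact h1

lemma tendsto_mul_inv_one_sub_e :
    Tendsto (fun x => x / (1 - e x)) (𝓝[≠] 0) (𝓝 (I / (2 * Real.pi))) := by
  have h := (hasDerivAt_e 0).tendsto_slope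
  rw [e_zero, mul_one] at h
  have h2 := (h.inv₀ Complex.two_pi_I_ne_zero).neg
  have e1 : -(2 * (Real.pi : ℂ) * I)⁻¹ = I / (2 * Real.pi) := by
    have : (Real.pi : ℂ) ≠ 0 := by simp [Real.pi_ne_zero]
    field_simp
    rw [I_sq]
  rw [e1] at h2
  refine h2.congr fun x => ?_
  rw [slope_def_field, e_zero, inv_div, ← div_neg]
  ring_nf

lemma tendsto_mul_A (j : Fin 2) :
    Tendsto (fun x => x * A j x) (𝓝[≠] 0) (𝓝 (I / (2 * Real.pi))) := by
  have h := tendsto_mul_inv_one_sub_e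
  have hid : Tendsto (fun x : ℂ => x) (𝓝[≠] 0) (𝓝 0) := tendsto_id.mono_left nhdsWithin_le_nhds
  have he : Tendsto e (𝓝[≠] 0) (𝓝 1) := by
    have := continuous_e.tendsto 0
    rw [e_zero] at this
    exact this.mono_left nhdsWithin_le_nhds
  have he2 : Tendsto (fun x => e (x / 2)) (𝓝[≠] 0) (𝓝 1) := by
    have : Continuous fun x : ℂ => e (x / 2) := by fun_prop
    have := this.tendsto 0
    rw [zero_div, e_zero] at this
    exact this.mono_left nhdsWithin_le_nhds
  fin_cases j
  · have := (hid.mul_const (1 / 2)).add (h.mul he)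
    rw [zero_mul, zero_add, mul_one] at this
    refine this.congr fun x => ?_
    simp only [Fin.zero_eta, A_zero, A0]; ring
  · have := h.mul he2
    rw [mul_one] at this
    refine this.congr fun x => ?_
    simp only [Fin.mk_one, A_one, A1]; ring

/-- A₀ is odd, so its Laurent expansion at 0 has no constant term. Consequently A₀² has no simple
pole, and the term k = 0 of `ff` contributes nothing to the residue. -/
lemma tendsto_A0_sub :
    Tendsto (fun x => A0 x - I / (2 * Real.pi * x)) (𝓝[≠] 0) (𝓝 0) := by
  have hπ : (Real.pi : ℂ) ≠ 0 := by simp [Real.pi_ne_zero]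
  have hid : Tendsto (fun x : ℂ => x) (𝓝[≠] 0) (𝓝 0) := tendsto_id.mono_left nhdsWithin_le_nhds
  -- the Taylor remainder of the exponential
  set R : ℂ → ℂ := fun x => e x - (1 + 2 * Real.pi * I * x + (2 * Real.pi * I * x) ^ 2 / 2) with hR
  have hRb : Tendsto (fun x => R x / x ^ 2) (𝓝[≠] 0) (𝓝 0) := by
    have hb : ∀ᶠ x : ℂ in 𝓝[≠] 0, ‖R x / x ^ 2‖ ≤ (2 * Real.pi) ^ 3 * ‖x‖ := by
      have hball : Metric.ball (0 : ℂ) (1 / (2 * Real.pi)) ∈ 𝓝 (0 : ℂ) :=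
        Metric.ball_mem_nhds _ (by have := Real.pi_pos; positivity)
      filter_upwards [mem_nhdsWithin_of_mem_nhds hball, self_mem_nhdsWithin] with x hx hx0
      rw [mem_ball_zero_iff, lt_div_iff₀ Real.two_pi_pos] at hx
      have hn : ‖2 * Real.pi * I * x‖ = 2 * Real.pi * ‖x‖ := by
        simp [abs_of_pos Real.pi_pos]
      have h3 := Complex.exp_bound (x := 2 * Real.pi * I * x) (by rw [hn]; linarith) (n := 3)
        (by norm_num)
      rw [hn] at h3
      have hsum : ∑ m ∈ Finset.range 3, (2 * Real.pi * I * x) ^ m / (m.factorial : ℂ) =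
          1 + 2 * Real.pi * I * x + (2 * Real.pi * I * x) ^ 2 / 2 := by
        simp [Finset.sum_range_succ, Nat.factorial]
      rw [hsum] at h3
      have h4 : ‖R x‖ ≤ (2 * Real.pi * ‖x‖) ^ 3 := by
        refine h3.trans (mul_le_of_le_one_right (by have := Real.pi_pos; positivity) ?_)
        norm_num [Nat.factorial]
      have hxp : 0 < ‖x‖ := norm_pos_iff.2 hx0
      rw [norm_div, norm_pow, div_le_iff₀ (by positivity)]
      refine h4.trans (le_of_eq (by ring))
    refine squeeze_zero_norm' hb ?_
    have := hid.norm.const_mul ((2 * Real.pi) ^ 3)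
    simpa using this
  have hlim := (((hid.const_mul ((2 * Real.pi * I) ^ 2 / 2)).add
    (hid.mul hRb)).add (hRb.const_mul (-(1 / (Real.pi * I))))).mul
    (tendsto_mul_inv_one_sub_e.const_mul (1 / 2 : ℂ))
  have hz : ((2 * (Real.pi : ℂ) * I) ^ 2 / 2 * 0 + 0 * 0 + -(1 / (Real.pi * I)) * 0) *
      (1 / 2 * (I / (2 * Real.pi))) = 0 := by ring
  rw [hz] at hlim
  refine hlim.congr' ?_
  -- The lattice of τ = i is auxiliary: only its real period is used, to ensure e(x) ≠ 1.
  filter_upwards [self_mem_nhdsWithin, eventually_offLattice_zero UpperHalfPlane.I] with x hx0 hx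
  have hx0' : x ≠ 0 := hx0
  have hex : 1 - e x ≠ 0 := by
    intro h
    obtain ⟨n, hn⟩ := (e_eq_one_iff x).1 (by linear_combination -h)
    exact hx 0 n (by simp [hn])
  simp only [hR, A0]
  field_simp
  ring_nf
  simp only [I_sq]
  ring

lemma tendsto_mul_A0_sq :
    Tendsto (fun x => x * A0 x ^ 2 + 1 / (4 * Real.pi ^ 2 * x)) (𝓝[≠] 0) (𝓝 0) := by
  have hid : Tendsto (fun x : ℂ => x) (𝓝[≠] 0) (𝓝 0) := tendsto_id.mono_left nhdsWithin_le_nhds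
  have h := tendsto_A0_sub
  have := (h.const_mul (I / Real.pi)).add (hid.mul (h.mul h))
  simp only [mul_zero, add_zero] at this
  refine this.congr' ?_
  filter_upwards [self_mem_nhdsWithin] with x hx
  have hx0 : x ≠ 0 := hx
  have hπ : (Real.pi : ℂ) ≠ 0 := by simp [Real.pi_ne_zero]
  field_simp
  ring_nf
  simp only [I_sq]
  ring

/-- Uniform bound for `A j (u + Nτ)`, `N ∈ ℤ`, near `u₀`, excluding the `N` with a pole at `u₀`. -/
lemma exists_bound_A (τ : ℍ) (u₀ : ℂ) : ∃ C : ℝ, 0 < C ∧ ∀ᶠ u in 𝓝 u₀, ∀ (j : Fin 2) (N : ℤ),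
    e (u₀ + N * τ) ≠ 1 → ‖A j (u + N * τ)‖ ≤ C := by
  have hτ := τ.im_pos
  -- For |N| > L the imaginary part of u + Nτ exceeds 1 in absolute value, and `norm_A_le` applies.
  -- In the 2, one unit covers the displacement |u - u₀| < 1 and the other is the threshold. The
  -- finitely many remaining N are treated by continuity.
  set L : ℤ := ⌈(|u₀.im| + 2) / τ.im⌉ with hL
  set S : Finset (Fin 2 × ℤ) := Finset.univ ×ˢ Finset.Icc (-L) L with hS
  refine ⟨3 + ∑ p ∈ S, (‖A p.1 (u₀ + p.2 * τ)‖ + 1), by positivity, ?_⟩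
  have h1 : ∀ᶠ u in 𝓝 u₀, ∀ p ∈ S, e (u₀ + p.2 * τ) ≠ 1 →
      ‖A p.1 (u + p.2 * τ)‖ ≤ ‖A p.1 (u₀ + p.2 * τ)‖ + 1 := by
    rw [Filter.eventually_all_finset]
    intro p _
    by_cases hp : e (u₀ + p.2 * τ) = 1
    · exact Eventually.of_forall fun u h => absurd hp h
    · have hc : ContinuousAt (fun u => ‖A p.1 (u + p.2 * τ)‖) u₀ :=
        (ContinuousAt.comp (f := fun u : ℂ => u + p.2 * τ) (differentiableAt_A hp).continuousAt
          (by fun_prop)).norm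
      filter_upwards [hc.eventually (gt_mem_nhds (lt_add_one _))] with u hu _ using hu.le
  filter_upwards [h1, Metric.ball_mem_nhds u₀ one_pos] with u hu hball j N hN
  by_cases hmem : (j, N) ∈ S
  · refine (hu _ hmem hN).trans ?_
    have := Finset.single_le_sum (f := fun p : Fin 2 × ℤ => ‖A p.1 (u₀ + p.2 * τ)‖ + 1)
      (fun p _ => by positivity) hmem
    simp only at this
    linarith
  · refine (norm_A_le ?_).trans (by
      have : 0 ≤ ∑ p ∈ S, (‖A p.1 (u₀ + p.2 * τ)‖ + 1) := Finset.sum_nonneg fun p _ => by positivity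
      linarith)
    have hN' : L < |N| := by
      by_contra hc
      push Not at hc
      exact hmem (by simp only [hS, Finset.mem_product, Finset.mem_univ, true_and,
        Finset.mem_Icc]; exact abs_le.1 hc)
    have h2 : (|u₀.im| + 2) / τ.im < |(N : ℝ)| := by
      refine (Int.le_ceil _).trans_lt ?_
      rw [← Int.cast_abs]; exact_mod_cast hN'
    rw [div_lt_iff₀ hτ] at h2
    have h3 : |(u - u₀).im| < 1 := (abs_im_le_norm _).trans_lt (by simpa [dist_eq_norm] using hball)
    have h4 : (u + N * τ).im = N * τ.im + (u₀.im + (u - u₀).im) := by simp; ring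
    rw [h4]
    have h5 : |(N : ℝ) * τ.im| = |(N : ℝ)| * τ.im := by rw [abs_mul, abs_of_pos hτ]
    have h6 := abs_sub_abs_le_abs_sub ((N : ℝ) * τ.im) (-(u₀.im + (u - u₀).im))
    rw [sub_neg_eq_add, abs_neg, h5] at h6
    have h7 := abs_add_le u₀.im (u - u₀).im
    linarith

end

section

open Set

/-! ### Unary theta functions, their Appell sums, and the nonholomorphic corrections -/

/-- `e(Nz/2) q^{N²/4}`. -/
def thTerm (z : ℂ) (τ : ℍ) (N : ℤ) : ℂ := e (N * z / 2) * e (N ^ 2 * τ / 4)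

/-- The theta function `∑ q^{n²} e(nz)` over `n ∈ ℤ + k/2`. -/
def eta (k : ℤ) (z : ℂ) (τ : ℍ) : ℂ := ∑' n : ℤ, thTerm z τ (2 * n + k)

/-- The summand of `rr` at `N = 2n`. -/
def rTerm (w : ℂ) (τ : ℍ) (N : ℤ) : ℂ :=
  ((Real.sign N - E1 (√τ.im * (N - w.im / τ.im)) : ℝ) : ℂ) * (e (N * w / 2) * e (-(N ^ 2 * τ / 4)))

/-- `∑ (sgn n - E₁(√τ₂ (2n - a))) e(nw) q^{-n²}` over `n ∈ ℤ + k/2`. -/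
def rr (k : ℤ) (w : ℂ) (τ : ℍ) : ℂ := ∑' n : ℤ, rTerm w τ (2 * n + k)

/-- The summand of `hh` at `N = 2n`. -/
def hTerm (j : Fin 2) (u v : ℂ) (τ : ℍ) (N : ℤ) : ℂ := thTerm v τ N * A j (u + N * τ)

/-- The Appell sum `∑ e(nv) q^{n²} A_j(u + 2nτ)` over `n ∈ ℤ + k/2`. -/
def hh (k : ℤ) (j : Fin 2) (u v : ℂ) (τ : ℍ) : ℂ := ∑' n : ℤ, hTerm j u v τ (2 * n + k)

/-- The completed Appell sums, a `2 × 2` matrix. -/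
def hC (i j : Fin 2) (u v : ℂ) (τ : ℍ) : ℂ :=
  hh ((i : ℕ) + (j : ℕ)) j u v τ - 1 / 2 * eta (i : ℕ) v τ * rr (j : ℕ) (u - v) τ

lemma injective_two_mul_add (k : ℤ) : Function.Injective fun n : ℤ => 2 * n + k :=
  fun a b h => by simpa using h

lemma tsum_parity_add_two (F : ℤ → ℂ) (k : ℤ) :
    ∑' n : ℤ, F (2 * n + (k + 2)) = ∑' n : ℤ, F (2 * n + k) := by
  rw [← (Equiv.addRight (1 : ℤ)).tsum_eq fun n => F (2 * n + k)]
  refine tsum_congr fun n => ?_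
  simp only [Equiv.coe_addRight]
  congr 1; ring

lemma tsum_parity_shift (F : ℤ → ℂ) (k : ℤ) :
    ∑' n : ℤ, F (2 * n + k + 1) = ∑' n : ℤ, F (2 * n + (k + 1)) := by simp only [add_assoc]

lemma tsum_parity_neg (F : ℤ → ℂ) (k : ℤ) :
    ∑' n : ℤ, F (-(2 * n + k)) = ∑' n : ℤ, F (2 * n + k) := by
  rw [← (Equiv.subLeft (-k)).tsum_eq fun n => F (2 * n + k)]
  refine tsum_congr fun n => ?_
  simp only [Equiv.subLeft_apply]
  congr 1; ring

lemma eta_add_two (k : ℤ) (z : ℂ) (τ : ℍ) : eta (k + 2) z τ = eta k z τ :=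
  tsum_parity_add_two _ k

lemma rr_add_two (k : ℤ) (w : ℂ) (τ : ℍ) : rr (k + 2) w τ = rr k w τ :=
  tsum_parity_add_two _ k

lemma hh_add_two (k : ℤ) (j : Fin 2) (u v : ℂ) (τ : ℍ) : hh (k + 2) j u v τ = hh k j u v τ :=
  tsum_parity_add_two _ k

lemma norm_thTerm (z : ℂ) (τ : ℍ) (N : ℤ) :
    ‖thTerm z τ N‖ = Real.exp (-(Real.pi / 2 * τ.im) * N ^ 2 - Real.pi * z.im * N) := by
  rw [thTerm, ← e_add, norm_e]
  congr 1
  have : ((N : ℂ) * z / 2 + N ^ 2 * τ / 4).im = N * z.im / 2 + N ^ 2 * τ.im / 4 := by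
    rw [show (N : ℂ) * z / 2 + N ^ 2 * τ / 4 = ((N / 2 : ℝ) : ℂ) * z + ((N ^ 2 / 4 : ℝ) : ℂ) * τ by
      push_cast; ring]
    simp only [add_im, im_ofReal_mul, UpperHalfPlane.coe_im]
    ring
  rw [this]; ring

lemma norm_thTerm_le (z : ℂ) (τ : ℍ) (N : ℤ) : ‖thTerm z τ N‖ ≤
    Real.exp (-(Real.pi / 2 * τ.im) * (N + (0 : ℝ)) ^ 2 + Real.pi * |z.im| * |(N : ℝ) + 0|) := by
  rw [norm_thTerm, Real.exp_le_exp, add_zero]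
  have h : -(z.im * N) ≤ |z.im| * |(N : ℝ)| := by rw [← abs_mul]; exact neg_le_abs _
  nlinarith [Real.pi_pos]

lemma summable_norm_thTerm (z : ℂ) (τ : ℍ) : Summable fun N => ‖thTerm z τ N‖ :=
  (summable_exp_neg_sq 0 (Real.pi * |z.im|)
    (by have := τ.im_pos; have := Real.pi_pos; positivity)).of_nonneg_of_le
    (fun N => norm_nonneg _) fun N => norm_thTerm_le z τ N

lemma summable_thTerm (z : ℂ) (τ : ℍ) : Summable (thTerm z τ) :=
  (summable_norm_thTerm z τ).of_norm

lemma summable_thTerm_parity (k : ℤ) (z : ℂ) (τ : ℍ) :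
    Summable fun n : ℤ => thTerm z τ (2 * n + k) :=
  (summable_thTerm z τ).comp_injective (injective_two_mul_add k)

/-! #### Translations of `eta` -/

lemma e_parity (n k : ℤ) : e (((2 * n + k : ℤ) : ℂ) / 2) = e ((k : ℂ) / 2) := by
  rw [show ((2 * n + k : ℤ) : ℂ) / 2 = (n : ℂ) + k / 2 by push_cast; ring, e_add, e_int, one_mul]

lemma eta_add_one (k : ℤ) (z : ℂ) (τ : ℍ) : eta k (z + 1) τ = e (k / 2) * eta k z τ := by
  unfold eta
  rw [← tsum_mul_left]
  refine tsum_congr fun n => ?_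
  rw [← e_parity n k]
  simp only [thTerm, ← e_add]
  congr 1; ring

lemma thTerm_add_tau (z : ℂ) (τ : ℍ) (N : ℤ) :
    thTerm (z + τ) τ N = e (-(z / 2) - τ / 4) * thTerm z τ (N + 1) := by
  simp only [thTerm, ← e_add]
  congr 1; push_cast; ring

lemma eta_add_tau (k : ℤ) (z : ℂ) (τ : ℍ) :
    eta k (z + τ) τ = e (-(z / 2) - τ / 4) * eta (k + 1) z τ := by
  unfold eta
  rw [← tsum_parity_shift, ← tsum_mul_left]
  exact tsum_congr fun n => thTerm_add_tau z τ _

/-! #### Translations of `rr` -/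

lemma norm_rTerm_factor (w : ℂ) (τ : ℍ) (N : ℤ) :
    ‖e (N * w / 2) * e (-(N ^ 2 * τ / 4))‖ =
      Real.exp (Real.pi / 2 * τ.im * N ^ 2 - Real.pi * w.im * N) := by
  rw [← e_add, norm_e]
  congr 1
  have : ((N : ℂ) * w / 2 + -(N ^ 2 * τ / 4)).im = N * w.im / 2 - N ^ 2 * τ.im / 4 := by
    rw [show (N : ℂ) * w / 2 + -(N ^ 2 * τ / 4) =
      ((N / 2 : ℝ) : ℂ) * w - ((N ^ 2 / 4 : ℝ) : ℂ) * τ by push_cast; ring]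
    simp only [sub_im, im_ofReal_mul, UpperHalfPlane.coe_im]
    ring
  rw [this]; ring

lemma abs_sign_sub_E1_scaled_le {t : ℝ} (ht : 0 < t) (x a : ℝ) :
    |Real.sign x - E1 (√t * (x - a))| ≤
      2 * Real.exp (-(Real.pi * t) * x ^ 2 + 2 * Real.pi * t * a * x) := by
  have h := abs_sign_sub_E1_le (√t * x) (√t * a)
  rw [sign_mul_of_pos (Real.sqrt_pos.2 ht), ← mul_sub] at h
  refine h.trans (le_of_eq ?_)
  have hs : √t ^ 2 = t := Real.sq_sqrt ht.le
  congr 2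
  linear_combination (-Real.pi * x ^ 2 + 2 * Real.pi * a * x) * hs

lemma gauss_scaled {t : ℝ} (ht : 0 < t) (x a : ℝ) : gauss (√t * (x - a)) =
    Real.exp (-(Real.pi * t) * x ^ 2 + 2 * Real.pi * t * a * x - Real.pi * t * a ^ 2) := by
  unfold gauss
  have hs : √t ^ 2 = t := Real.sq_sqrt ht.le
  rw [mul_pow, hs]
  congr 1; ring

lemma rr_dbar_aux (k : ℤ) (τ : ℍ) (w : ℂ) :
    (Summable fun n : ℤ => rTerm w τ (2 * n + k)) ∧
    HasDbarAt (fun w => rr k w τ) (I / (2 * τ.im) * ∑' n : ℤ,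
      ((2 * √τ.im * gauss (√τ.im * ((2 * n + k : ℤ) - w.im / τ.im)) : ℝ) : ℂ) *
        (e (-((2 * n + k : ℤ) ^ 2 * τ / 4)) * e ((((2 * n + k : ℤ) / 2 : ℝ) : ℂ) * w))) w := by
  have hτ := τ.im_pos
  have key := hasDbarAt_tsum (ι := ℤ) hτ
    (φ := fun n a => Real.sign (2 * n + k : ℤ) - E1 (√τ.im * ((2 * n + k : ℤ) - a)))
    (φ' := fun n a => 2 * √τ.im * gauss (√τ.im * ((2 * n + k : ℤ) - a)))
    (m := fun n => ((2 * n + k : ℤ) : ℝ) / 2)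
    (C := fun n => e (-((2 * n + k : ℤ) ^ 2 * τ / 4))) ?_ ?_ w
  · have e1 : ∀ (n : ℤ) (w : ℂ), rTerm w τ (2 * n + k) =
        ((Real.sign (2 * n + k : ℤ) - E1 (√τ.im * ((2 * n + k : ℤ) - w.im / τ.im)) : ℝ) : ℂ) *
        (e (-((2 * n + k : ℤ) ^ 2 * τ / 4)) * e (((((2 * n + k : ℤ) : ℝ) / 2 : ℝ) : ℂ) * w)) := by
      intro n w
      rw [rTerm, mul_comm (e (-((2 * n + k : ℤ) ^ 2 * τ / 4)))]
      congr 3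
      push_cast; ring
    simp only [rr, e1]
    exact key
  · intro n a
    have h1 : HasDerivAt (fun a => √τ.im * (((2 * n + k : ℤ) : ℝ) - a)) (√τ.im * -1) a :=
      ((hasDerivAt_id a).const_sub _).const_mul _
    refine (((hasDerivAt_E1 _).comp a h1).const_sub _).congr_deriv ?_
    ring
  · intro B
    -- The extra 1 in πB + 1 absorbs the factor 1 + |m|, through 1 + |N|/2 ≤ exp |N|.
    have hs := ((summable_exp_neg_sq 0 (Real.pi * B + 1)
      (by have := Real.pi_pos; positivity : 0 < Real.pi / 2 * τ.im)).comp_injective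
        (injective_two_mul_add k)).mul_left (2 + 2 * √τ.im)
    refine ⟨_, hs, fun n w hw => ?_⟩
    simp only [Function.comp, add_zero]
    set N : ℤ := 2 * n + k with hN
    have hwi : |w.im| ≤ B := (abs_im_le_norm w).trans hw
    have hC : ‖e (-((N : ℂ) ^ 2 * τ / 4)) * e ((((N : ℝ) / 2 : ℝ) : ℂ) * w)‖ =
        Real.exp (Real.pi / 2 * τ.im * N ^ 2 - Real.pi * w.im * N) := by
      rw [← norm_rTerm_factor, mul_comm]
      congr 3; push_cast; ring
    have hE : Real.exp (-(Real.pi * τ.im) * N ^ 2 + 2 * Real.pi * τ.im * (w.im / τ.im) * N) *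
        Real.exp (Real.pi / 2 * τ.im * N ^ 2 - Real.pi * w.im * N) ≤
        Real.exp (-(Real.pi / 2 * τ.im) * N ^ 2 + Real.pi * B * |(N : ℝ)|) := by
      rw [← Real.exp_add, Real.exp_le_exp]
      have h1 : w.im * N ≤ B * |(N : ℝ)| :=
        (le_abs_self _).trans (by rw [abs_mul]; gcongr)
      have h2 : 2 * Real.pi * τ.im * (w.im / τ.im) * N = 2 * Real.pi * w.im * N := by
        field_simp
      rw [h2]
      nlinarith [Real.pi_pos]
    have h1N : 1 + |(N : ℝ) / 2| ≤ Real.exp |(N : ℝ)| := by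
      have := Real.add_one_le_exp |(N : ℝ)|
      rw [abs_div, abs_two]
      linarith [abs_nonneg (N : ℝ)]
    have hsplit : Real.exp (-(Real.pi / 2 * τ.im) * N ^ 2 + (Real.pi * B + 1) * |(N : ℝ)|) =
        Real.exp |(N : ℝ)| * Real.exp (-(Real.pi / 2 * τ.im) * N ^ 2 + Real.pi * B * |(N : ℝ)|) := by
      rw [← Real.exp_add]; congr 1; ring
    have hs0 : 0 ≤ √τ.im := Real.sqrt_nonneg _
    rw [hC, hsplit]
    set X := Real.exp (-(Real.pi / 2 * τ.im) * N ^ 2 + Real.pi * B * |(N : ℝ)|)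
    have hX : 0 < X := Real.exp_pos _
    have hone : 1 ≤ Real.exp |(N : ℝ)| := Real.one_le_exp (abs_nonneg _)
    constructor
    · calc _ ≤ Real.exp |(N : ℝ)| * (2 * Real.exp (-(Real.pi * τ.im) * N ^ 2 +
            2 * Real.pi * τ.im * (w.im / τ.im) * N)) *
            Real.exp (Real.pi / 2 * τ.im * N ^ 2 - Real.pi * w.im * N) := by
            gcongr
            exact abs_sign_sub_E1_scaled_le hτ _ _
        _ ≤ Real.exp |(N : ℝ)| * (2 * X) := by
            rw [mul_assoc, mul_assoc]
            gcongr
        _ ≤ _ := by nlinarith [mul_pos (Real.exp_pos |(N : ℝ)|) hX]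
    · rw [abs_of_nonneg (by have := gauss_pos (√τ.im * (N - w.im / τ.im)); positivity)]
      calc _ ≤ 2 * √τ.im * Real.exp (-(Real.pi * τ.im) * N ^ 2 +
            2 * Real.pi * τ.im * (w.im / τ.im) * N) *
            Real.exp (Real.pi / 2 * τ.im * N ^ 2 - Real.pi * w.im * N) := by
            gcongr
            rw [gauss_scaled hτ, Real.exp_le_exp]
            have : 0 ≤ Real.pi * τ.im * (w.im / τ.im) ^ 2 := by have := Real.pi_pos; positivity
            linarith
        _ ≤ 2 * √τ.im * X := by
            rw [mul_assoc]
            gcongr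
        _ ≤ _ := by nlinarith [mul_nonneg hs0 hX.le]

lemma summable_rTerm (k : ℤ) (w : ℂ) (τ : ℍ) : Summable fun n : ℤ => rTerm w τ (2 * n + k) :=
  (rr_dbar_aux k τ w).1

/-- The Gaussian decays twice as fast as q^{-N²/4} grows. Completing the square leaves the complex
conjugate of a theta term, so the antiholomorphic derivative of `rr` is a conjugated theta function.
-/
lemma gauss_mul_rTerm_factor (w : ℂ) (τ : ℍ) (N : ℤ) :
    (gauss (√τ.im * (N - w.im / τ.im)) : ℂ) *
      (e (-(N ^ 2 * τ / 4)) * e (((N / 2 : ℝ) : ℂ) * w)) =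
    (Real.exp (-(Real.pi * w.im ^ 2 / τ.im)) : ℂ) * (starRingEnd ℂ) (thTerm w τ (-N)) := by
  have hτ := τ.im_pos
  rw [gauss_scaled hτ, thTerm, map_mul, conj_e, conj_e]
  unfold e
  simp only [Complex.ofReal_exp, ← Complex.exp_add]
  congr 1
  obtain ⟨x, y⟩ := w
  have hw : (⟨x, y⟩ : ℂ) = x + y * I := (re_add_im ⟨x, y⟩).symm
  have ht : (τ : ℂ) = τ.re + τ.im * I := (re_add_im (τ : ℂ)).symm
  have hw' : (starRingEnd ℂ) (⟨x, y⟩ : ℂ) = x - y * I := by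
    apply Complex.ext <;> simp
  have ht' : (starRingEnd ℂ) (τ : ℂ) = τ.re - τ.im * I := by
    apply Complex.ext <;> simp
  have h0 : (τ.im : ℂ) ≠ 0 := by exact_mod_cast hτ.ne'
  simp only [map_div₀, map_mul, map_pow, map_ofNat, map_intCast, hw', ht']
  rw [hw, ht]
  push_cast
  field_simp
  ring_nf
  simp only [I_sq]
  ring

lemma hasDbarAt_rr (k : ℤ) (τ : ℍ) (w : ℂ) : HasDbarAt (fun w => rr k w τ)
    (I / √τ.im * Real.exp (-(Real.pi * w.im ^ 2 / τ.im)) * (starRingEnd ℂ) (eta k w τ)) w := by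
  refine (rr_dbar_aux k τ w).2.congr ?_
  have hτ := τ.im_pos
  have h1 : ∀ n : ℤ, ((2 * √τ.im * gauss (√τ.im * ((2 * n + k : ℤ) - w.im / τ.im)) : ℝ) : ℂ) *
        (e (-((2 * n + k : ℤ) ^ 2 * τ / 4)) * e ((((2 * n + k : ℤ) / 2 : ℝ) : ℂ) * w)) =
      2 * √τ.im * Real.exp (-(Real.pi * w.im ^ 2 / τ.im)) *
        (starRingEnd ℂ) (thTerm w τ (-(2 * n + k))) := by
    intro n
    have h := gauss_mul_rTerm_factor w τ (2 * n + k)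
    rw [ofReal_mul, ofReal_mul, ofReal_ofNat]
    linear_combination (2 * √τ.im : ℂ) * h
  simp_rw [h1]
  rw [tsum_mul_left, ← Complex.conj_tsum, tsum_parity_neg, ← eta]
  have h0 : (√τ.im : ℂ) ≠ 0 := by exact_mod_cast (Real.sqrt_pos.2 hτ).ne'
  have hs : (√τ.im : ℂ) ^ 2 = τ.im := by rw [← ofReal_pow, Real.sq_sqrt hτ.le]
  rw [← hs]
  field_simp

lemma rr_add_one (k : ℤ) (w : ℂ) (τ : ℍ) : rr k (w + 1) τ = e (k / 2) * rr k w τ := by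
  unfold rr
  rw [← tsum_mul_left]
  refine tsum_congr fun n => ?_
  rw [← e_parity n k]
  simp only [rTerm, add_im, one_im, add_zero]
  rw [mul_left_comm (e _)]
  congr 1
  simp only [← e_add]
  congr 1; ring

/-- Shifting N by 1 together with w by τ preserves N - Im w / Im τ, hence the E₁-part. Only the jump
of the sign remains. -/
lemma rTerm_add_tau (w : ℂ) (τ : ℍ) (N : ℤ) : rTerm (w + τ) τ (N + 1) =
    e (w / 2 + τ / 4) * (rTerm w τ N + ((Real.sign ((N + 1 : ℤ) : ℝ) - Real.sign N : ℝ) : ℂ) *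
      (e (N * w / 2) * e (-(N ^ 2 * τ / 4)))) := by
  have hτ := τ.im_pos.ne'
  have h1 : (w + τ).im / τ.im = w.im / τ.im + 1 := by
    simp only [add_im, UpperHalfPlane.coe_im]; field_simp
  have h2 : e (((N + 1 : ℤ) : ℂ) * (w + τ) / 2) * e (-(((N + 1 : ℤ) : ℂ) ^ 2 * τ / 4)) =
      e (w / 2 + τ / 4) * (e (N * w / 2) * e (-(N ^ 2 * τ / 4))) := by
    simp only [← e_add]
    congr 1; push_cast; ring
  rw [rTerm, rTerm, h1, h2]
  have h3 : (((N + 1 : ℤ) : ℝ) - (w.im / τ.im + 1)) = N - w.im / τ.im := by push_cast; ring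
  rw [h3]
  push_cast
  ring

/-- As sgn 0 = 0, the jump of 2 is split evenly between the steps from -1 to 0 and from 0 to 1. Each
parity class therefore sees exactly one unit jump. -/
lemma sign_int_succ_sub (N : ℤ) : Real.sign ((N + 1 : ℤ) : ℝ) - Real.sign (N : ℝ) =
    if N = 0 ∨ N = -1 then 1 else 0 := by
  split_ifs with h
  · rcases h with rfl | rfl
    · simp
    · simp [Real.sign_of_neg]
  · push Not at h
    rcases lt_or_gt_of_ne h.1 with h0 | h0
    · have h1 : N + 1 < 0 := by have := h.2; omega
      rw [Real.sign_of_neg (by exact_mod_cast h1), Real.sign_of_neg (by exact_mod_cast h0), sub_self]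
    · have h1 : 0 < N + 1 := by omega
      rw [Real.sign_of_pos (by exact_mod_cast h1), Real.sign_of_pos (by exact_mod_cast h0), sub_self]

lemma rr_add_tau_aux (k : ℤ) (w : ℂ) (τ : ℍ) {n₀ : ℤ}
    (hn : ∀ n : ℤ, (2 * n + k = 0 ∨ 2 * n + k = -1) ↔ n = n₀) :
    rr (k + 1) (w + τ) τ = e (w / 2 + τ / 4) * (rr k w τ +
      e ((2 * n₀ + k : ℤ) * w / 2) * e (-((2 * n₀ + k : ℤ) ^ 2 * τ / 4))) := by
  unfold rr
  rw [← tsum_parity_shift]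
  simp_rw [rTerm_add_tau, sign_int_succ_sub, hn]
  rw [tsum_mul_left]
  have h1 : HasSum (fun n : ℤ => (((if n = n₀ then 1 else 0 : ℝ)) : ℂ) *
      (e ((2 * n + k : ℤ) * w / 2) * e (-((2 * n + k : ℤ) ^ 2 * τ / 4))))
      (e ((2 * n₀ + k : ℤ) * w / 2) * e (-((2 * n₀ + k : ℤ) ^ 2 * τ / 4))) := by
    convert! hasSum_ite_eq n₀ (e ((2 * n₀ + k : ℤ) * w / 2) * e (-((2 * n₀ + k : ℤ) ^ 2 * τ / 4)))
      using 1
    ext n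
    split_ifs with h
    · rw [h]; simp
    · simp
  rw [(summable_rTerm k w τ).tsum_add h1.summable, h1.tsum_eq]

lemma rr_one_add_tau (w : ℂ) (τ : ℍ) :
    rr 1 (w + τ) τ = e (w / 2 + τ / 4) * (rr 0 w τ + 1) := by
  have := rr_add_tau_aux 0 w τ (n₀ := 0) (fun n => by omega)
  simpa [e_zero] using this

lemma rr_zero_add_tau (w : ℂ) (τ : ℍ) :
    rr 0 (w + τ) τ = e (w / 2 + τ / 4) * rr 1 w τ + 1 := by
  have h := rr_add_tau_aux 1 w τ (n₀ := -1) (fun n => by omega)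
  rw [show (1 : ℤ) + 1 = 0 + 2 by norm_num, rr_add_two] at h
  rw [h, mul_add]
  congr 1
  simp only [← e_add]
  rw [show w / 2 + τ / 4 + ((2 * (-1) + 1 : ℤ) * w / 2 + -((2 * (-1) + 1 : ℤ) ^ 2 * (τ : ℂ) / 4)) = 0 by
    push_cast; ring, e_zero]

/-! #### The Appell sums `hh` -/

lemma OffLattice.e_ne_one {τ : ℍ} {u : ℂ} (hu : OffLattice τ u) (N : ℤ) : e (u + N * τ) ≠ 1 := by
  intro h
  obtain ⟨n, hn⟩ := (e_eq_one_iff _).1 h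
  apply hu (-N) n
  push_cast
  linear_combination hn

lemma e_int_mul_tau_ne_one (τ : ℍ) {N : ℤ} (hN : N ≠ 0) : e (0 + N * τ) ≠ 1 := by
  intro h
  obtain ⟨n, hn⟩ := (e_eq_one_iff _).1 h
  have := congrArg Complex.im hn
  simp at this
  rcases this with h | h
  · exact hN h
  · exact τ.im_ne_zero h

lemma summable_norm_hTerm (j : Fin 2) {u : ℂ} (v : ℂ) {τ : ℍ} (hu : OffLattice τ u) :
    Summable fun N => ‖hTerm j u v τ N‖ := by
  obtain ⟨C, hC, h⟩ := exists_bound_A τ u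
  refine ((summable_norm_thTerm v τ).mul_right C).of_nonneg_of_le (fun N => norm_nonneg _) fun N => ?_
  rw [hTerm, norm_mul]
  exact mul_le_mul_of_nonneg_left (h.self_of_nhds j N (hu.e_ne_one N)) (norm_nonneg _)

lemma summable_hTerm_parity (k : ℤ) (j : Fin 2) {u : ℂ} (v : ℂ) {τ : ℍ} (hu : OffLattice τ u) :
    Summable fun n : ℤ => hTerm j u v τ (2 * n + k) :=
  (summable_norm_hTerm j v hu).of_norm.comp_injective (injective_two_mul_add k)

lemma differentiableAt_A_shift {j : Fin 2} {u : ℂ} {τ : ℍ} (hu : OffLattice τ u) (N : ℤ) :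
    DifferentiableAt ℂ (fun u => A j (u + N * τ)) u :=
  DifferentiableAt.comp (g := A j) u (differentiableAt_A (hu.e_ne_one N)) (by fun_prop)

lemma differentiableAt_hh (k : ℤ) (j : Fin 2) {u : ℂ} (v : ℂ) {τ : ℍ} (hu : OffLattice τ u) :
    DifferentiableAt ℂ (fun u => hh k j u v τ) u := by
  obtain ⟨C, hC, h⟩ := exists_bound_A τ u
  obtain ⟨s, hs, hso, hus⟩ := eventually_nhds_iff.1
    (h.and ((isOpen_offLattice τ).eventually_mem hu))
  have hd : DifferentiableOn ℂ (fun u => ∑' n : ℤ, hTerm j u v τ (2 * n + k)) s := by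
    refine Complex.differentiableOn_tsum_of_summable_norm
      (u := fun n : ℤ => ‖thTerm v τ (2 * n + k)‖ * C)
      (((summable_norm_thTerm v τ).comp_injective (injective_two_mul_add k)).mul_right C) ?_ hso ?_
    · intro n z hz
      exact ((differentiableAt_A_shift (hs z hz).2 _).const_mul _).differentiableWithinAt
    · intro n z hz
      rw [hTerm, norm_mul]
      exact mul_le_mul_of_nonneg_left ((hs z hz).1 j _ (hu.e_ne_one _)) (norm_nonneg _)
  exact (hd.differentiableAt (hso.mem_nhds hus))

lemma A_add_one (j : Fin 2) (x : ℂ) : A j (x + 1) = (-1) ^ (j : ℕ) * A j x := by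
  fin_cases j
  · simp [A0_add_one]
  · simp [A1_add_one]

lemma hh_add_one (k : ℤ) (j : Fin 2) (u v : ℂ) (τ : ℍ) :
    hh k j (u + 1) v τ = (-1) ^ (j : ℕ) * hh k j u v τ := by
  unfold hh
  rw [← tsum_mul_left]
  refine tsum_congr fun n => ?_
  rw [hTerm, add_right_comm, A_add_one, hTerm]
  ring

lemma hTerm_add_tau (j : Fin 2) (u v : ℂ) (τ : ℍ) (N : ℤ) : hTerm j (u + τ) v τ N =
    e ((u - v) / 2 + τ / 4) * (thTerm v τ (N + 1) *
      (A j (u + (N + 1 : ℤ) * τ) * e (-((u + (N + 1 : ℤ) * τ) / 2)))) := by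
  have h1 : thTerm v τ N = e ((u - v) / 2 + τ / 4) * (thTerm v τ (N + 1) *
      e (-((u + (N + 1 : ℤ) * τ) / 2))) := by
    simp only [thTerm, ← e_add]
    congr 1; push_cast; ring
  rw [hTerm, h1, show u + τ + N * (τ : ℂ) = u + (N + 1 : ℤ) * τ by push_cast; ring]
  ring

lemma hh_zero_add_tau (k : ℤ) {u : ℂ} (v : ℂ) {τ : ℍ} (hu : OffLattice τ u) :
    hh k 0 (u + τ) v τ = e ((u - v) / 2 + τ / 4) * hh (k + 1) 1 u v τ + 1 / 2 * eta k v τ := by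
  have h1 : ∀ N : ℤ, hTerm 0 (u + τ) v τ N =
      e ((u - v) / 2 + τ / 4) * hTerm 1 u v τ (N + 1) + 1 / 2 * thTerm v τ N := by
    intro N
    rw [hTerm_add_tau, A_zero, A0_mul_e (hu.e_ne_one _), hTerm, A_one]
    have h2 : thTerm v τ N = e ((u - v) / 2 + τ / 4) * (thTerm v τ (N + 1) *
        e (-((u + (N + 1 : ℤ) * τ) / 2))) := by
      simp only [thTerm, ← e_add]
      congr 1; push_cast; ring
    rw [h2]; ring
  unfold hh eta
  simp_rw [h1]
  have hs := summable_hTerm_parity (k + 1) 1 v hu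
  simp only [← add_assoc] at hs
  rw [(hs.mul_left _).tsum_add ((summable_thTerm_parity k v τ).mul_left _),
    tsum_mul_left, tsum_mul_left, tsum_parity_shift]

lemma hh_one_add_tau (k : ℤ) {u : ℂ} (v : ℂ) {τ : ℍ} (hu : OffLattice τ u) :
    hh k 1 (u + τ) v τ =
      e ((u - v) / 2 + τ / 4) * (hh (k + 1) 0 u v τ + 1 / 2 * eta (k + 1) v τ) := by
  have h1 : ∀ N : ℤ, hTerm 1 (u + τ) v τ N =
      e ((u - v) / 2 + τ / 4) * (hTerm 0 u v τ (N + 1) + 1 / 2 * thTerm v τ (N + 1)) := by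
    intro N
    rw [hTerm_add_tau, A_one, A1_mul_e (hu.e_ne_one _), hTerm, A_zero]
    ring
  unfold hh eta
  simp_rw [h1]
  have hs := summable_hTerm_parity (k + 1) 0 v hu
  have ht := summable_thTerm_parity (k + 1) v τ
  simp only [← add_assoc] at hs ht
  rw [tsum_mul_left, hs.tsum_add (ht.mul_left _), tsum_mul_left, tsum_parity_shift,
    tsum_parity_shift]

/-! #### The completed Appell sums -/

lemma hC_add_one (i j : Fin 2) (u v : ℂ) (τ : ℍ) :
    hC i j (u + 1) v τ = (-1) ^ (j : ℕ) * hC i j u v τ := by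
  have h : e (((j : ℕ) : ℤ) / 2 : ℂ) = (-1) ^ (j : ℕ) := by
    fin_cases j
    · simp [e_zero]
    · simpa using e_half
  rw [hC, hh_add_one, show u + 1 - v = u - v + 1 by ring, rr_add_one, h, hC]
  ring

/-- The defect (1/2) `eta` of `hh` cancels against the defect 1 of `rr`. Completion thus makes the
translation law homogeneous, at the price of exchanging the two columns. -/
lemma hC_zero_add_tau (i : Fin 2) {u : ℂ} (v : ℂ) {τ : ℍ} (hu : OffLattice τ u) :
    hC i 0 (u + τ) v τ = e ((u - v) / 2 + τ / 4) * hC i 1 u v τ := by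
  simp only [hC, Fin.val_zero, Fin.val_one, Nat.cast_zero, Nat.cast_one, add_zero]
  rw [hh_zero_add_tau _ v hu, show u + τ - v = u - v + τ by ring, rr_zero_add_tau]
  ring

lemma hC_one_add_tau (i : Fin 2) {u : ℂ} (v : ℂ) {τ : ℍ} (hu : OffLattice τ u) :
    hC i 1 (u + τ) v τ = e ((u - v) / 2 + τ / 4) * hC i 0 u v τ := by
  simp only [hC, Fin.val_zero, Fin.val_one, Nat.cast_zero, Nat.cast_one, add_zero]
  rw [hh_one_add_tau _ v hu, show u + τ - v = u - v + τ by ring, rr_one_add_tau, add_assoc,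
    one_add_one_eq_two, eta_add_two, hh_add_two]
  ring

/-- The derivative is of rank one as a matrix in (i, j): a holomorphic theta vector in v times a
conjugated theta vector in u - v. -/
lemma hasDbarAt_hC (i j : Fin 2) {u : ℂ} (v : ℂ) {τ : ℍ} (hu : OffLattice τ u) :
    HasDbarAt (fun u => hC i j u v τ) (-(1 / 2) * eta (i : ℕ) v τ *
      (I / √τ.im * Real.exp (-(Real.pi * (u - v).im ^ 2 / τ.im)) *
        (starRingEnd ℂ) (eta (j : ℕ) (u - v) τ))) u := by
  have h1 : HasDbarAt (fun u => rr (j : ℕ) (u - v) τ)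
      (I / √τ.im * Real.exp (-(Real.pi * (u - v).im ^ 2 / τ.im)) *
        (starRingEnd ℂ) (eta (j : ℕ) (u - v) τ)) u := by
    have := HasDbarAt.comp_affine (f := fun w => rr (j : ℕ) w τ) (w := u) 1 (-v)
      (hasDbarAt_rr (j : ℕ) τ _)
    simpa [← sub_eq_add_neg] using this
  have h2 := (differentiableAt_hh (((i : ℕ) : ℤ) + ((j : ℕ) : ℤ)) j v hu).hasDbarAt.sub
    (h1.const_mul (1 / 2 * eta (i : ℕ) v τ))
  refine h2.congr ?_
  ring

lemma continuous_rr (k : ℤ) (τ : ℍ) : Continuous fun w => rr k w τ :=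
  continuous_iff_continuousAt.2 fun w => (hasDbarAt_rr k τ w).continuousAt

/-- Only the term with N = 2n + k = 0 has a pole at u = 0. Dominated convergence removes all others.
-/
lemma tendsto_mul_hh (k : ℤ) (j : Fin 2) (v : ℂ) (τ : ℍ) :
    Tendsto (fun u => u * hh k j u v τ) (𝓝[≠] 0)
      (𝓝 (∑' n : ℤ, if 2 * n + k = 0 then I / (2 * Real.pi) else 0)) := by
  have hid : Tendsto (fun x : ℂ => x) (𝓝[≠] 0) (𝓝 0) := tendsto_id.mono_left nhdsWithin_le_nhds
  obtain ⟨C, hC, h⟩ := exists_bound_A τ 0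
  have hterm : ∀ n : ℤ, Tendsto (fun u => u * hTerm j u v τ (2 * n + k)) (𝓝[≠] 0)
      (𝓝 (if 2 * n + k = 0 then I / (2 * Real.pi) else 0)) := by
    intro n
    split_ifs with hn
    · have := tendsto_mul_A j
      refine this.congr fun u => ?_
      simp [hTerm, hn, thTerm, e_zero]
    · have hc : ContinuousAt (fun u => hTerm j u v τ (2 * n + k)) 0 := by
        refine ContinuousAt.mul continuousAt_const ?_
        exact ContinuousAt.comp (g := A j) (f := fun u : ℂ => u + (2 * n + k : ℤ) * τ)
          (differentiableAt_A (e_int_mul_tau_ne_one τ hn)).continuousAt (by fun_prop)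
      have := hid.mul (hc.tendsto.mono_left nhdsWithin_le_nhds)
      rwa [zero_mul] at this
  have hfun : ∀ u, u * hh k j u v τ = ∑' n : ℤ, u * hTerm j u v τ (2 * n + k) := fun u => by
    rw [hh, tsum_mul_left]
  simp_rw [hfun]
  refine tendsto_tsum_of_dominated_convergence
    (bound := fun n : ℤ => ‖thTerm v τ (2 * n + k)‖ * (C + (‖I / (2 * (Real.pi : ℂ))‖ + 1)))
    (((summable_norm_thTerm v τ).comp_injective (injective_two_mul_add k)).mul_right _) hterm ?_
  have hball : Metric.ball (0 : ℂ) 1 ∈ 𝓝 (0 : ℂ) := Metric.ball_mem_nhds _ one_pos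
  filter_upwards [mem_nhdsWithin_of_mem_nhds h, mem_nhdsWithin_of_mem_nhds hball,
    (tendsto_mul_A j).norm.eventually (gt_mem_nhds (lt_add_one _))] with u hu hub huA n
  rw [hTerm, mul_left_comm, norm_mul]
  refine mul_le_mul_of_nonneg_left ?_ (norm_nonneg _)
  rw [mem_ball_zero_iff] at hub
  by_cases hn : 2 * n + k = 0
  · rw [hn]
    simp only [Int.cast_zero, zero_mul, add_zero]
    linarith
  · rw [norm_mul]
    have := hu j (2 * n + k) (e_int_mul_tau_ne_one τ hn)
    have h2 : 0 ≤ ‖I / (2 * (Real.pi : ℂ))‖ := norm_nonneg _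
    nlinarith [norm_nonneg u, norm_nonneg (A j (u + (2 * n + k : ℤ) * τ))]

lemma tendsto_mul_hh_even (j : Fin 2) (v : ℂ) (τ : ℍ) :
    Tendsto (fun u => u * hh 0 j u v τ) (𝓝[≠] 0) (𝓝 (I / (2 * Real.pi))) := by
  have h := tendsto_mul_hh 0 j v τ
  rw [tsum_eq_single 0 (by intro n hn; simp [hn])] at h
  simpa using h

lemma tendsto_mul_hh_odd (j : Fin 2) (v : ℂ) (τ : ℍ) :
    Tendsto (fun u => u * hh 1 j u v τ) (𝓝[≠] 0) (𝓝 0) := by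
  have h := tendsto_mul_hh 1 j v τ
  have h2 : ∀ n : ℤ, (if 2 * n + 1 = 0 then I / (2 * (Real.pi : ℂ)) else 0) = 0 := fun n => by
    rw [if_neg (by omega)]
  simpa [h2] using h

/-- The residue is a scalar matrix, so its image under conjugation by a matrix that is unitary up to
a factor is again scalar. This cancels the simple poles in `defectS`. -/
lemma tendsto_mul_hC (i j : Fin 2) (v : ℂ) (τ : ℍ) :
    Tendsto (fun u => u * hC i j u v τ) (𝓝[≠] 0)
      (𝓝 (if i = j then I / (2 * Real.pi) else 0)) := by
  have hid : Tendsto (fun x : ℂ => x) (𝓝[≠] 0) (𝓝 0) := tendsto_id.mono_left nhdsWithin_le_nhds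
  have hr : Tendsto (fun u => rr (j : ℕ) (u - v) τ) (𝓝[≠] 0) (𝓝 (rr (j : ℕ) (0 - v) τ)) := by
    have : Continuous fun u => rr (j : ℕ) (u - v) τ :=
      (continuous_rr (j : ℕ) τ).comp (by fun_prop : Continuous fun u : ℂ => u - v)
    exact (this.tendsto 0).mono_left nhdsWithin_le_nhds
  have h2 := hid.mul (hr.const_mul (1 / 2 * eta (i : ℕ) v τ))
  rw [zero_mul] at h2
  have h1 : Tendsto (fun u => u * hh ((i : ℕ) + (j : ℕ)) j u v τ) (𝓝[≠] 0)
      (𝓝 (if i = j then I / (2 * Real.pi) else 0)) := by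
    fin_cases i <;> fin_cases j
    · simpa using tendsto_mul_hh_even 0 v τ
    · simpa using tendsto_mul_hh_odd 1 v τ
    · simpa using tendsto_mul_hh_odd 0 v τ
    · have h3 : ∀ u, hh 2 1 u v τ = hh 0 1 u v τ := fun u => hh_add_two 0 1 u v τ
      simpa [one_add_one_eq_two, h3] using tendsto_mul_hh_even 1 v τ
  have := h1.sub h2
  rw [sub_zero] at this
  refine this.congr fun u => ?_
  rw [hC]; ring

end

section

open Set Matrix

/-! ### Modular behaviour of the completed Appell sums -/

lemma tsum_parity (F : ℤ → ℂ) (hF : Summable F) :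
    ∑' n : ℤ, F n = ∑' n : ℤ, F (2 * n + 0) + ∑' n : ℤ, F (2 * n + 1) := by
  have h := hF.hasSum
  refine h.unique ?_
  have h0 := (hF.comp_injective (injective_two_mul_add 0)).hasSum
  have h1 := (hF.comp_injective (injective_two_mul_add 1)).hasSum
  have := HasSum.add_isCompl (s := {n : ℤ | Even n}) (t := {n : ℤ | Even n}ᶜ) (f := F)
    (a := ∑' n : ℤ, F (2 * n + 0)) (b := ∑' n : ℤ, F (2 * n + 1)) isCompl_compl ?_ ?_
  · exact this
  · have hr : {n : ℤ | Even n} = range fun n : ℤ => 2 * n + 0 := by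
      ext n
      simp only [mem_ofPred_eq, mem_range, even_iff_exists_two_mul, add_zero, eq_comm]
    rw [hr]
    exact (injective_two_mul_add 0).hasSum_range_iff.2 h0
  · have hr : {n : ℤ | Even n}ᶜ = range fun n : ℤ => 2 * n + 1 := by
      ext n
      simp only [mem_compl_iff, mem_ofPred_eq, mem_range, Int.not_even_iff_odd, Odd, eq_comm]
    rw [hr]
    exact (injective_two_mul_add 1).hasSum_range_iff.2 h1

lemma eta_zero_eq (z : ℂ) (τ : ℍ) : eta 0 z τ = jacobiTheta₂ z (2 * τ) := by
  refine tsum_congr fun n => ?_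
  rw [thTerm, ← e_add, e, jacobiTheta₂_term]
  congr 1
  push_cast; ring

lemma eta_zero_add_eta_one (z : ℂ) (τ : ℍ) :
    eta 0 z τ + eta 1 z τ = jacobiTheta₂ (z / 2) (τ / 2) := by
  rw [eta, eta, ← tsum_parity _ (summable_thTerm z τ)]
  refine tsum_congr fun n => ?_
  rw [thTerm, ← e_add, e, jacobiTheta₂_term]
  congr 1
  ring

/-- The scalar `√(-iτ/2)`. -/
def sqrtS (τ : ℂ) : ℂ := (-I * (τ / 2)) ^ (1 / 2 : ℂ)

lemma sqrtS_ne_zero (τ : ℍ) : sqrtS τ ≠ 0 := by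
  have : (τ : ℂ) ≠ 0 := UpperHalfPlane.ne_zero τ
  simp [sqrtS, this]

lemma sqrtS_sq (τ : ℂ) : sqrtS τ * sqrtS τ = -I * (τ / 2) := by
  rw [sqrtS, ← pow_two, ← Complex.cpow_nat_mul]
  norm_num

lemma sqrtS_smul {r : ℝ} (hr : 0 < r) {τ : ℂ} (hτ : τ ≠ 0) : sqrtS (r * τ) = √r * sqrtS τ := by
  have hx : -I * (τ / 2) ≠ 0 := by simp [hτ]
  have hr' : (r : ℂ) ≠ 0 := by exact_mod_cast hr.ne'
  rw [sqrtS, sqrtS, show -I * (r * τ / 2) = r * (-I * (τ / 2)) by ring,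
    Complex.cpow_def_of_ne_zero (mul_ne_zero hr' hx), Complex.log_ofReal_mul hr hx, add_mul,
    Complex.exp_add, ← Complex.cpow_def_of_ne_zero hx, Real.sqrt_eq_rpow,
    Complex.ofReal_cpow hr.le, Complex.cpow_def_of_ne_zero hr', Complex.ofReal_log hr.le]
  norm_num

lemma sqrtS_mul_conj (τ : ℂ) : sqrtS τ * (starRingEnd ℂ) (sqrtS τ) = (‖τ‖ / 2 : ℝ) := by
  rw [mul_conj, normSq_eq_norm_sq, pow_two, ← norm_mul, sqrtS_sq]
  simp

/-- The theta functional equation relates the parameters τ/2 and -2/τ. The first gives `eta 0 + eta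
1`, the sum over all N; the second gives the even part alone. -/
lemma eta_zero_S {τ τ' : ℍ} (h : (τ' : ℂ) = -1 / τ) (z : ℂ) :
    eta 0 (z / τ) τ' = sqrtS τ * e (z ^ 2 / (4 * τ)) * (eta 0 z τ + eta 1 z τ) := by
  have hτ : (τ : ℂ) ≠ 0 := UpperHalfPlane.ne_zero τ
  have h2 : sqrtS τ ≠ 0 := sqrtS_ne_zero τ
  rw [eta_zero_add_eta_one, jacobiTheta₂_functional_equation, eta_zero_eq, h]
  rw [show 2 * (-1 / (τ : ℂ)) = -1 / (τ / 2) by field_simp,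
    show z / 2 / ((τ : ℂ) / 2) = z / τ by field_simp]
  rw [← sqrtS]
  have h3 : e (z ^ 2 / (4 * τ)) * cexp (-Real.pi * I * (z / 2) ^ 2 / (τ / 2)) = 1 := by
    rw [e, ← Complex.exp_add, Complex.exp_eq_one_iff]
    exact ⟨0, by field_simp; ring⟩
  generalize jacobiTheta₂ (z / τ) (-1 / (τ / 2)) = J
  have h4 : sqrtS τ * (1 / sqrtS τ) = 1 := by field_simp
  linear_combination (-J) * h3 - J * e (z ^ 2 / (4 * τ)) *
    cexp (-Real.pi * I * (z / 2) ^ 2 / (τ / 2)) * h4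

lemma eta_sub_one (k : ℤ) (z : ℂ) (τ : ℍ) : eta k z τ = e (k / 2) * eta k (z - 1) τ := by
  rw [← eta_add_one, sub_add_cancel]

/-- Translate `eta_zero_S` by τ' = -1/τ. On the left this converts `eta 0` into `eta 1`; on the
right it is z ↦ z - 1, which flips the sign of `eta 1`. -/
lemma eta_one_S {τ τ' : ℍ} (h : (τ' : ℂ) = -1 / τ) (z : ℂ) :
    eta 1 (z / τ) τ' = sqrtS τ * e (z ^ 2 / (4 * τ)) * (eta 0 z τ - eta 1 z τ) := by
  have hτ : (τ : ℂ) ≠ 0 := UpperHalfPlane.ne_zero τ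
  have h1 := eta_add_tau 0 (z / τ) τ'
  rw [h, show z / (τ : ℂ) + -1 / τ = (z - 1) / τ by ring, eta_zero_S h, zero_add] at h1
  have h0 := eta_sub_one 0 z τ
  have h2 := eta_sub_one 1 z τ
  simp only [Int.cast_zero, zero_div, e_zero, one_mul, Int.cast_one, e_half] at h0 h2
  have h3 : e ((z - 1) ^ 2 / (4 * τ)) = e (-(z / τ / 2) - -1 / τ / 4) * e (z ^ 2 / (4 * τ)) := by
    rw [← e_add]
    congr 1
    field_simp
    ring
  rw [h3] at h1
  have h4 := e_ne_zero (-(z / τ / 2) - -1 / τ / 4)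
  refine mul_left_cancel₀ h4 ?_
  rw [← h1, h0, h2]
  ring

/-- The `2 × 2` Hadamard matrix. -/
def hadamard : Matrix (Fin 2) (Fin 2) ℂ := !![1, 1; 1, -1]

lemma eta_S {τ τ' : ℍ} (h : (τ' : ℂ) = -1 / τ) (z : ℂ) (i : Fin 2) :
    eta (i : ℕ) (z / τ) τ' = sqrtS τ * e (z ^ 2 / (4 * τ)) *
      ∑ k : Fin 2, hadamard i k * eta (k : ℕ) z τ := by
  fin_cases i
  · simp [hadamard, eta_zero_S h, Fin.sum_univ_two]
  · simp [hadamard, eta_one_S h, Fin.sum_univ_two, sub_eq_add_neg]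

lemma offLattice_S {τ τ' : ℍ} (h : (τ' : ℂ) = -1 / τ) {u : ℂ} (hu : OffLattice τ u) :
    OffLattice τ' (u / τ) := by
  have hτ : (τ : ℂ) ≠ 0 := UpperHalfPlane.ne_zero τ
  intro m n hmn
  apply hu n (-m)
  rw [h] at hmn
  field_simp at hmn
  push_cast
  linear_combination hmn

lemma offLattice_T {τ τ' : ℍ} (n : ℤ) (h : (τ' : ℂ) = τ + n) {u : ℂ} (hu : OffLattice τ u) :
    OffLattice τ' u := by
  intro m k hmk
  apply hu m (m * n + k)
  rw [hmk, h]
  push_cast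
  ring

lemma im_S {τ τ' : ℍ} (h : (τ' : ℂ) = -1 / τ) : τ'.im = τ.im / ‖(τ : ℂ)‖ ^ 2 := by
  have := congrArg Complex.im h
  rw [UpperHalfPlane.coe_im] at this
  rw [this, ← normSq_eq_norm_sq]
  simp [neg_div]

lemma gaussian_S {τ τ' : ℍ} (h : (τ' : ℂ) = -1 / τ) (z : ℂ) :
    (z / τ).im ^ 2 / τ'.im + (1 / τ * z ^ 2).im = z.im ^ 2 / τ.im := by
  have hτ := τ.im_pos
  rw [im_S h, ← normSq_eq_norm_sq]
  have hn : (Complex.normSq τ) ≠ 0 := by simp [UpperHalfPlane.ne_zero]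
  have hn2 : Complex.normSq τ = τ.re ^ 2 + τ.im ^ 2 := by
    rw [Complex.normSq_apply]; simp [pow_two]
  simp only [Complex.div_im, Complex.mul_im, pow_two z, Complex.one_im, Complex.one_re,
    Complex.mul_re, Complex.div_re, UpperHalfPlane.coe_im, UpperHalfPlane.coe_re]
  field_simp
  rw [hn2]
  ring

lemma hC_sub_tau (i j : Fin 2) {u : ℂ} (v : ℂ) {τ : ℍ} (hu : OffLattice τ u) :
    hC i j (u - τ) v τ = e (-((u - v) / 2) + τ / 4) * hC i (1 - j) u v τ := by
  have hu' : OffLattice τ (u - τ) := by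
    have := (offLattice_add_iff τ (u - τ) 1 0).1
    apply this
    simpa using hu
  have h3 : e ((u - τ - v) / 2 + τ / 4) * e (-((u - v) / 2) + τ / 4) = 1 := by
    rw [← e_add, ← e_zero]; congr 1; ring
  fin_cases j
  · have h := hC_one_add_tau i v hu'
    rw [sub_add_cancel] at h
    simp only [Fin.zero_eta, sub_zero]
    rw [h]
    linear_combination (-hC i 0 (u - τ) v τ) * h3
  · have h := hC_zero_add_tau i v hu'
    rw [sub_add_cancel] at h
    simp only [Fin.mk_one, sub_self]
    rw [h]
    linear_combination (-hC i 1 (u - τ) v τ) * h3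

lemma hC_add_tau (i j : Fin 2) {u : ℂ} (v : ℂ) {τ : ℍ} (hu : OffLattice τ u) :
    hC i j (u + τ) v τ = e ((u - v) / 2 + τ / 4) * hC i (1 - j) u v τ := by
  fin_cases j
  · simpa using hC_zero_add_tau i v hu
  · simpa using hC_one_add_tau i v hu

/-- The defect of the transformation law of `hC` under `τ ↦ -1/τ`. -/
def defectS (τ τ' : ℍ) (v : ℂ) (i j : Fin 2) (u : ℂ) : ℂ :=
  e (-(2 * u * v - u ^ 2) / (4 * τ)) * hC i j (u / τ) (v / τ) τ' -
    τ / 2 * ∑ k, ∑ l, hadamard i k * hC k l u v τ * hadamard j l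

/-- Adding 1 to u subtracts τ' from u/τ, which exchanges the columns. On the other side the sign of
the second column becomes the same exchange after multiplication by the Hadamard matrix. -/
lemma defectS_add_one {τ τ' : ℍ} (h : (τ' : ℂ) = -1 / τ) (v : ℂ) (i j : Fin 2) {u : ℂ}
    (hu : OffLattice τ u) : defectS τ τ' v i j (u + 1) = defectS τ τ' v i (1 - j) u := by
  have hτ : (τ : ℂ) ≠ 0 := UpperHalfPlane.ne_zero τ
  have h1 := hC_sub_tau i j (v / τ) (offLattice_S h hu)
  rw [h, show u / (τ : ℂ) - -1 / τ = (u + 1) / τ by ring] at h1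
  unfold defectS
  rw [h1, ← mul_assoc, ← e_add]
  congr 1
  · congr 2
    field_simp
    ring
  · congr 1
    simp only [hC_add_one]
    fin_cases j <;> simp [hadamard, Fin.sum_univ_two]

lemma defectS_add_tau {τ τ' : ℍ} (v : ℂ) (i j : Fin 2) {u : ℂ}
    (hu : OffLattice τ u) : defectS τ τ' v i j (u + τ) =
      e ((u - v) / 2 + τ / 4) * ((-1) ^ (j : ℕ) * defectS τ τ' v i j u) := by
  have hτ : (τ : ℂ) ≠ 0 := UpperHalfPlane.ne_zero τ
  unfold defectS
  rw [show (u + τ) / (τ : ℂ) = u / τ + 1 by field_simp, hC_add_one]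
  have h1 : e (-(2 * (u + τ) * v - (u + τ) ^ 2) / (4 * τ)) =
      e ((u - v) / 2 + τ / 4) * e (-(2 * u * v - u ^ 2) / (4 * τ)) := by
    rw [← e_add]; congr 1; field_simp; ring
  rw [h1]
  simp only [hC_add_tau _ _ v hu]
  fin_cases j
  · simp [hadamard, Fin.sum_univ_two]; ring
  · simp [hadamard, Fin.sum_univ_two]; ring

lemma e_mul_conj_e (x : ℂ) : e x * (starRingEnd ℂ) (e x) = (Real.exp (-(4 * Real.pi * x.im)) : ℝ) := by
  rw [mul_conj, normSq_eq_norm_sq, norm_e, ← Real.exp_nat_mul]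
  congr 2; push_cast; ring

/-- Both factors of the rank-one derivative transform by the Hadamard matrix (`eta_S`). It remains
to match the exponentials through `gaussian_S` and the powers of |τ| from the chain rule and from
√Im τ'. -/
lemma hasDbarAt_defectS {τ τ' : ℍ} (h : (τ' : ℂ) = -1 / τ) (v : ℂ) (i j : Fin 2) {u : ℂ}
    (hu : OffLattice τ u) : HasDbarAt (defectS τ τ' v i j) 0 u := by
  have hτ : (τ : ℂ) ≠ 0 := UpperHalfPlane.ne_zero τ
  have hτ2 := τ.im_pos
  have hu' := offLattice_S h hu
  have h0 := hasDbarAt_hC i j (v / τ) hu'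
  rw [show u / (τ : ℂ) = 1 / τ * u + 0 by ring] at h0
  have h1 := HasDbarAt.comp_affine (w := u) (1 / τ) 0 (f := fun u => hC i j u (v / τ) τ') h0
  simp only [add_zero, one_div_mul_eq_div] at h1
  have hF : DifferentiableAt ℂ (fun u => e (-(2 * u * v - u ^ 2) / (4 * τ))) u :=
    DifferentiableAt.comp (g := e) u (differentiable_e _)
      (by fun_prop : DifferentiableAt ℂ (fun u : ℂ => -(2 * u * v - u ^ 2) / (4 * τ)) u)
  have h2 := HasDbarAt.sum Finset.univ (f := fun k u => ∑ l, hadamard i k * hC k l u v τ * hadamard j l)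
    (w := u) (fun k _ => HasDbarAt.sum Finset.univ (fun l _ => by
      have := (hasDbarAt_hC k l v hu).const_mul (hadamard i k * hadamard j l)
      simpa only [mul_right_comm _ (hadamard j l)] using this))
  refine ((HasDbarAt.holo_mul hF h1).sub (h2.const_mul (τ / 2))).congr ?_
  rw [show u / (τ : ℂ) - v / τ = (u - v) / τ by ring, eta_S h, eta_S h]
  have hn : (‖(τ : ℂ)‖ : ℂ) ≠ 0 := by simpa using hτ
  have hs : √τ'.im = √τ.im / ‖(τ : ℂ)‖ := by
    rw [im_S h, Real.sqrt_div hτ2.le, Real.sqrt_sq (norm_nonneg _)]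
  have hs0 : (√τ.im : ℂ) ≠ 0 := by exact_mod_cast (Real.sqrt_pos.2 hτ2).ne'
  have hg := gaussian_S h (u - v)
  have hE : e (-(2 * u * v - u ^ 2) / (4 * τ)) * e (v ^ 2 / (4 * τ)) *
      (starRingEnd ℂ) (e ((u - v) ^ 2 / (4 * τ))) *
      Real.exp (-(Real.pi * ((u - v) / τ).im ^ 2 / τ'.im)) =
      Real.exp (-(Real.pi * (u - v).im ^ 2 / τ.im)) := by
    rw [← e_add, show -(2 * u * v - u ^ 2) / (4 * (τ : ℂ)) + v ^ 2 / (4 * τ) = (u - v) ^ 2 / (4 * τ) by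
      ring, e_mul_conj_e, ← ofReal_mul, ← Real.exp_add]
    congr 2
    have : ((u - v) ^ 2 / (4 * (τ : ℂ))).im = (1 / τ * (u - v) ^ 2).im / 4 := by
      rw [show (u - v) ^ 2 / (4 * (τ : ℂ)) = (1 / τ * (u - v) ^ 2) / (4 : ℝ) by push_cast; ring,
        Complex.div_ofReal_im]
    rw [this]
    linear_combination (-Real.pi) * hg
  have hc := sqrtS_mul_conj τ
  have hcc : (starRingEnd ℂ) (τ : ℂ) * τ = (‖(τ : ℂ)‖ : ℂ) ^ 2 := by
    rw [mul_comm, mul_conj, normSq_eq_norm_sq]; push_cast; rfl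
  have hcτ : (starRingEnd ℂ) (τ : ℂ) ≠ 0 := by simpa using hτ
  rw [hs]
  push_cast at hc
  simp only [map_mul, map_div₀, map_one, map_sum]
  have hH : ∀ k l, (starRingEnd ℂ) (hadamard k l) = hadamard k l := by
    intro k l; fin_cases k <;> fin_cases l <;> simp [hadamard]
  simp only [hH]
  have hcc' : (‖(τ : ℂ)‖ : ℂ) * (‖(τ : ℂ)‖ / 2) * (1 / (starRingEnd ℂ) (τ : ℂ)) = τ / 2 := by
    field_simp; rw [← hcc]
  rw [← hE, ← hcc', ← hc]
  simp only [Fin.sum_univ_two]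
  push_cast
  field_simp
  ring

lemma tendsto_defectS (τ τ' : ℍ) (v : ℂ) (i j : Fin 2) :
    Tendsto (fun u => u * defectS τ τ' v i j u) (𝓝[≠] 0) (𝓝 0) := by
  have hτ : (τ : ℂ) ≠ 0 := UpperHalfPlane.ne_zero τ
  have hE : Tendsto (fun u => e (-(2 * u * v - u ^ 2) / (4 * τ))) (𝓝[≠] 0) (𝓝 1) := by
    have : Continuous fun u => e (-(2 * u * v - u ^ 2) / (4 * τ)) := by fun_prop
    have := this.tendsto 0
    rw [show -(2 * 0 * v - 0 ^ 2) / (4 * (τ : ℂ)) = 0 by ring, e_zero] at this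
    exact this.mono_left nhdsWithin_le_nhds
  have hdiv : Tendsto (fun u : ℂ => u / τ) (𝓝[≠] 0) (𝓝[≠] 0) := by
    refine tendsto_nhdsWithin_iff.2 ⟨?_, ?_⟩
    · have : Continuous fun u : ℂ => u / τ := by fun_prop
      have := this.tendsto 0
      rw [zero_div] at this
      exact this.mono_left nhdsWithin_le_nhds
    · filter_upwards [self_mem_nhdsWithin] with u hu
      exact div_ne_zero hu hτ
  have h1 := ((tendsto_mul_hC i j (v / τ) τ').comp hdiv).const_mul (τ : ℂ)
  have h2 := tendsto_finsetSum (Finset.univ : Finset (Fin 2)) fun k _ =>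
    tendsto_finsetSum (Finset.univ : Finset (Fin 2)) fun l _ =>
      (tendsto_mul_hC k l v τ).const_mul (hadamard i k * hadamard j l)
  have h3 := (hE.mul h1).sub (h2.const_mul ((τ : ℂ) / 2))
  have hz : (1 * ((τ : ℂ) * if i = j then I / (2 * Real.pi) else 0)) - τ / 2 * ∑ k : Fin 2, ∑ l : Fin 2,
      hadamard i k * hadamard j l * (if k = l then I / (2 * Real.pi) else 0) = 0 := by
    fin_cases i <;> fin_cases j <;> simp [hadamard, Fin.sum_univ_two] <;> ring
  rw [hz] at h3
  refine h3.congr fun u => ?_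
  simp only [Function.comp, defectS, Fin.sum_univ_two]
  field_simp

theorem hC_S {τ τ' : ℍ} (h : (τ' : ℂ) = -1 / τ) {u : ℂ} (v : ℂ) (i j : Fin 2)
    (hu : OffLattice τ u) : hC i j (u / τ) (v / τ) τ' =
      τ / 2 * e ((2 * u * v - u ^ 2) / (4 * τ)) *
        ∑ k, ∑ l, hadamard i k * hC k l u v τ * hadamard j l := by
  -- The multiplier e((u - v)/2 + τ/4) of the translation by τ has absolute value exp(-2πm(Im τ + 2
  -- Im(u - v))) with m = 1/4.
  have key := eq_zero_of_negative_index τ (m := 1 / 4) (by norm_num) v (D := defectS τ τ' v i)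
    (fun j u hu => (hasDbarAt_defectS h v i j hu).differentiableAt)
    (tendsto_defectS τ τ' v i) ?_ ?_ j u hu
  · unfold defectS at key
    have h1 : e ((2 * u * v - u ^ 2) / (4 * τ)) * e (-(2 * u * v - u ^ 2) / (4 * τ)) = 1 := by
      rw [← e_add, ← e_zero]; congr 1; ring
    linear_combination e ((2 * u * v - u ^ 2) / (4 * τ)) * key - hC i j (u / τ) (v / τ) τ' * h1
  · intro u hu
    simp only [defectS_add_one h v i _ hu, Fin.sum_univ_two]
    simp [add_comm]
  · intro u hu
    simp only [defectS_add_tau v i _ hu, Fin.sum_univ_two, norm_mul, norm_e, norm_pow, norm_neg,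
      norm_one, one_pow, one_mul, ← mul_add]
    congr 2
    have : ((u - v) / 2 + (τ : ℂ) / 4).im = (u - v).im / 2 + τ.im / 4 := by
      rw [add_im, ← UpperHalfPlane.coe_im]
      congr 1
      · exact_mod_cast Complex.div_ofReal_im (u - v) 2
      · exact_mod_cast Complex.div_ofReal_im (τ : ℂ) 4
    rw [this]; ring

end

section

open Set Matrix

/-! ### The modular cocycle -/

/-- The `2 × 2` matrix of completed Appell sums. -/
def hM (u v : ℂ) (τ : ℍ) : Matrix (Fin 2) (Fin 2) ℂ := Matrix.of fun i j => hC i j u v τ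

/-- The vector of unary theta functions. -/
def etaV (z : ℂ) (τ : ℍ) : Fin 2 → ℂ := fun i => eta (i : ℕ) z τ

/-- A substitution `τ ↦ τ'` with automorphy factor `j` and `s = c / j`, acting on the vector `etaV`
through the matrix `M` and on `hM` through conjugation by `M`. -/
structure IsModular (s j : ℂ) (τ τ' : ℍ) (M : Matrix (Fin 2) (Fin 2) ℂ) : Prop where
  ne_zero : j ≠ 0
  unitary : M * Mᴴ = (‖j‖ : ℂ) • (1 : Matrix (Fin 2) (Fin 2) ℂ)
  im : τ'.im * ‖j‖ ^ 2 = τ.im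
  gaussian : ∀ z : ℂ, (z / j).im ^ 2 / τ'.im + (s * z ^ 2).im = z.im ^ 2 / τ.im
  offLattice : ∀ u, OffLattice τ u → OffLattice τ' (u / j)
  eta : ∀ z, etaV (z / j) τ' = e (s * z ^ 2 / 4) • M.mulVec (etaV z τ)
  hM : ∀ u v, OffLattice τ u →
    hM (u / j) (v / j) τ' = (j / ‖j‖ * e (s * (2 * u * v - u ^ 2) / 4)) • (M * hM u v τ * Mᴴ)

lemma IsModular.comp {s₁ j₁ s₂ j₂ : ℂ} {τ τ₁ τ₂ : ℍ} {M₁ M₂ : Matrix (Fin 2) (Fin 2) ℂ}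
    (h₂ : IsModular s₂ j₂ τ₁ τ₂ M₂) (h₁ : IsModular s₁ j₁ τ τ₁ M₁) :
    IsModular (s₁ + s₂ / j₁ ^ 2) (j₁ * j₂) τ τ₂ (M₂ * M₁) where
  ne_zero := mul_ne_zero h₁.ne_zero h₂.ne_zero
  unitary := by
    rw [conjTranspose_mul, Matrix.mul_assoc, ← Matrix.mul_assoc M₁, h₁.unitary, Matrix.smul_mul,
      Matrix.one_mul, Matrix.mul_smul, h₂.unitary, smul_smul, norm_mul]
    push_cast; rfl
  im := by rw [← h₁.im, ← h₂.im, norm_mul]; ring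
  gaussian z := by
    have h := h₁.ne_zero
    rw [← h₁.gaussian z, ← h₂.gaussian (z / j₁), div_div, add_assoc, ← add_im]
    congr 2
    field_simp
    ring
  offLattice u hu := by
    rw [← div_div]; exact h₂.offLattice _ (h₁.offLattice u hu)
  eta z := by
    have h := h₁.ne_zero
    rw [← div_div, h₂.eta, h₁.eta, mulVec_smul, smul_smul, mulVec_mulVec, ← e_add]
    congr 2
    field_simp
    ring
  hM u v hu := by
    have h := h₁.ne_zero
    rw [← div_div, ← div_div, h₂.hM _ _ (h₁.offLattice u hu), h₁.hM u v hu]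
    rw [Matrix.mul_smul, Matrix.smul_mul, smul_smul, conjTranspose_mul]
    simp only [Matrix.mul_assoc]
    congr 1
    rw [norm_mul, show (s₁ + s₂ / j₁ ^ 2) * (2 * u * v - u ^ 2) / 4 =
      s₂ * (2 * (u / j₁) * (v / j₁) - (u / j₁) ^ 2) / 4 + s₁ * (2 * u * v - u ^ 2) / 4 by
        field_simp; ring, e_add]
    push_cast
    ring

lemma hadamard_conjTranspose : hadamardᴴ = hadamard := by
  ext i j
  fin_cases i <;> fin_cases j <;> simp [hadamard]

lemma hadamard_transpose : hadamardᵀ = hadamard := by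
  ext i j
  fin_cases i <;> fin_cases j <;> simp [hadamard]

lemma hadamard_mul_self : hadamard * hadamard = (2 : ℂ) • (1 : Matrix (Fin 2) (Fin 2) ℂ) := by
  ext i j
  fin_cases i <;> fin_cases j <;> simp [hadamard, Matrix.mul_apply, Fin.sum_univ_two] <;> norm_num

lemma isModular_S {τ τ' : ℍ} (h : (τ' : ℂ) = -1 / τ) :
    IsModular (1 / τ) τ τ τ' (sqrtS τ • hadamard) where
  ne_zero := UpperHalfPlane.ne_zero τ
  unitary := by
    rw [conjTranspose_smul, hadamard_conjTranspose, Matrix.smul_mul, Matrix.mul_smul, hadamard_mul_self,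
      smul_smul, smul_smul]
    congr 1
    have := sqrtS_mul_conj τ
    rw [mul_assoc, mul_comm _ (2 : ℂ), mul_left_comm, ← starRingEnd_apply, this]
    push_cast; ring
  im := by
    rw [im_S h, div_mul_cancel₀]
    simp [UpperHalfPlane.ne_zero]
  gaussian := gaussian_S h
  offLattice u hu := offLattice_S h hu
  eta z := by
    ext i
    rw [etaV, eta_S h]
    simp only [Pi.smul_apply, smul_mulVec, smul_eq_mul, mulVec, dotProduct, etaV]
    rw [show 1 / (τ : ℂ) * z ^ 2 / 4 = z ^ 2 / (4 * τ) by ring]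
    ring
  hM u v hu := by
    ext i j
    rw [hM, of_apply, hC_S h v i j hu, conjTranspose_smul, hadamard_conjTranspose, Matrix.smul_mul,
      Matrix.smul_mul, Matrix.mul_smul, smul_smul, smul_smul, Matrix.smul_apply, smul_eq_mul]
    have h1 := sqrtS_mul_conj τ
    rw [starRingEnd_apply] at h1
    have hn : (‖(τ : ℂ)‖ : ℂ) ≠ 0 := by simp [UpperHalfPlane.ne_zero]
    rw [show 1 / (τ : ℂ) * (2 * u * v - u ^ 2) / 4 = (2 * u * v - u ^ 2) / (4 * τ) by ring,
      mul_assoc _ (sqrtS τ), h1]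
    have h2 : (hadamard * hM u v τ * hadamard) i j =
        ∑ k, ∑ l, hadamard i k * hC k l u v τ * hadamard j l := by
      have h3 : ∀ l, hadamard l j = hadamard j l := fun l =>
        congrFun (congrFun hadamard_transpose j) l
      simp only [Matrix.mul_apply, Fin.sum_univ_two, h3, hM, of_apply]
      ring
    rw [h2]
    push_cast
    field_simp

lemma e_sq_int_quarter (N n : ℤ) : e (N ^ 2 * n / 4) = if Even N then 1 else e (n / 4) := by
  split_ifs with h
  · obtain ⟨k, rfl⟩ := h
    rw [show (((k + k : ℤ) : ℂ) ^ 2 * n / 4) = ((k ^ 2 * n : ℤ) : ℂ) by push_cast; ring, e_int]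
  · obtain ⟨k, rfl⟩ := Int.not_even_iff_odd.1 h
    rw [show (((2 * k + 1 : ℤ) : ℂ) ^ 2 * n / 4) = (((k ^ 2 + k) * n : ℤ) : ℂ) + n / 4 by
      push_cast; ring, e_add, e_int, one_mul]

lemma thTerm_T {τ τ' : ℍ} (n : ℤ) (h : (τ' : ℂ) = τ + n) (z : ℂ) (N : ℤ) :
    thTerm z τ' N = (if Even N then 1 else e (n / 4)) * thTerm z τ N := by
  rw [← e_sq_int_quarter, thTerm, thTerm, h]
  simp only [← e_add]
  congr 1; ring

/-- The diagonal matrix `diag(1, iⁿ)`. -/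
def diagT (n : ℤ) : Matrix (Fin 2) (Fin 2) ℂ := diagonal ![1, e (n / 4)]

lemma diagT_add (m n : ℤ) : diagT m * diagT n = diagT (m + n) := by
  rw [diagT, diagT, diagonal_mul_diagonal, diagT]
  congr 1
  ext i
  fin_cases i
  · simp
  · change e (m / 4) * e (n / 4) = e ((m + n : ℤ) / 4)
    rw [← e_add]
    push_cast; congr 1; ring

lemma diagT_four_mul (n : ℤ) : diagT (4 * n) = 1 := by
  rw [diagT, show (((4 * n : ℤ) : ℂ) / 4) = n by push_cast; ring, e_int, ← diagonal_one]
  congr 1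
  ext i
  fin_cases i <;> simp

lemma eta_T {τ τ' : ℍ} (n : ℤ) (h : (τ' : ℂ) = τ + n) (z : ℂ) (i : Fin 2) :
    eta (i : ℕ) z τ' = ![1, e (n / 4)] i * eta (i : ℕ) z τ := by
  unfold eta
  rw [← tsum_mul_left]
  refine tsum_congr fun m => ?_
  rw [thTerm_T n h]
  fin_cases i
  · simp
  · simp

lemma im_T {τ τ' : ℍ} (n : ℤ) (h : (τ' : ℂ) = τ + n) : τ'.im = τ.im := by
  have := congrArg Complex.im h
  simpa using this

lemma rr_T {τ τ' : ℍ} (n : ℤ) (h : (τ' : ℂ) = τ + n) (w : ℂ) (i : Fin 2) :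
    rr (i : ℕ) w τ' = ![1, e (-n / 4)] i * rr (i : ℕ) w τ := by
  unfold rr
  rw [← tsum_mul_left]
  refine tsum_congr fun m => ?_
  have h2 := e_sq_int_quarter (2 * m + ((i : ℕ) : ℤ)) (-n)
  have h3 : (if Even (2 * m + ((i : ℕ) : ℤ)) then 1 else e ((-n : ℤ) / 4)) =
      ![1, e (-n / 4)] i := by
    fin_cases i <;> simp
  rw [h3] at h2
  rw [← h2, rTerm, rTerm, im_T n h, h, mul_left_comm (e _)]
  congr 1
  simp only [← e_add]
  congr 1
  push_cast
  ring

lemma A_add_int (j : Fin 2) (x : ℂ) (m : ℤ) : A j (x + m) = e ((j : ℕ) * m / 2) * A j x := by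
  have h : ∀ x : ℂ, e (x + m) = e x := fun x => by rw [e_add, e_int, mul_one]
  fin_cases j
  · simp [A0, h, e_zero]
  · simp only [Fin.mk_one, A_one, A1, h, add_div, e_add]
    simp
    ring

lemma hTerm_T {τ τ' : ℍ} (n : ℤ) (h : (τ' : ℂ) = τ + n) (j : Fin 2) (u v : ℂ) (N : ℤ) :
    hTerm j u v τ' N = ((if Even N then 1 else e (n / 4)) * e ((j : ℕ) * (N * n) / 2)) *
      hTerm j u v τ N := by
  rw [hTerm, thTerm_T n h, h, show u + N * ((τ : ℂ) + n) = u + N * τ + (N * n : ℤ) by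
    push_cast; ring, A_add_int, hTerm]
  push_cast
  ring

/-- The summation class i + j is chosen so that the phase of the theta term and that of A_j combine
to the phase of η_i times the conjugate phase of η_j. Thus `hh` follows the same law as its
correction. -/
lemma hh_T {τ τ' : ℍ} (n : ℤ) (h : (τ' : ℂ) = τ + n) (i j : Fin 2) (u v : ℂ) :
    hh ((i : ℕ) + (j : ℕ)) j u v τ' =
      (![1, e (n / 4)] i * ![1, e (-n / 4)] j) * hh ((i : ℕ) + (j : ℕ)) j u v τ := by
  unfold hh
  rw [← tsum_mul_left]
  refine tsum_congr fun m => ?_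
  rw [hTerm_T n h]
  congr 1
  fin_cases i <;> fin_cases j
  · simp [e_zero]
  · rw [if_neg (by simp)]
    change e (n / 4) * _ = 1 * e (-n / 4)
    rw [one_mul, ← e_add]
    simp only [Nat.cast_zero, Nat.cast_one]
    rw [show (n : ℂ) / 4 + 1 * (((2 * m + (0 + 1) : ℤ) : ℂ) * n) / 2 =
      -n / 4 + ((m * n + n : ℤ) : ℂ) by push_cast; ring, e_add, e_int, mul_one]
  · simp [e_zero]
  · rw [if_pos (by simp)]
    change 1 * _ = e (n / 4) * e (-n / 4)
    rw [one_mul, ← e_add]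
    simp only [Nat.cast_one]
    rw [show 1 * (((2 * m + (1 + 1) : ℤ) : ℂ) * n) / 2 =
      n / 4 + -n / 4 + ((m * n + n : ℤ) : ℂ) by push_cast; ring, e_add, e_int, mul_one]

lemma isModular_T {τ τ' : ℍ} (n : ℤ) (h : (τ' : ℂ) = τ + n) :
    IsModular 0 1 τ τ' (diagT n) where
  ne_zero := one_ne_zero
  unitary := by
    rw [diagT, diagonal_conjTranspose, diagonal_mul_diagonal, norm_one, ofReal_one, one_smul,
      ← diagonal_one]
    congr 1
    ext i
    fin_cases i
    · simp
    · change e (n / 4) * (starRingEnd ℂ) (e (n / 4)) = 1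
      rw [e_mul_conj_e]
      simp
  im := by simp [im_T n h]
  gaussian z := by simp [im_T n h]
  offLattice u hu := by simpa using offLattice_T n h hu
  eta z := by
    ext i
    rw [zero_mul, zero_div, e_zero, one_smul, diagT, mulVec_diagonal, div_one, etaV, etaV,
      eta_T n h]
  hM u v hu := by
    have hc : star (e ((n : ℂ) / 4)) = e (-n / 4) := by
      rw [← starRingEnd_apply, conj_e, map_div₀, Complex.conj_ofNat, neg_div]
      simp
    have hd : (diagT n)ᴴ = diagonal ![1, e (-n / 4)] := by
      rw [diagT, diagonal_conjTranspose]
      congr 1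
      ext i
      fin_cases i
      · simp
      · simpa using hc
    ext i j
    rw [hd, diagT]
    simp only [div_one, norm_one, ofReal_one, zero_mul, zero_div, e_zero, mul_one, one_smul,
      mul_diagonal, diagonal_mul, hM, of_apply, hC]
    rw [hh_T n h, eta_T n h, rr_T n h]
    ring

/-! ### The congruence subgroup of level three -/

/-- The point `3τ`. -/
def triple (τ : ℍ) : ℍ := ⟨3 * τ, by simpa using τ.im_pos⟩

@[simp] lemma coe_triple (τ : ℍ) : (triple τ : ℂ) = 3 * τ := rfl

@[simp] lemma im_triple (τ : ℍ) : (triple τ).im = 3 * τ.im := by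
  simp [← UpperHalfPlane.coe_im]

/-- Compatible modular substitutions at `τ` and at `3τ`. -/
def IsLevelThree (s j χ : ℂ) (τ τ' : ℍ) : Prop :=
  ∃ M N : Matrix (Fin 2) (Fin 2) ℂ, IsModular s j τ τ' M ∧
    IsModular (s / 3) j (triple τ) (triple τ') N ∧
    Nᵀ * M = (χ * j) • (1 : Matrix (Fin 2) (Fin 2) ℂ)

lemma IsLevelThree.comp {s₁ j₁ χ₁ s₂ j₂ χ₂ : ℂ} {τ τ₁ τ₂ : ℍ} (h₂ : IsLevelThree s₂ j₂ χ₂ τ₁ τ₂)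
    (h₁ : IsLevelThree s₁ j₁ χ₁ τ τ₁) :
    IsLevelThree (s₁ + s₂ / j₁ ^ 2) (j₁ * j₂) (χ₁ * χ₂) τ τ₂ := by
  obtain ⟨M₁, N₁, hM₁, hN₁, h1⟩ := h₁
  obtain ⟨M₂, N₂, hM₂, hN₂, h2⟩ := h₂
  refine ⟨M₂ * M₁, N₂ * N₁, hM₂.comp hM₁, ?_, ?_⟩
  · have := hN₂.comp hN₁
    rwa [show s₁ / 3 + s₂ / 3 / j₁ ^ 2 = (s₁ + s₂ / j₁ ^ 2) / 3 by ring] at this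
  · rw [transpose_mul, Matrix.mul_assoc, ← Matrix.mul_assoc N₂ᵀ, h2, Matrix.smul_mul, Matrix.one_mul,
      Matrix.mul_smul, h1, smul_smul]
    congr 1; ring

/-- A translation of τ by n translates 3τ by 3n, and the phases i^n and i^{3n} of the odd component
multiply to 1. -/
lemma isLevelThree_T {τ τ' : ℍ} (n : ℤ) (h : (τ' : ℂ) = τ + n) : IsLevelThree 0 1 1 τ τ' := by
  refine ⟨diagT n, diagT (3 * n), isModular_T n h, ?_, ?_⟩
  · rw [zero_div]
    exact isModular_T _ (by rw [coe_triple, coe_triple, h]; push_cast; ring)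
  · rw [diagT, diagonal_transpose, ← diagT, diagT_add, show 3 * n + n = 4 * n by ring,
      diagT_four_mul]
    simp

/-- The point `-1/τ`. -/
def negInv (τ : ℍ) : ℍ := UpperHalfPlane.mk (-(τ : ℂ))⁻¹ τ.im_inv_neg_coe_pos

lemma coe_negInv (τ : ℍ) : (negInv τ : ℂ) = -1 / τ := by
  change (-(τ : ℂ))⁻¹ = -1 / τ
  rw [neg_div, one_div, inv_neg]

/-- A lower triangular substitution is the composite of -1/τ, a translation by -m, and -1/τ again.
This product yields the automorphy factor with the sign -(1 + mτ). -/
lemma isModular_STS {τ τ' : ℍ} (m : ℤ) (hτ' : (τ' : ℂ) = τ / (1 + m * τ)) :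
    IsModular (m / (1 + m * τ)) (-(1 + m * τ)) τ τ'
      ((sqrtS (-(1 + m * τ) / τ) * sqrtS τ) • (hadamard * diagT (-m) * hadamard)) := by
  have hτ : (τ : ℂ) ≠ 0 := UpperHalfPlane.ne_zero τ
  set τ₁ := negInv τ
  have h1 : (τ₁ : ℂ) = -1 / τ := coe_negInv τ
  set τ₂ : ℍ := (-m : ℝ) +ᵥ τ₁ with hτ₂
  have h2 : (τ₂ : ℂ) = τ₁ + ((-m : ℤ) : ℂ) := by
    rw [hτ₂, UpperHalfPlane.coe_vadd]; push_cast; ring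
  have h2' : (τ₂ : ℂ) = -(1 + m * τ) / τ := by
    rw [h2, h1]; push_cast; field_simp; ring
  have hne : (1 + m * τ : ℂ) ≠ 0 := by
    intro h
    have := UpperHalfPlane.ne_zero τ₂
    rw [h2', h] at this
    simp at this
  have h3 : (τ' : ℂ) = -1 / τ₂ := by
    rw [hτ', h2']; field_simp
  have hS := isModular_S h1
  have hT := isModular_T _ h2
  have hS' := isModular_S h3
  have := hS'.comp (hT.comp hS)
  have e1 : 1 / (τ : ℂ) + 0 / τ ^ 2 + 1 / τ₂ / (τ * 1) ^ 2 = m / (1 + m * τ) := by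
    rw [h2', mul_one, zero_div, add_zero, one_div_div, div_div, div_add_div _ _ hτ
      (mul_ne_zero (neg_ne_zero.2 hne) (pow_ne_zero 2 hτ)), div_eq_div_iff
      (mul_ne_zero hτ (mul_ne_zero (neg_ne_zero.2 hne) (pow_ne_zero 2 hτ))) hne]
    ring
  have e2 : (τ : ℂ) * 1 * τ₂ = -(1 + m * τ) := by rw [h2']; field_simp
  rw [e1, e2] at this
  convert this using 1
  rw [h2', Matrix.smul_mul, Matrix.mul_smul, Matrix.mul_smul, smul_smul, Matrix.mul_assoc]

/-- Lowering by 3m at τ is lowering by m at 3τ. In NᵀM the inner Hadamard matrices cancel, and the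
diagonal phases combine to i^{-4m} = 1. Each square root occurs once at τ and once at 3τ, so it
enters squared up to √3; the branches drop out and χ = -1. -/
lemma isLevelThree_STS {τ τ' : ℍ} (m : ℤ) (hτ' : (τ' : ℂ) = τ / (1 + 3 * m * τ)) :
    IsLevelThree (3 * m / (1 + 3 * m * τ)) (-(1 + 3 * m * τ)) (-1) τ τ' := by
  have hτ : (τ : ℂ) ≠ 0 := UpperHalfPlane.ne_zero τ
  have h1 := isModular_STS (τ := τ) (τ' := τ') (3 * m) (by rw [hτ']; push_cast; rfl)
  have h2 := isModular_STS (τ := triple τ) (τ' := triple τ') m (by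
    rw [coe_triple, coe_triple, hτ']; ring)
  push_cast at h1
  rw [coe_triple, show (m : ℂ) * (3 * τ) = 3 * m * τ by ring] at h2
  rw [show (m : ℂ) / (1 + 3 * m * τ) = 3 * m / (1 + 3 * m * τ) / 3 by ring] at h2
  refine ⟨_, _, h1, h2, ?_⟩
  have hne : (1 + 3 * m * τ : ℂ) ≠ 0 := by
    exact neg_ne_zero.1 h1.ne_zero
  have hD : ∀ n, (diagT n)ᵀ = diagT n := fun n => by rw [diagT, diagonal_transpose]
  rw [transpose_smul, transpose_mul, transpose_mul, hadamard_transpose, hD, Matrix.smul_mul, Matrix.mul_smul,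
    smul_smul]
  have h3 : hadamard * (diagT (-m) * hadamard) * (hadamard * diagT (-(3 * m)) * hadamard) =
      (4 : ℂ) • (1 : Matrix (Fin 2) (Fin 2) ℂ) := by
    calc _ = hadamard * diagT (-m) * (hadamard * hadamard) * diagT (-(3 * m)) * hadamard := by
          simp only [Matrix.mul_assoc]
      _ = (2 : ℂ) • (hadamard * (diagT (-m) * diagT (-(3 * m))) * hadamard) := by
          rw [hadamard_mul_self, Matrix.mul_smul, Matrix.mul_one, Matrix.smul_mul, Matrix.smul_mul]
          simp only [Matrix.mul_assoc]
      _ = _ := by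
          rw [diagT_add, show -m + -(3 * m) = 4 * (-m) by ring, diagT_four_mul, Matrix.mul_one,
            hadamard_mul_self, smul_smul]
          norm_num
  rw [h3, smul_smul]
  congr 1
  have h4 : (-(1 + 3 * m * τ) / τ : ℂ) = (3 : ℝ) * (-(1 + 3 * m * τ) / (3 * τ)) := by
    push_cast; field_simp
  have h5 : (3 * τ : ℂ) = (3 : ℝ) * τ := by push_cast; ring
  have hX : (-(1 + 3 * m * τ) / (3 * τ) : ℂ) ≠ 0 := by
    apply div_ne_zero
    · exact neg_ne_zero.2 hne
    · simpa using hτ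
  have hs3 : ((√3 : ℝ) : ℂ) * (√3 : ℝ) = 3 := by
    rw [← ofReal_mul, Real.mul_self_sqrt (by norm_num)]; norm_num
  have h6 := sqrtS_smul (r := 3) (by norm_num) hX
  have h7 := sqrtS_smul (r := 3) (by norm_num) hτ
  rw [← h4] at h6
  rw [← h5] at h7
  rw [h6, h7]
  have h8 := sqrtS_sq (-(1 + 3 * m * τ) / (3 * τ))
  have h9 := sqrtS_sq τ
  generalize sqrtS (-(1 + 3 * m * τ) / (3 * τ)) = X at *
  generalize sqrtS τ = Y at *
  calc _ = ((√3 : ℝ) * (√3 : ℝ) : ℂ) * (X * X) * (Y * Y) * 4 := by ring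
    _ = _ := by
      rw [hs3, h8, h9]
      field_simp
      ring_nf
      simp only [I_sq]
      ring

/-- The substitution by `γ` is compatible at `τ` and `3τ`, with multiplier `(d/3)`. -/
def IsJacobi (γ : SpecialLinearGroup (Fin 2) ℤ) : Prop :=
  ∀ τ : ℍ, IsLevelThree (γ 1 0 / (γ 1 0 * τ + γ 1 1)) (γ 1 0 * τ + γ 1 1)
    (legendreSym 3 (γ 1 1)) τ (γ • τ)

lemma coe_SL_smul (γ : SpecialLinearGroup (Fin 2) ℤ) (τ : ℍ) :
    ((γ • τ : ℍ) : ℂ) = (γ 0 0 * τ + γ 0 1) / (γ 1 0 * τ + γ 1 1) := by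
  rw [UpperHalfPlane.coe_specialLinearGroup_apply]
  simp

lemma SL_det (γ : SpecialLinearGroup (Fin 2) ℤ) : γ 0 0 * γ 1 1 - γ 0 1 * γ 1 0 = 1 := by
  have := γ.det_coe
  rwa [Matrix.det_fin_two] at this

lemma SL_denom_ne_zero (γ : SpecialLinearGroup (Fin 2) ℤ) (τ : ℍ) :
    (γ 1 0 * τ + γ 1 1 : ℂ) ≠ 0 := by
  intro h
  have h1 := congrArg Complex.im h
  simp at h1
  have hc : γ 1 0 = 0 := by
    rcases h1 with h1 | h1
    · exact h1
    · exact absurd h1 τ.im_ne_zero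
  rw [hc] at h
  have hd : γ 1 1 = 0 := by simpa using h
  have := SL_det γ
  rw [hc, hd] at this
  simp at this

lemma IsJacobi.mul {γ₂ γ₁ : SpecialLinearGroup (Fin 2) ℤ} (h₂ : IsJacobi γ₂) (h₁ : IsJacobi γ₁)
    (hΓ : γ₂ ∈ CongruenceSubgroup.Gamma0 3) : IsJacobi (γ₂ * γ₁) := by
  intro τ
  have h := (h₂ (γ₁ • τ)).comp (h₁ τ)
  rw [coe_SL_smul] at h
  have hj := SL_denom_ne_zero γ₁ τ
  have hj2 := SL_denom_ne_zero γ₂ (γ₁ • τ)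
  rw [coe_SL_smul] at hj2
  have hdet : (γ₁ 0 0 * γ₁ 1 1 - γ₁ 0 1 * γ₁ 1 0 : ℂ) = 1 := by exact_mod_cast SL_det γ₁
  have hc : (γ₂ * γ₁) 1 0 = γ₂ 1 0 * γ₁ 0 0 + γ₂ 1 1 * γ₁ 1 0 := by
    simp [Matrix.mul_apply, Fin.sum_univ_two]
  have hd : (γ₂ * γ₁) 1 1 = γ₂ 1 0 * γ₁ 0 1 + γ₂ 1 1 * γ₁ 1 1 := by
    simp [Matrix.mul_apply, Fin.sum_univ_two]
  have hden : ((γ₂ * γ₁) 1 0 * τ + (γ₂ * γ₁) 1 1 : ℂ) = (γ₁ 1 0 * τ + γ₁ 1 1) *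
      (γ₂ 1 0 * ((γ₁ 0 0 * τ + γ₁ 0 1) / (γ₁ 1 0 * τ + γ₁ 1 1)) + γ₂ 1 1) := by
    rw [hc, hd]; push_cast; field_simp; ring
  have hχ : legendreSym 3 ((γ₂ * γ₁) 1 1) = legendreSym 3 (γ₁ 1 1) * legendreSym 3 (γ₂ 1 1) := by
    have h3 : (3 : ℤ) ∣ γ₂ 1 0 := by
      rw [CongruenceSubgroup.Gamma0_mem] at hΓ
      exact (ZMod.intCast_zmod_eq_zero_iff_dvd _ 3).1 hΓ
    rw [← legendreSym.mul, legendreSym.mod 3 (γ₁ 1 1 * γ₂ 1 1), legendreSym.mod 3 ((γ₂ * γ₁) 1 1), hd]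
    congr 1
    obtain ⟨k, hk⟩ := h3
    rw [hk]
    push_cast
    rw [show 3 * k * γ₁ 0 1 + γ₂ 1 1 * γ₁ 1 1 = γ₁ 1 1 * γ₂ 1 1 + 3 * (k * γ₁ 0 1) by ring,
      Int.add_mul_emod_self_left]
  rw [mul_smul, hden, hχ]
  convert h using 1
  · rw [hc]
    push_cast
    have hj3 : (γ₁ 1 0 * τ + γ₁ 1 1 : ℂ) *
        (γ₂ 1 0 * ((γ₁ 0 0 * τ + γ₁ 0 1) / (γ₁ 1 0 * τ + γ₁ 1 1)) + γ₂ 1 1) =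
        γ₂ 1 0 * (γ₁ 0 0 * τ + γ₁ 0 1) + γ₂ 1 1 * (γ₁ 1 0 * τ + γ₁ 1 1) := by
      field_simp
    generalize (γ₂ 1 0 : ℂ) * ((γ₁ 0 0 * τ + γ₁ 0 1) / (γ₁ 1 0 * τ + γ₁ 1 1)) + γ₂ 1 1 = j₂ at *
    rw [div_div, div_add_div _ _ hj (mul_ne_zero hj2 (pow_ne_zero 2 hj)), div_eq_div_iff
      (mul_ne_zero hj hj2) (mul_ne_zero hj (mul_ne_zero hj2 (pow_ne_zero 2 hj)))]
    linear_combination (-(γ₁ 1 0 * τ + γ₁ 1 1 : ℂ) ^ 2 * j₂ * γ₁ 1 0) * hj3 +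
      (γ₂ 1 0 * (γ₁ 1 0 * τ + γ₁ 1 1 : ℂ) ^ 2 * j₂) * hdet
  · push_cast; rfl

/-- The translation by `n`. -/
def genT (n : ℤ) : SpecialLinearGroup (Fin 2) ℤ := ⟨!![1, n; 0, 1], by simp⟩

/-- The lower triangular elements of level three. -/
def genV (m : ℤ) : SpecialLinearGroup (Fin 2) ℤ := ⟨!![-1, 0; -(3 * m), -1], by simp⟩

lemma coe_genT (n : ℤ) : (genT n : Matrix (Fin 2) (Fin 2) ℤ) = !![1, n; 0, 1] := rfl

lemma coe_genV (m : ℤ) : (genV m : Matrix (Fin 2) (Fin 2) ℤ) = !![-1, 0; -(3 * m), -1] := rfl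

lemma genT_mem (n : ℤ) : genT n ∈ CongruenceSubgroup.Gamma0 3 := by
  rw [CongruenceSubgroup.Gamma0_mem]
  simp [coe_genT]

lemma genV_mem (m : ℤ) : genV m ∈ CongruenceSubgroup.Gamma0 3 := by
  rw [CongruenceSubgroup.Gamma0_mem, ZMod.intCast_zmod_eq_zero_iff_dvd]
  exact ⟨-m, by simp [coe_genV]⟩

lemma isJacobi_genT (n : ℤ) : IsJacobi (genT n) := by
  intro τ
  have h := isLevelThree_T (τ := τ) (τ' := genT n • τ) n (by rw [coe_SL_smul]; simp [coe_genT])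
  simpa [coe_genT] using h

lemma isJacobi_genV (m : ℤ) : IsJacobi (genV m) := by
  intro τ
  have h := isLevelThree_STS (τ := τ) (τ' := genV m • τ) m (by
    rw [coe_SL_smul]
    rw [← neg_div_neg_eq]
    simp [coe_genV])
  have hl : legendreSym 3 (-1) = -1 := by decide
  have e1 : (genV m 1 0 : ℂ) * τ + genV m 1 1 = -(1 + 3 * m * τ) := by simp [coe_genV]
  have e2 : (genV m 1 0 : ℂ) = -(3 * m) := by simp [coe_genV]
  have e3 : genV m 1 1 = -1 := by simp [coe_genV]
  rw [e1, e2, e3, hl, neg_div_neg_eq]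
  simpa using h

lemma exists_two_mul_abs_sub_le (x : ℤ) {y : ℤ} (hy : y ≠ 0) : ∃ n : ℤ, 2 * |x - n * y| ≤ |y| := by
  have h1 := Int.emod_nonneg x hy
  have h2 := Int.emod_lt_abs x hy
  have h3 := Int.emod_add_mul_ediv x y
  by_cases h : 2 * (x % y) ≤ |y|
  · refine ⟨x / y, ?_⟩
    rw [show x - x / y * y = x % y by linarith [mul_comm y (x / y)], abs_of_nonneg h1]
    exact h
  · refine ⟨x / y + y.sign, ?_⟩
    have h4 : y.sign * y = |y| := Int.sign_mul_self_eq_abs y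
    rw [show x - (x / y + y.sign) * y = x % y - |y| by linarith [mul_comm y (x / y)],
      abs_of_nonpos (by linarith)]
    linarith

/-- Euclidean descent on |c|. A translation achieves 2|d| ≤ |c|, with d ≠ 0 because 3 divides c and
det γ = 1. A lower triangular factor then achieves 2|c'| ≤ 3|d|, so |c'| ≤ (3/4)|c|. For c = 0 the
element -1 is `genV 0`. -/
theorem isJacobi_of_mem (γ : SpecialLinearGroup (Fin 2) ℤ) (hγ : γ ∈ CongruenceSubgroup.Gamma0 3) :
    IsJacobi γ := by
  induction hk : (γ 1 0).natAbs using Nat.strong_induction_on generalizing γ with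
  | _ k ih =>
    have hdet := SL_det γ
    by_cases hc : γ 1 0 = 0
    · rw [hc, mul_zero, sub_zero] at hdet
      rcases Int.eq_one_or_neg_one_of_mul_eq_one hdet with h0 | h0
      · have h1 : γ 1 1 = 1 := by rw [h0] at hdet; linarith
        have : γ = genT (γ 0 1) := by
          ext i j
          fin_cases i <;> fin_cases j <;> simp [coe_genT, h0, h1, hc]
        rw [this]
        exact isJacobi_genT _
      · have h1 : γ 1 1 = -1 := by rw [h0] at hdet; linarith
        have : γ = genV 0 * genT (-γ 0 1) := by
          ext i j
          fin_cases i <;> fin_cases j <;>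
            simp [coe_genT, coe_genV, h0, h1, hc, Matrix.mul_apply, Fin.sum_univ_two]
        rw [this]
        exact (isJacobi_genV 0).mul (isJacobi_genT _) (genV_mem 0)
    · obtain ⟨n, hn⟩ := exists_two_mul_abs_sub_le (γ 1 1) hc
      have h3 : (3 : ℤ) ∣ γ 1 0 := by
        rw [CongruenceSubgroup.Gamma0_mem] at hγ
        exact (ZMod.intCast_zmod_eq_zero_iff_dvd _ 3).1 hγ
      set d := γ 1 1 - n * γ 1 0 with hd
      have hd0 : d ≠ 0 := by
        intro h
        obtain ⟨l, hl⟩ := h3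
        have : γ 1 1 = n * γ 1 0 := by linarith
        rw [this, hl] at hdet
        have : 3 * (γ 0 0 * n * l - γ 0 1 * l) = 1 := by linarith
        omega
      obtain ⟨m, hm⟩ := exists_two_mul_abs_sub_le (γ 1 0) (y := 3 * d) (by omega)
      have hmem : γ * genT (-n) * genV (-m) ∈ CongruenceSubgroup.Gamma0 3 :=
        mul_mem (mul_mem hγ (genT_mem _)) (genV_mem _)
      have hγ' := ih ((γ * genT (-n) * genV (-m)) 1 0).natAbs ?_ _ hmem rfl
      · have : γ = γ * genT (-n) * genV (-m) * (genV m * genT n) := by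
          have h1 : genV (-m) * genV m = 1 := by
            ext i j
            fin_cases i <;> fin_cases j <;> simp [coe_genV, Matrix.mul_apply, Fin.sum_univ_two]
          have h2 : genT (-n) * genT n = 1 := by
            ext i j
            fin_cases i <;> fin_cases j <;> simp [coe_genT, Matrix.mul_apply, Fin.sum_univ_two]
          calc γ = γ * (genT (-n) * ((genV (-m) * genV m) * genT n)) := by
                rw [h1, one_mul, h2, mul_one]
            _ = _ := by simp only [mul_assoc]
        rw [this]
        exact hγ'.mul ((isJacobi_genV m).mul (isJacobi_genT n) (genV_mem m)) hmem
      · have he : (γ * genT (-n) * genV (-m)) 1 0 = -(γ 1 0 - m * (3 * d)) := by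
          simp [coe_genT, coe_genV, Matrix.mul_apply, Fin.sum_univ_two, hd]
          ring
        rw [he, Int.natAbs_neg, ← hk]
        rw [abs_mul, abs_of_pos (by norm_num : (0 : ℤ) < 3)] at hm
        have hc' : 0 < |γ 1 0| := abs_pos.2 hc
        have : |γ 1 0 - m * (3 * d)| < |γ 1 0| := by linarith
        rw [Int.abs_eq_natAbs, Int.abs_eq_natAbs] at this
        exact_mod_cast this

end

section

open Set

/-! ### The correction of depth two -/

/-- The `A₂` quadratic form. -/
def quadA2 (k : ℤ × ℤ) : ℤ := k.1 ^ 2 + k.2 ^ 2 - k.1 * k.2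

/-- The coefficient of the symmetrized series `R₂`, as a function of `a = Im w / Im τ`. -/
def phi2 (t : ℝ) (k : ℤ × ℤ) (a : ℝ) : ℝ :=
  Real.sign k.1 * Real.sign k.2
    - (Real.sign k.2 - E1 (√(3 * t) * (k.2 - a))) * Real.sign (2 * k.1 - k.2)
    - (Real.sign k.1 - E1 (√(3 * t) * (k.1 - a))) * Real.sign (2 * k.2 - k.1)
    - E2Gauss (1 / √3) (√t * (2 * k.1 - k.2 - a)) (√(3 * t) * (k.2 - a))

/-- One half of the derivative of `phi2`, up to the factor `-2√(3t)`. -/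
def psi2 (t : ℝ) (k : ℤ × ℤ) (a : ℝ) : ℝ :=
  gauss (√(3 * t) * (k.2 - a)) *
    (Real.sign (2 * k.1 - k.2) - E1 (√t * (2 * k.1 - k.2 - a)))

/-- The derivative of `phi2`. -/
def phi2' (t : ℝ) (k : ℤ × ℤ) (a : ℝ) : ℝ := -2 * √(3 * t) * (psi2 t k a + psi2 t k.swap a)

lemma sqrt_one_add_third : √(1 + (1 / √3 : ℝ) ^ 2) = 2 / √3 := by
  rw [Real.sqrt_eq_iff_mul_self_eq (by positivity) (by positivity)]
  have : √3 ^ 2 = (3 : ℝ) := Real.sq_sqrt (by norm_num)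
  field_simp
  rw [this]; norm_num

/-- For α = 1/√3 the rotated coordinates of E₂ are the original ones with x and y exchanged. This is
the symmetry of A₂ that makes the derivative of E₂ symmetric in k. -/
lemma a2_coord_add {t : ℝ} (x y a : ℝ) :
    (√t * (2 * x - y - a) + 1 / √3 * (√(3 * t) * (y - a))) / √(1 + (1 / √3 : ℝ) ^ 2) =
      √(3 * t) * (x - a) := by
  rw [sqrt_one_add_third, Real.sqrt_mul (by norm_num)]
  have : √3 ^ 2 = (3 : ℝ) := Real.sq_sqrt (by norm_num)
  field_simp
  ring

lemma a2_coord_sub {t : ℝ} (x y a : ℝ) :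
    (√(3 * t) * (y - a) - 1 / √3 * (√t * (2 * x - y - a))) / √(1 + (1 / √3 : ℝ) ^ 2) =
      √t * (2 * y - x - a) := by
  rw [sqrt_one_add_third, Real.sqrt_mul (by norm_num)]
  have : √3 ^ 2 = (3 : ℝ) := Real.sq_sqrt (by norm_num)
  field_simp
  rw [this]
  ring

/-- Each Gaussian in the derivative of E₂ carries an E₁. The derivative of the corresponding sgn ·
E₁ term supplies the matching sign, so the derivative contains only the decaying combinations sgn -
E₁. -/
lemma hasDerivAt_phi2 {t : ℝ} (k : ℤ × ℤ) (a : ℝ) :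
    HasDerivAt (phi2 t k) (phi2' t k a) a := by
  have hE : ∀ x : ℝ, HasDerivAt (fun a => E1 (√(3 * t) * (x - a)))
      (2 * gauss (√(3 * t) * (x - a)) * (√(3 * t) * -1)) a := fun x =>
    (hasDerivAt_E1 _).comp a (((hasDerivAt_id a).const_sub _).const_mul _)
  have h2 := hasDerivAt_E2Gauss (1 / √3) (√t * (2 * k.1 - k.2)) (-√t) (√(3 * t) * k.2) (-√(3 * t)) a
  have e1 : ∀ a, √t * (2 * k.1 - k.2) + -√t * a = √t * (2 * k.1 - k.2 - a) := fun a => by ring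
  have e2 : ∀ a, √(3 * t) * k.2 + -√(3 * t) * a = √(3 * t) * (k.2 - a) := fun a => by ring
  simp only [e1, e2, a2_coord_add, a2_coord_sub] at h2
  have e3 : (-√t + 1 / √3 * -√(3 * t)) / √(1 + (1 / √3 : ℝ) ^ 2) = -√(3 * t) := by
    have := a2_coord_add (t := t) 0 0 1
    linear_combination this
  rw [e3] at h2
  have h := (((((hE k.2).const_sub (Real.sign k.2)).mul_const (Real.sign (2 * k.1 - k.2))).const_sub
    (Real.sign k.1 * Real.sign k.2)).sub
      (((hE k.1).const_sub (Real.sign k.1)).mul_const (Real.sign (2 * k.2 - k.1)))).sub h2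
  refine h.congr_deriv ?_
  simp only [phi2', psi2, Prod.fst_swap, Prod.snd_swap]
  ring

lemma quadA2_cast (k : ℤ × ℤ) : (quadA2 k : ℝ) = (k.1 : ℝ) ^ 2 + (k.2 : ℝ) ^ 2 - k.1 * k.2 := by
  simp [quadA2]

/-- The exponents of the two factors add up to 3k₂² + (2k₁ - k₂)² = 4Q(k), with Q the A₂ form. -/
lemma abs_psi2_le {t : ℝ} (ht : 0 < t) (k : ℤ × ℤ) (a : ℝ) : |psi2 t k a| ≤
    2 * Real.exp (-(4 * Real.pi * t) * quadA2 k + 4 * Real.pi * t * a * (k.1 + k.2)) := by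
  have h1 := abs_sign_sub_E1_scaled_le ht (2 * k.1 - k.2) a
  have h2 := gauss_scaled (by positivity : 0 < 3 * t) k.2 a
  rw [psi2, abs_mul, abs_of_pos (gauss_pos _), h2]
  calc _ ≤ Real.exp (-(Real.pi * (3 * t)) * (k.2 : ℝ) ^ 2 + 2 * Real.pi * (3 * t) * a * k.2) *
        (2 * Real.exp (-(Real.pi * t) * (2 * k.1 - k.2) ^ 2 +
          2 * Real.pi * t * a * (2 * k.1 - k.2))) := by
        gcongr
        have := Real.pi_pos
        have : 0 ≤ Real.pi * (3 * t) * a ^ 2 := by positivity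
        linarith
    _ = _ := by
        rw [mul_left_comm, ← Real.exp_add, quadA2_cast]
        congr 2; ring

lemma quadA2_swap (k : ℤ × ℤ) : quadA2 k.swap = quadA2 k := by
  simp only [quadA2, Prod.fst_swap, Prod.snd_swap]; ring

lemma abs_phi2'_le {t : ℝ} (ht : 0 < t) (k : ℤ × ℤ) (a : ℝ) : |phi2' t k a| ≤ 8 * √(3 * t) *
    Real.exp (-(4 * Real.pi * t) * quadA2 k + 4 * Real.pi * t * a * (k.1 + k.2)) := by
  have h1 := abs_psi2_le ht k a
  have h2 := abs_psi2_le ht k.swap a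
  rw [quadA2_swap, Prod.fst_swap, Prod.snd_swap, add_comm (k.2 : ℝ)] at h2
  have h3 := abs_add_le (psi2 t k a) (psi2 t k.swap a)
  rw [phi2', abs_mul, abs_mul, abs_neg, abs_two, abs_of_nonneg (Real.sqrt_nonneg _)]
  have h4 : 0 ≤ √(3 * t) := Real.sqrt_nonneg _
  nlinarith

/-- At a = 0 the coefficient is exactly -M₂, by the sign identity `sign_sub_mul_sign_sub_eq_zero`,
so the bound `abs_M2Gauss_le` applies. -/
lemma abs_phi2_zero_le {t : ℝ} (ht : 0 < t) (k : ℤ × ℤ) :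
    |phi2 t k 0| ≤ 4 * Real.exp (-(4 * Real.pi * t) * quadA2 k) := by
  have hst : 0 < √t := Real.sqrt_pos.2 ht
  have h3t : 0 < √(3 * t) := Real.sqrt_pos.2 (by positivity)
  set u₁ := √t * (2 * k.1 - k.2 - 0) with hu₁
  set u₂ := √(3 * t) * (k.2 - 0) with hu₂
  have hc : 0 < √(1 + (1 / √3 : ℝ) ^ 2) := by positivity
  have hadd := a2_coord_add (t := t) k.1 k.2 0
  have hsub := a2_coord_sub (t := t) k.1 k.2 0
  rw [← hu₁, ← hu₂] at hadd hsub
  have s1 : Real.sign u₁ = Real.sign (2 * k.1 - k.2) := by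
    rw [hu₁, sign_mul_of_pos hst, sub_zero]
  have s2 : Real.sign u₂ = Real.sign k.2 := by rw [hu₂, sign_mul_of_pos h3t, sub_zero]
  have s3 : Real.sign (u₁ + 1 / √3 * u₂) = Real.sign k.1 := by
    rw [div_eq_iff hc.ne'] at hadd
    rw [hadd, mul_comm, sign_mul_of_pos hc, sign_mul_of_pos h3t, sub_zero]
  have s4 : Real.sign (u₂ - 1 / √3 * u₁) = Real.sign (2 * k.2 - k.1) := by
    rw [div_eq_iff hc.ne'] at hsub
    rw [hsub, mul_comm, sign_mul_of_pos hc, sign_mul_of_pos hst, sub_zero]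
  have h0 := sign_sub_mul_sign_sub_eq_zero (1 / √3) u₁ u₂
  rw [s1, s2, s3, s4] at h0
  have hM := M2Gauss_eq (1 / √3) u₁ u₂
  rw [s1, s4, hadd] at hM
  have hφ : phi2 t k 0 = -M2Gauss (1 / √3) u₁ u₂ := by
    rw [hM, phi2, ← hu₁, ← hu₂]
    linear_combination h0
  rw [hφ, abs_neg]
  refine (abs_M2Gauss_le _ _ _).trans (le_of_eq ?_)
  rw [hu₁, hu₂, gauss_scaled ht, gauss_scaled (by positivity : 0 < 3 * t), ← Real.exp_add,
    quadA2_cast]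
  congr 2; ring

/-- For a ≠ 0 the signs no longer match the arguments of the error functions, so the estimate is
carried over from a = 0 by the mean value inequality. -/
lemma abs_phi2_le {t : ℝ} (ht : 0 < t) (k : ℤ × ℤ) (a : ℝ) : |phi2 t k a| ≤
    (4 + 8 * √(3 * t) * |a|) *
      Real.exp (-(4 * Real.pi * t) * quadA2 k + 4 * Real.pi * t * |a| * |(k.1 + k.2 : ℝ)|) := by
  set E := Real.exp (-(4 * Real.pi * t) * quadA2 k + 4 * Real.pi * t * |a| * |(k.1 + k.2 : ℝ)|)
  have hπ := Real.pi_pos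
  have hd : ∀ b ∈ Icc (-|a|) |a|, ‖phi2' t k b‖ ≤ 8 * √(3 * t) * E := by
    intro b hb
    refine (abs_phi2'_le ht k b).trans ?_
    have : b * (k.1 + k.2 : ℝ) ≤ |a| * |(k.1 + k.2 : ℝ)| := by
      refine (le_abs_self _).trans ?_
      rw [abs_mul]
      exact mul_le_mul_of_nonneg_right (abs_le.2 hb) (abs_nonneg _)
    refine mul_le_mul_of_nonneg_left (Real.exp_le_exp.2 ?_) (by positivity)
    have h2 : 4 * Real.pi * t * (b * (k.1 + k.2 : ℝ)) ≤
        4 * Real.pi * t * (|a| * |(k.1 + k.2 : ℝ)|) := by gcongr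
    linarith
  have hmv := Convex.norm_image_sub_le_of_norm_hasDerivWithin_le (f := phi2 t k) (f' := phi2' t k)
    (s := Icc (-|a|) |a|) (x := 0) (y := a) (C := 8 * √(3 * t) * E)
    (fun b _ => (hasDerivAt_phi2 k b).hasDerivWithinAt) hd (convex_Icc _ _)
    ⟨by simp, by simp⟩ ⟨neg_abs_le a, le_abs_self a⟩
  rw [sub_zero, Real.norm_eq_abs, Real.norm_eq_abs] at hmv
  have h0 := abs_phi2_zero_le ht k
  have h0' : Real.exp (-(4 * Real.pi * t) * quadA2 k) ≤ E := by
    apply Real.exp_le_exp.2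
    have : 0 ≤ 4 * Real.pi * t * |a| * |(k.1 + k.2 : ℝ)| := by positivity
    linarith
  have := abs_sub_abs_le_abs_sub (phi2 t k a) (phi2 t k 0)
  nlinarith

/-- The exponential factor of `R₂`. -/
def xTerm (w : ℂ) (τ : ℍ) (k : ℤ × ℤ) : ℂ := e (-(quadA2 k * τ)) * e (((k.1 + k.2 : ℝ) : ℂ) * w)

/-- The summand of the symmetrized series `R₂`. -/
def R2SymTerm (w : ℂ) (τ : ℍ) (k : ℤ × ℤ) : ℂ :=
  (phi2 τ.im k (w.im / τ.im) : ℂ) * xTerm w τ k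

/-- The symmetrized, absolutely convergent series `R₂`. -/
def R2Sym (w : ℂ) (τ : ℍ) : ℂ := ∑' k : ℤ × ℤ, R2SymTerm w τ k

lemma xTerm_eq (w : ℂ) (τ : ℍ) (k : ℤ × ℤ) :
    xTerm w τ k = e ((k.1 + k.2) * w) * e ((-k.1 ^ 2 - k.2 ^ 2 + k.1 * k.2) * τ) := by
  rw [xTerm, mul_comm, quadA2]
  push_cast
  congr 2; ring

lemma norm_xTerm (w : ℂ) (τ : ℍ) (k : ℤ × ℤ) : ‖xTerm w τ k‖ =
    Real.exp (2 * Real.pi * τ.im * quadA2 k - 2 * Real.pi * w.im * (k.1 + k.2)) := by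
  rw [xTerm, ← e_add, norm_e]
  congr 1
  have : (-((quadA2 k : ℂ) * τ) + ((k.1 + k.2 : ℝ) : ℂ) * w).im =
      -(quadA2 k * τ.im) + (k.1 + k.2) * w.im := by
    rw [add_im, neg_im, im_ofReal_mul, ← ofReal_intCast, im_ofReal_mul, UpperHalfPlane.coe_im]
  rw [this]; ring

/-- The decay exp(-4πτ₂Q) beats the growth exp(2πτ₂Q) of the exponential factor, and 2Q = k₁² + k₂²
+ (k₁ - k₂)² ≥ k₁² + k₂². -/
lemma exp_bound_R2 {τ : ℍ} {B : ℝ} (k : ℤ × ℤ) {w : ℂ} (hw : ‖w‖ ≤ B) :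
    (1 + |(k.1 + k.2 : ℝ)|) * (Real.exp (-(4 * Real.pi * τ.im) * quadA2 k +
      4 * Real.pi * τ.im * |w.im / τ.im| * |(k.1 + k.2 : ℝ)|) * ‖xTerm w τ k‖) ≤
    Real.exp (-(Real.pi * τ.im) * ((k.1 : ℝ) ^ 2 + (k.2 : ℝ) ^ 2) +
      (6 * Real.pi * B + 1) * (|(k.1 : ℝ)| + |(k.2 : ℝ)|)) := by
  have hτ := τ.im_pos
  have hπ := Real.pi_pos
  have hwB : |w.im| ≤ B := (abs_im_le_norm w).trans hw
  have hB : 0 ≤ B := (abs_nonneg _).trans hwB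
  have h1 : 4 * Real.pi * τ.im * |w.im / τ.im| = 4 * Real.pi * |w.im| := by
    rw [abs_div, abs_of_pos hτ]; field_simp
  have hm : |(k.1 + k.2 : ℝ)| ≤ |(k.1 : ℝ)| + |(k.2 : ℝ)| := abs_add_le _ _
  have h2 : 1 + |(k.1 + k.2 : ℝ)| ≤ Real.exp |(k.1 + k.2 : ℝ)| := by
    rw [add_comm]; exact Real.add_one_le_exp _
  rw [norm_xTerm, h1]
  calc _ ≤ Real.exp |(k.1 + k.2 : ℝ)| * _ := by gcongr
    _ ≤ _ := by
      rw [← Real.exp_add, ← Real.exp_add, Real.exp_le_exp, quadA2_cast]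
      have h3 : -(w.im * (k.1 + k.2)) ≤ |w.im| * |(k.1 + k.2 : ℝ)| := by
        rw [← abs_mul]; exact neg_le_abs _
      have h4 : |w.im| * |(k.1 + k.2 : ℝ)| ≤ B * (|(k.1 : ℝ)| + |(k.2 : ℝ)|) := by gcongr
      have h5 := mul_nonneg (mul_nonneg hπ.le hτ.le) (sq_nonneg ((k.1 : ℝ) - k.2))
      nlinarith

lemma R2Sym_dbar_aux (τ : ℍ) (w : ℂ) : Summable (R2SymTerm w τ) ∧
    HasDbarAt (fun w => R2Sym w τ)
      (I / (2 * τ.im) * ∑' k : ℤ × ℤ, (phi2' τ.im k (w.im / τ.im) : ℂ) * xTerm w τ k) w := by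
  have hτ := τ.im_pos
  refine hasDbarAt_tsum (ι := ℤ × ℤ) hτ (φ := phi2 τ.im) (φ' := phi2' τ.im)
    (m := fun k => (k.1 + k.2 : ℝ)) (C := fun k => e (-(quadA2 k * τ)))
    (fun k a => hasDerivAt_phi2 k a) ?_ w
  intro B
  refine ⟨_, (summable_exp_neg_sq_prod (6 * Real.pi * B + 1)
    (by have := Real.pi_pos; positivity : 0 < Real.pi * τ.im)).mul_left
      (4 + 8 * √(3 * τ.im) * (B / τ.im) + 8 * √(3 * τ.im)), fun k w hw => ?_⟩
  have hb := exp_bound_R2 (τ := τ) k hw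
  have hwB : |w.im| ≤ B := (abs_im_le_norm w).trans hw
  have hB : 0 ≤ B := (abs_nonneg _).trans hwB
  have ha : |w.im / τ.im| ≤ B / τ.im := by rw [abs_div, abs_of_pos hτ]; gcongr
  have h1 := abs_phi2_le hτ k (w.im / τ.im)
  have h2 := abs_phi2'_le hτ k (w.im / τ.im)
  change (1 + |(k.1 + k.2 : ℝ)|) * _ * ‖xTerm w τ k‖ ≤ _ ∧ _ * ‖xTerm w τ k‖ ≤ _
  set X := ‖xTerm w τ k‖
  have hX : 0 ≤ X := norm_nonneg _
  set E := Real.exp (-(4 * Real.pi * τ.im) * quadA2 k +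
      4 * Real.pi * τ.im * |w.im / τ.im| * |(k.1 + k.2 : ℝ)|)
  have hE : 0 ≤ E := (Real.exp_pos _).le
  set m := |(k.1 + k.2 : ℝ)|
  have hm : 0 ≤ m := abs_nonneg _
  set Y := Real.exp (-(Real.pi * τ.im) * ((k.1 : ℝ) ^ 2 + (k.2 : ℝ) ^ 2) +
      (6 * Real.pi * B + 1) * (|(k.1 : ℝ)| + |(k.2 : ℝ)|))
  have hY : 0 ≤ Y := (Real.exp_pos _).le
  have hs : 0 ≤ √(3 * τ.im) := Real.sqrt_nonneg _
  have hBt : 0 ≤ B / τ.im := by positivity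
  constructor
  · calc _ ≤ (1 + m) * ((4 + 8 * √(3 * τ.im) * (B / τ.im)) * E) * X := by
          gcongr
          refine h1.trans ?_
          gcongr
      _ = (4 + 8 * √(3 * τ.im) * (B / τ.im)) * ((1 + m) * (E * X)) := by ring
      _ ≤ (4 + 8 * √(3 * τ.im) * (B / τ.im)) * Y := by gcongr
      _ ≤ _ := by nlinarith [mul_nonneg hs hY]
  · have h3 : Real.exp (-(4 * Real.pi * τ.im) * quadA2 k + 4 * Real.pi * τ.im * (w.im / τ.im) * (k.1 + k.2)) ≤ E := by
      apply Real.exp_le_exp.2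
      have h4 : (w.im / τ.im) * (k.1 + k.2 : ℝ) ≤ |w.im / τ.im| * m := by
        rw [← abs_mul]; exact le_abs_self _
      have := Real.pi_pos
      have h5 : 4 * Real.pi * τ.im * ((w.im / τ.im) * (k.1 + k.2 : ℝ)) ≤
        4 * Real.pi * τ.im * (|w.im / τ.im| * m) := by gcongr
      linarith
    calc _ ≤ (8 * √(3 * τ.im) * E) * X := by
          gcongr
          refine h2.trans ?_
          gcongr
      _ = 8 * √(3 * τ.im) * (E * X) := by ring
      _ ≤ 8 * √(3 * τ.im) * ((1 + m) * (E * X)) := by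
          refine mul_le_mul_of_nonneg_left ?_ (by positivity)
          nlinarith [mul_nonneg hm (mul_nonneg hE hX)]
      _ ≤ 8 * √(3 * τ.im) * Y := by gcongr
      _ ≤ _ := by nlinarith [mul_nonneg (mul_nonneg hs hBt) hY]

lemma summable_R2SymTerm (w : ℂ) (τ : ℍ) : Summable (R2SymTerm w τ) := (R2Sym_dbar_aux τ w).1

/-- The part of the summand of `R₂` that cancels on squares. -/
def R2AntiTerm (w : ℂ) (τ : ℍ) (k : ℤ × ℤ) : ℂ :=
  (((Real.sign k.2 - E1 (√(3 * τ.im) * (k.2 - w.im / τ.im))) * Real.sign (2 * k.1 - k.2) : ℝ) : ℂ) *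
    xTerm w τ k

lemma xTerm_swap (w : ℂ) (τ : ℍ) (k : ℤ × ℤ) : xTerm w τ k.swap = xTerm w τ k := by
  rw [xTerm, xTerm, quadA2_swap, Prod.fst_swap, Prod.snd_swap, add_comm (k.2 : ℝ)]

/-- Replacing twice the one-sided term by the sum of it and its mirror image changes the summand by
something antisymmetric under k₁ ↔ k₂. That part does not decay in all directions, but it sums to
zero over each square. -/
lemma R2Term_eq (w : ℂ) (τ : ℍ) (k : ℤ × ℤ) : R2Term w τ k.1 k.2 =
    R2SymTerm w τ k - R2AntiTerm w τ k + R2AntiTerm w τ k.swap := by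
  rw [R2Term, ← xTerm_eq, E2_eq_E2Gauss, R2SymTerm, R2AntiTerm, R2AntiTerm, xTerm_swap, phi2]
  simp only [Prod.fst_swap, Prod.snd_swap]
  push_cast
  ring

lemma R2Partial_eq (w : ℂ) (τ : ℍ) (N : ℕ) : R2Partial w τ N =
    ∑ k ∈ Finset.Icc (-(N : ℤ)) N ×ˢ Finset.Icc (-(N : ℤ)) N, R2SymTerm w τ k := by
  have h : ∀ k₃ k₄ : ℤ, R2Term w τ k₃ k₄ = R2SymTerm w τ (k₃, k₄) - R2AntiTerm w τ (k₃, k₄) +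
    R2AntiTerm w τ (k₄, k₃) := fun k₃ k₄ => R2Term_eq w τ (k₃, k₄)
  rw [R2Partial, Finset.sum_product]
  simp only [h, Finset.sum_add_distrib, Finset.sum_sub_distrib]
  rw [Finset.sum_comm (f := fun k₃ k₄ => R2AntiTerm w τ (k₄, k₃))]
  ring

lemma tendsto_squares :
    Tendsto (fun N : ℕ => Finset.Icc (-(N : ℤ)) N ×ˢ Finset.Icc (-(N : ℤ)) N) atTop atTop := by
  refine tendsto_atTop_finset_of_monotone ?_ ?_
  · intro M N h
    have h' : (M : ℤ) ≤ N := by exact_mod_cast h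
    exact Finset.product_subset_product (Finset.Icc_subset_Icc (by omega) h')
      (Finset.Icc_subset_Icc (by omega) h')
  · intro k
    refine ⟨k.1.natAbs + k.2.natAbs, ?_⟩
    rw [Finset.mem_product, Finset.mem_Icc, Finset.mem_Icc]
    omega

lemma tendsto_R2Partial (w : ℂ) (τ : ℍ) : Tendsto (R2Partial w τ) atTop (𝓝 (R2Sym w τ)) := by
  have := (summable_R2SymTerm w τ).hasSum.comp tendsto_squares
  refine this.congr fun N => ?_
  rw [R2Partial_eq]; rfl

theorem R2_eq_R2Sym (w : ℂ) (τ : ℍ) : R2 w τ = R2Sym w τ := (tendsto_R2Partial w τ).limUnder_eq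

end

section

open Set

/-! #### Reindexing by parity -/

lemma hasSum_of_eq {ι : Type*} {f g : ι → ℂ} {a : ℂ} (h : HasSum f a) (hfg : ∀ i, f i = g i) :
    HasSum g a := (funext hfg : f = g) ▸ h

/-- Pairs of integers, sorted by the parity of the second one. -/
def parityEquiv : Fin 2 × (ℤ × ℤ) ≃ ℤ × ℤ where
  toFun p := (p.2.1 - p.2.2, 2 * p.2.2 + ((p.1 : ℕ) : ℤ))
  invFun k := (if k.2 % 2 = 0 then 0 else 1, (k.1 + k.2 / 2, k.2 / 2))
  left_inv := by
    rintro ⟨i, n, l⟩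
    fin_cases i
    · simp
    · have h1 : (2 * l + 1) % 2 = 1 := by omega
      have h2 : (2 * l + 1) / 2 = l := by omega
      simp [h1, h2]
  right_inv := by
    rintro ⟨a, b⟩
    by_cases h : b % 2 = 0
    · simp [h]; omega
    · simp [h]; omega

/-- The shear `(k₁, k₂) ↦ (k₁ + k₂, k₂)`. -/
def shearEquiv : ℤ × ℤ ≃ ℤ × ℤ where
  toFun k := (k.1 + k.2, k.2)
  invFun k := (k.1 - k.2, k.2)
  left_inv k := by simp
  right_inv k := by simp

lemma tsum_parityEquiv {F : ℤ × ℤ → ℂ} (hF : Summable F) :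
    ∑' k, F k = ∑ i : Fin 2, ∑' p : ℤ × ℤ, F (p.1 - p.2, 2 * p.2 + ((i : ℕ) : ℤ)) := by
  have hs : Summable fun p => F (parityEquiv p) := parityEquiv.summable_iff.2 hF
  rw [← parityEquiv.tsum_eq, hs.tsum_prod, tsum_fintype]
  rfl

lemma tsum_parityEquiv_shear {F : ℤ × ℤ → ℂ} (hF : Summable F) :
    ∑' k, F k = ∑ i : Fin 2, ∑' p : ℤ × ℤ,
      F (p.1 + p.2 + ((i : ℕ) : ℤ), 2 * p.2 + ((i : ℕ) : ℤ)) := by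
  have hs : Summable fun p => F (shearEquiv p) := shearEquiv.summable_iff.2 hF
  rw [← shearEquiv.tsum_eq, tsum_parityEquiv hs]
  refine Finset.sum_congr rfl fun i _ => tsum_congr fun p => ?_
  simp only [shearEquiv, Equiv.coe_fn_mk]
  congr 2; ring

lemma tsum_mul_prod {f g : ℤ → ℂ} (hf : Summable f) (hg : Summable g) :
    ∑' p : ℤ × ℤ, f p.1 * g p.2 = (∑' n, f n) * ∑' n, g n :=
  (tsum_mul_tsum_of_summable_norm hf.norm hg.norm).symm

/-! #### The antiholomorphic derivative of `R₂` -/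

lemma R1_eq_rr (j : ℕ) (w : ℂ) (τ : ℍ) (n : ℤ) :
    R1Term w τ (n + j / 2) = rTerm (3 * w) (triple τ) (2 * n + j) := by
  rw [R1Term, rTerm, im_triple]
  have h1 : Real.sign ((n : ℝ) + j / 2) = Real.sign ((2 * n + j : ℤ) : ℝ) := by
    rw [← sign_mul_of_pos (two_pos) ((n : ℝ) + j / 2)]
    congr 1; push_cast; ring
  have h2 : 2 * ((n : ℝ) + j / 2) - w.im / τ.im =
      ((2 * n + j : ℤ) : ℝ) - (3 * w).im / (3 * τ.im) := by
    have : (3 * w).im = 3 * w.im := by simp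
    rw [this, mul_div_mul_left _ _ (by norm_num)]
    push_cast; ring
  rw [h1, h2, coe_triple]
  congr 1
  simp only [← e_add]
  congr 1
  push_cast
  ring

lemma R1_eq (j : ℕ) (w : ℂ) (τ : ℍ) : R1 j w τ = rr j (3 * w) (triple τ) :=
  tsum_congr fun n => R1_eq_rr j w τ n

/-- The antiholomorphic derivative of `R_{1,j}`, up to normalization. -/
def rho (k : ℤ) (w : ℂ) (τ : ℍ) : ℂ :=
  (Real.exp (-(Real.pi * (3 * w).im ^ 2 / (triple τ).im)) : ℂ) *
    (starRingEnd ℂ) (eta k (3 * w) (triple τ))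

lemma hasDbarAt_R1 (k : ℤ) (τ : ℍ) (w : ℂ) :
    HasDbarAt (fun w => rr k (3 * w) (triple τ)) (3 * I / √(3 * τ.im) * rho k w τ) w := by
  have h := HasDbarAt.comp_affine (w := w) 3 0 (f := fun w => rr k w (triple τ))
    (hasDbarAt_rr k (triple τ) _)
  simp only [add_zero] at h
  refine h.congr ?_
  rw [rho, im_triple, Complex.conj_ofNat]
  ring

lemma summable_psi2 (w : ℂ) (τ : ℍ) :
    Summable fun k : ℤ × ℤ => (psi2 τ.im k (w.im / τ.im) : ℂ) * xTerm w τ k := by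
  have hτ := τ.im_pos
  refine Summable.of_norm_bounded ((summable_exp_neg_sq_prod (6 * Real.pi * ‖w‖ + 1)
    (by have := Real.pi_pos; positivity : 0 < Real.pi * τ.im)).mul_left 2) fun k => ?_
  have hb := exp_bound_R2 (τ := τ) k le_rfl (w := w)
  have h2 := abs_psi2_le hτ k (w.im / τ.im)
  rw [norm_mul, norm_real, Real.norm_eq_abs]
  set X := ‖xTerm w τ k‖
  have hX : 0 ≤ X := norm_nonneg _
  set E := Real.exp (-(4 * Real.pi * τ.im) * quadA2 k +
      4 * Real.pi * τ.im * |w.im / τ.im| * |(k.1 + k.2 : ℝ)|)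
  have hE : 0 ≤ E := (Real.exp_pos _).le
  have hm : 0 ≤ |(k.1 + k.2 : ℝ)| := abs_nonneg _
  have h3 : Real.exp (-(4 * Real.pi * τ.im) * quadA2 k +
      4 * Real.pi * τ.im * (w.im / τ.im) * (k.1 + k.2)) ≤ E := by
    apply Real.exp_le_exp.2
    have h4 : (w.im / τ.im) * (k.1 + k.2 : ℝ) ≤ |w.im / τ.im| * |(k.1 + k.2 : ℝ)| := by
      rw [← abs_mul]; exact le_abs_self _
    have := Real.pi_pos
    have h5 : 4 * Real.pi * τ.im * ((w.im / τ.im) * (k.1 + k.2 : ℝ)) ≤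
      4 * Real.pi * τ.im * (|w.im / τ.im| * |(k.1 + k.2 : ℝ)|) := by gcongr
    linarith
  calc _ ≤ 2 * E * X := by
        gcongr
        exact h2.trans (by gcongr)
    _ = 2 * (E * X) := by ring
    _ ≤ _ := by
        refine mul_le_mul_of_nonneg_left (le_trans ?_ hb) zero_le_two
        nlinarith [mul_nonneg hm (mul_nonneg hE hX)]

/-- In the coordinates 2k₁ - k₂ = 2n + j and k₂ = 2l + j the form is orthogonal, Q = (2n + j)²/4 +
3(2l + j)²/4. The summand factors into a term of `rr` at τ and a conjugated theta term at 3τ. -/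
lemma psi2_mul_xTerm (w : ℂ) (τ : ℍ) (j n l : ℤ) :
    (psi2 τ.im (n + l + j, 2 * l + j) (w.im / τ.im) : ℂ) * xTerm w τ (n + l + j, 2 * l + j) =
      rTerm w τ (2 * n + j) * (Real.exp (-(Real.pi * (3 * w).im ^ 2 / (triple τ).im)) *
        (starRingEnd ℂ) (thTerm (3 * w) (triple τ) (-(2 * l + j)))) := by
  rw [← gauss_mul_rTerm_factor, im_triple, coe_triple, psi2, rTerm, xTerm]
  have h1 : (2 * ((n + l + j : ℤ) : ℝ) - ((2 * l + j : ℤ) : ℝ)) = ((2 * n + j : ℤ) : ℝ) := by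
    push_cast; ring
  have h2 : (3 * w).im / (3 * τ.im) = w.im / τ.im := by
    have : (3 * w).im = 3 * w.im := by simp
    rw [this, mul_div_mul_left _ _ (by norm_num)]
  have h3 : e (-((quadA2 (n + l + j, 2 * l + j) : ℂ) * τ)) *
      e ((((n + l + j : ℤ) + (2 * l + j : ℤ) : ℝ) : ℂ) * w) =
      e ((2 * n + j : ℤ) * w / 2) * e (-((2 * n + j : ℤ) ^ 2 * τ / 4)) *
      (e (-((2 * l + j : ℤ) ^ 2 * (3 * τ) / 4)) * e ((((2 * l + j : ℤ) / 2 : ℝ) : ℂ) * (3 * w))) := by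
    simp only [← e_add, quadA2]
    congr 1
    push_cast
    ring
  simp only [h1, h2, h3]
  push_cast
  ring

lemma tsum_psi2 (w : ℂ) (τ : ℍ) :
    ∑' k : ℤ × ℤ, (psi2 τ.im k (w.im / τ.im) : ℂ) * xTerm w τ k =
      ∑ j : Fin 2, rr (j : ℕ) w τ * rho (j : ℕ) w τ := by
  rw [tsum_parityEquiv_shear (summable_psi2 w τ)]
  refine Finset.sum_congr rfl fun j _ => ?_
  simp_rw [psi2_mul_xTerm]
  have hs : Summable fun l : ℤ => thTerm (3 * w) (triple τ) (-(2 * l + ((j : ℕ) : ℤ))) := by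
    refine (summable_thTerm (3 * w) (triple τ)).comp_injective (i := fun l : ℤ => -(2 * l + ((j : ℕ) : ℤ))) ?_
    intro a b h
    simpa using h
  have hs' : Summable fun l : ℤ => (Real.exp (-(Real.pi * (3 * w).im ^ 2 / (triple τ).im)) : ℂ) *
      (starRingEnd ℂ) (thTerm (3 * w) (triple τ) (-(2 * l + ((j : ℕ) : ℤ)))) := by
    refine Summable.mul_left _ ?_
    exact hs.map (starRingEnd ℂ) Complex.continuous_conj
  rw [tsum_mul_prod (summable_rTerm ((j : ℕ) : ℤ) w τ) hs', tsum_mul_left, ← Complex.conj_tsum,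
    tsum_parity_neg]
  rfl

/-- The two mirror-image halves of the derivative have equal sums, and each factors by `tsum_psi2`.
This produces the factor -2. -/
theorem hasDbarAt_R2Sym (τ : ℍ) (w : ℂ) : HasDbarAt (fun w => R2Sym w τ)
    (-2 * ∑ j : Fin 2, 3 * I / √(3 * τ.im) * rho (j : ℕ) w τ * rr (j : ℕ) w τ) w := by
  refine (R2Sym_dbar_aux τ w).2.congr ?_
  have hs := summable_psi2 w τ
  have hs2 : Summable fun k : ℤ × ℤ => (psi2 τ.im k.swap (w.im / τ.im) : ℂ) * xTerm w τ k.swap :=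
    (Equiv.prodComm ℤ ℤ).summable_iff.2 hs
  have ht2 : ∑' k : ℤ × ℤ, (psi2 τ.im k.swap (w.im / τ.im) : ℂ) * xTerm w τ k.swap =
      ∑' k : ℤ × ℤ, (psi2 τ.im k (w.im / τ.im) : ℂ) * xTerm w τ k :=
    (Equiv.prodComm ℤ ℤ).tsum_eq fun k => (psi2 τ.im k (w.im / τ.im) : ℂ) * xTerm w τ k
  have h1 : ∀ k : ℤ × ℤ, (phi2' τ.im k (w.im / τ.im) : ℂ) * xTerm w τ k =
      (-2 * √(3 * τ.im) : ℂ) * ((psi2 τ.im k (w.im / τ.im) : ℂ) * xTerm w τ k +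
        (psi2 τ.im k.swap (w.im / τ.im) : ℂ) * xTerm w τ k.swap) := by
    intro k
    rw [xTerm_swap, phi2']
    push_cast
    ring
  simp_rw [h1]
  rw [tsum_mul_left, hs.tsum_add hs2, ht2, tsum_psi2, Fin.sum_univ_two, Fin.sum_univ_two]
  have hτ := τ.im_pos
  have h0 : (√(3 * τ.im) : ℂ) ≠ 0 := by
    exact_mod_cast (Real.sqrt_pos.2 (by positivity : 0 < 3 * τ.im)).ne'
  have hsq : (√(3 * τ.im) : ℂ) ^ 2 = 3 * τ.im := by
    rw [← ofReal_pow, Real.sq_sqrt (by positivity)]; push_cast; rfl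
  have hτ' : (τ.im : ℂ) ≠ 0 := by exact_mod_cast hτ.ne'
  field_simp
  rw [hsq]
  ring

/-! #### Translations of `R₂` -/

lemma R2Sym_add_one (w : ℂ) (τ : ℍ) : R2Sym (w + 1) τ = R2Sym w τ := by
  refine tsum_congr fun k => ?_
  rw [R2SymTerm, R2SymTerm, xTerm, xTerm, add_im, one_im, add_zero, mul_add, mul_one, e_add,
    show (((k.1 + k.2 : ℝ) : ℝ) : ℂ) = ((k.1 + k.2 : ℤ) : ℂ) by push_cast; rfl, e_int, mul_one]

/-- If only one coordinate jumps, the jump of the product is the sign of the other coordinate, which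
is also the sign of the linear form beside it, and everything cancels. Only the four points with
both coordinates in {0, -1} need inspection. -/
lemma sign_succ_mul_sub (k : ℤ × ℤ) :
    Real.sign ((k.1 + 1 : ℤ) : ℝ) * Real.sign ((k.2 + 1 : ℤ) : ℝ) -
      Real.sign (k.1 : ℝ) * Real.sign (k.2 : ℝ) -
      (Real.sign ((k.2 + 1 : ℤ) : ℝ) - Real.sign (k.2 : ℝ)) *
        Real.sign ((2 * k.1 - k.2 + 1 : ℤ) : ℝ) -
      (Real.sign ((k.1 + 1 : ℤ) : ℝ) - Real.sign (k.1 : ℝ)) *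
        Real.sign ((2 * k.2 - k.1 + 1 : ℤ) : ℝ) =
    -if k = (0, 0) ∨ k = (-1, -1) then 1 else 0 := by
  obtain ⟨a, b⟩ := k
  have key : ∀ a b : ℤ, ¬(a = 0 ∨ a = -1) → (b = 0 ∨ b = -1) →
      Real.sign ((a + 1 : ℤ) : ℝ) = Real.sign (a : ℝ) ∧
      Real.sign ((2 * a - b + 1 : ℤ) : ℝ) = Real.sign (a : ℝ) := by
    intro a b ha hb
    have h1 := sign_int_succ_sub a
    rw [if_neg ha] at h1
    refine ⟨by linarith, ?_⟩
    rcases lt_or_gt_of_ne (fun h => ha (Or.inl h) : a ≠ 0) with h | h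
    · have h2 : (2 * a - b + 1 : ℤ) < 0 := by omega
      rw [Real.sign_of_neg (by exact_mod_cast h2), Real.sign_of_neg (by exact_mod_cast h)]
    · have h2 : 0 < (2 * a - b + 1 : ℤ) := by omega
      rw [Real.sign_of_pos (by exact_mod_cast h2), Real.sign_of_pos (by exact_mod_cast h)]
  have hm1 : Real.sign ((-1 : ℤ) : ℝ) = -1 := by rw [Real.sign_of_neg]; norm_num
  by_cases ha : a = 0 ∨ a = -1 <;> by_cases hb : b = 0 ∨ b = -1
  · rcases ha with rfl | rfl <;> rcases hb with rfl | rfl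
    · norm_num [Real.sign_of_pos]
    · norm_num [Real.sign_of_pos, Real.sign_of_neg]
    · norm_num [Real.sign_of_pos, Real.sign_of_neg]
    · norm_num [Real.sign_of_pos, Real.sign_of_neg]
  · obtain ⟨h1, h2⟩ := key b a hb ha
    have hne : ¬((a, b) = ((0, 0) : ℤ × ℤ) ∨ (a, b) = (-1, -1)) := by
      simp only [Prod.mk.injEq]; tauto
    have h3 := sign_int_succ_sub a
    rw [if_pos ha] at h3
    dsimp only at *
    rw [if_neg hne, h1, h2, h3]
    linear_combination Real.sign (b : ℝ) * h3
  · obtain ⟨h1, h2⟩ := key a b ha hb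
    have hne : ¬((a, b) = ((0, 0) : ℤ × ℤ) ∨ (a, b) = (-1, -1)) := by
      simp only [Prod.mk.injEq]; tauto
    have h3 := sign_int_succ_sub b
    rw [if_pos hb] at h3
    dsimp only at *
    rw [if_neg hne, h1, h2, h3]
    linear_combination Real.sign (a : ℝ) * h3
  · have hne : ¬((a, b) = ((0, 0) : ℤ × ℤ) ∨ (a, b) = (-1, -1)) := by
      simp only [Prod.mk.injEq]; tauto
    have h3 := sign_int_succ_sub a
    have h4 := sign_int_succ_sub b
    rw [if_neg ha] at h3
    rw [if_neg hb] at h4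
    dsimp only at *
    rw [if_neg hne, h3, h4, sub_eq_zero.1 h3, sub_eq_zero.1 h4]
    ring

/-- The summand of `R_{1,j}`, as a function on the lattice. -/
def lineTerm (w : ℂ) (τ : ℍ) (k : ℤ × ℤ) : ℂ :=
  ((Real.sign k.2 - E1 (√(3 * τ.im) * (k.2 - w.im / τ.im)) : ℝ) : ℂ) * xTerm w τ k

/-- Shifting k by (1, 1) and w by τ fixes the arguments of all error functions. The remaining jumps
of signs are supported on two pairs of lines and at two points. -/
lemma R2SymTerm_add_tau (w : ℂ) (τ : ℍ) (k : ℤ × ℤ) :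
    R2SymTerm (w + τ) τ (k + (1, 1)) = e (2 * w + τ) * (R2SymTerm w τ k
      - (if 2 * k.1 - k.2 = 0 ∨ 2 * k.1 - k.2 = -1 then 1 else 0) * lineTerm w τ k
      - (if 2 * k.2 - k.1 = 0 ∨ 2 * k.2 - k.1 = -1 then 1 else 0) * lineTerm w τ k.swap
      - (if k = (0, 0) ∨ k = (-1, -1) then 1 else 0) * xTerm w τ k) := by
  have hτ := τ.im_pos.ne'
  have ha : (w + τ).im / τ.im = w.im / τ.im + 1 := by
    simp only [add_im, UpperHalfPlane.coe_im]; field_simp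
  have hx : xTerm (w + τ) τ (k + (1, 1)) = e (2 * w + τ) * xTerm w τ k := by
    simp only [xTerm, ← e_add, quadA2, Prod.fst_add, Prod.snd_add]
    congr 1
    push_cast
    ring
  have h0 := sign_succ_mul_sub k
  have h1 := sign_int_succ_sub (2 * k.1 - k.2)
  have h2 := sign_int_succ_sub (2 * k.2 - k.1)
  have hφ : phi2 τ.im (k + (1, 1)) (w.im / τ.im + 1) = phi2 τ.im k (w.im / τ.im)
      - (if 2 * k.1 - k.2 = 0 ∨ 2 * k.1 - k.2 = -1 then 1 else 0) *
        (Real.sign k.2 - E1 (√(3 * τ.im) * (k.2 - w.im / τ.im)))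
      - (if 2 * k.2 - k.1 = 0 ∨ 2 * k.2 - k.1 = -1 then 1 else 0) *
        (Real.sign k.1 - E1 (√(3 * τ.im) * (k.1 - w.im / τ.im)))
      - (if k = (0, 0) ∨ k = (-1, -1) then 1 else 0) := by
    rw [← h1, ← h2]
    have e1 : (2 * ((k.1 + 1 : ℤ) : ℝ) - ((k.2 + 1 : ℤ) : ℝ)) = ((2 * k.1 - k.2 + 1 : ℤ) : ℝ) := by
      push_cast; ring
    have e2 : (2 * ((k.2 + 1 : ℤ) : ℝ) - ((k.1 + 1 : ℤ) : ℝ)) = ((2 * k.2 - k.1 + 1 : ℤ) : ℝ) := by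
      push_cast; ring
    have e3 : (((2 * k.1 - k.2 + 1 : ℤ) : ℝ) - (w.im / τ.im + 1)) = 2 * k.1 - k.2 - w.im / τ.im := by
      push_cast; ring
    have e4 : ((k.2 + 1 : ℤ) : ℝ) - (w.im / τ.im + 1) = k.2 - w.im / τ.im := by push_cast; ring
    have e5 : ((k.1 + 1 : ℤ) : ℝ) - (w.im / τ.im + 1) = k.1 - w.im / τ.im := by push_cast; ring
    have e6 : ((2 * k.1 - k.2 : ℤ) : ℝ) = 2 * k.1 - k.2 := by push_cast; ring
    have e7 : ((2 * k.2 - k.1 : ℤ) : ℝ) = 2 * k.2 - k.1 := by push_cast; ring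
    simp only [phi2, Prod.fst_add, Prod.snd_add]
    rw [e1, e2, e3, e4, e5, e6, e7]
    linear_combination h0
  rw [R2SymTerm, ha, hx, hφ, R2SymTerm, lineTerm, lineTerm, xTerm_swap]
  have hite : ∀ (p : Prop) [Decidable p], ((if p then (1 : ℝ) else 0 : ℝ) : ℂ) =
      if p then 1 else 0 := fun p _ => by split_ifs <;> simp
  simp only [Prod.snd_swap, ofReal_sub, ofReal_mul, hite]
  ring

/-- On the line k₂ = 2k₁ + j the form is Q = 3(2k₁ + j)²/4 + j²/4, so the restricted sum is R_{1,j}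
up to the displayed factor. -/
lemma hasSum_lineTerm (w : ℂ) (τ : ℍ) :
    HasSum (fun k : ℤ × ℤ => (if 2 * k.1 - k.2 = 0 ∨ 2 * k.1 - k.2 = -1 then 1 else 0) *
      lineTerm w τ k)
      (rr 0 (3 * w) (triple τ) + e (-(w / 2) - τ / 4) * rr 1 (3 * w) (triple τ)) := by
  have aux : ∀ j : ℤ, HasSum (fun k : ℤ × ℤ => if k.2 = 2 * k.1 + j then lineTerm w τ k else 0)
      (e (-(j * w / 2) - j ^ 2 * τ / 4) * rr j (3 * w) (triple τ)) := by
    intro j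
    have hinj : Function.Injective fun n : ℤ => (n, 2 * n + j) := fun a b h => by
      simpa using congrArg Prod.fst h
    refine (hinj.hasSum_iff ?_).1 ?_
    · intro k hk
      refine if_neg fun h => hk ⟨k.1, ?_⟩
      exact Prod.ext rfl h.symm
    · have := ((summable_rTerm j (3 * w) (triple τ)).hasSum.mul_left (e (-(j * w / 2) - j ^ 2 * τ / 4)))
      refine hasSum_of_eq this fun n => ?_
      simp only [Function.comp, if_true, lineTerm, rTerm, xTerm, im_triple]
      have h2 : (3 * w).im / (3 * τ.im) = w.im / τ.im := by
        have : (3 * w).im = 3 * w.im := by simp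
        rw [this, mul_div_mul_left _ _ (by norm_num)]
      rw [h2, mul_left_comm]
      congr 1
      simp only [← e_add, quadA2, coe_triple]
      congr 1
      push_cast
      ring
  have h := (aux 0).add (aux 1)
  have h0 : e (-(((0 : ℤ) : ℂ) * w / 2) - ((0 : ℤ) : ℂ) ^ 2 * τ / 4) = 1 := by
    rw [← e_zero]; congr 1; push_cast; ring
  have h1 : e (-(((1 : ℤ) : ℂ) * w / 2) - ((1 : ℤ) : ℂ) ^ 2 * τ / 4) = e (-(w / 2) - τ / 4) := by
    congr 1; push_cast; ring
  rw [h0, h1, one_mul] at h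
  refine hasSum_of_eq h fun k => ?_
  by_cases hk0 : k.2 = 2 * k.1 + 0
  · rw [if_pos hk0, if_neg (by omega), if_pos (by omega)]; ring
  · by_cases hk1 : k.2 = 2 * k.1 + 1
    · rw [if_neg hk0, if_pos hk1, if_pos (by omega)]; ring
    · rw [if_neg hk0, if_neg hk1, if_neg (by omega)]; ring

theorem R2Sym_add_tau (w : ℂ) (τ : ℍ) : R2Sym (w + τ) τ = e (2 * w + τ) * (R2Sym w τ
    - 2 * (rr 0 (3 * w) (triple τ) + e (-(w / 2) - τ / 4) * rr 1 (3 * w) (triple τ)) - 1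
    - e (-(2 * w + τ))) := by
  have h1 := hasSum_lineTerm w τ
  have h2 := (Equiv.prodComm ℤ ℤ).hasSum_iff.2 h1
  have h3 : HasSum (fun k : ℤ × ℤ => (if k = (0, 0) ∨ k = (-1, -1) then 1 else 0) * xTerm w τ k)
      (1 + e (-(2 * w + τ))) := by
    have ha := hasSum_ite_eq ((0, 0) : ℤ × ℤ) (xTerm w τ (0, 0))
    have hb := hasSum_ite_eq ((-1, -1) : ℤ × ℤ) (xTerm w τ (-1, -1))
    have hx0 : xTerm w τ (0, 0) = 1 := by simp [xTerm, quadA2, e_zero]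
    have hx1 : xTerm w τ (-1, -1) = e (-(2 * w + τ)) := by
      simp only [xTerm, quadA2, ← e_add]
      congr 1
      push_cast
      ring
    have hab := ha.add hb
    rw [hx0, hx1] at hab
    refine hasSum_of_eq hab fun k => ?_
    by_cases hk0 : k = (0, 0)
    · subst hk0; simp [hx0]
    · by_cases hk1 : k = (-1, -1)
      · subst hk1; simp [hx1]
      · simp [hk0, hk1]
  have h := (((((summable_R2SymTerm w τ).hasSum).sub h1).sub h2).sub h3).mul_left (e (2 * w + τ))
  have h' := hasSum_of_eq h fun k => (R2SymTerm_add_tau w τ k).symm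
  have h4 : ∑' k : ℤ × ℤ, R2SymTerm (w + τ) τ (k + (1, 1)) = R2Sym (w + τ) τ :=
    (Equiv.addRight ((1, 1) : ℤ × ℤ)).tsum_eq (R2SymTerm (w + τ) τ)
  rw [← h4, h'.tsum_eq, R2Sym]
  ring

end

section

open Set

/-! ### The completed double Appell sum -/

/-- Inner product with the first root. -/
def n1 (k : ℤ × ℤ) : ℤ := 2 * k.1 + k.2

/-- Inner product with the second root. -/
def n2 (k : ℤ × ℤ) : ℤ := k.2 - k.1

lemma summable_pair {a b : ℤ → ℂ} (ha : Summable fun n => ‖a n‖) (hb : Summable fun n => ‖b n‖)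
    (j : ℤ) : Summable fun k : ℤ × ℤ => a k.2 * b (n1 k + j) := by
  have h := (summable_mul_of_summable_norm hb ha)
  have hinj : Function.Injective fun k : ℤ × ℤ => (n1 k + j, k.2) := by
    rintro ⟨a, b⟩ ⟨c, d⟩ h
    simp only [n1, Prod.mk.injEq] at h ⊢
    omega
  refine (h.comp_injective hinj).congr fun k => ?_
  exact mul_comm _ _

lemma tsum_pair {a b : ℤ → ℂ} (ha : Summable fun n => ‖a n‖) (hb : Summable fun n => ‖b n‖)
    (j : ℤ) : ∑' k : ℤ × ℤ, a k.2 * b (n1 k + j) =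
      ∑ i : Fin 2, (∑' l : ℤ, a (2 * l + ((i : ℕ) : ℤ))) *
        ∑' n : ℤ, b (2 * n + (((i : ℕ) : ℤ) + j)) := by
  rw [tsum_parityEquiv (summable_pair ha hb j)]
  refine Finset.sum_congr rfl fun i _ => ?_
  have h1 : ∀ p : ℤ × ℤ, n1 (p.1 - p.2, 2 * p.2 + ((i : ℕ) : ℤ)) + j =
      2 * p.1 + (((i : ℕ) : ℤ) + j) := fun p => by simp only [n1]; ring
  simp only [h1]
  have h2 := tsum_mul_prod (hb.of_norm.comp_injective (injective_two_mul_add (((i : ℕ) : ℤ) + j)))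
    (ha.of_norm.comp_injective (injective_two_mul_add ((i : ℕ) : ℤ)))
  simp only [Function.comp] at h2
  rw [mul_comm, ← h2]
  exact tsum_congr fun p => mul_comm _ _

/-- The orthogonal splitting k₁² + k₂² + k₁k₂ = n₁²/4 + 3k₂²/4 with n₁ = 2k₁ + k₂ ≡ k₂ mod 2; the
linear form is k₁ + 2k₂ = (n₁ + 3k₂)/2. -/
lemma ThetaTerm_eq (v : ℂ) (τ : ℍ) (k : ℤ × ℤ) :
    ThetaTerm v τ k = thTerm (3 * v) (triple τ) k.2 * thTerm v τ (n1 k + 0) := by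
  simp only [ThetaTerm, thTerm, ← e_add, n1, coe_triple]
  congr 1
  push_cast
  ring

lemma summable_ThetaTerm (v : ℂ) (τ : ℍ) : Summable (ThetaTerm v τ) :=
  (summable_pair (summable_norm_thTerm (3 * v) (triple τ)) (summable_norm_thTerm v τ) 0).congr
    fun k => (ThetaTerm_eq v τ k).symm

/-- The theta functions at level three. -/
def th (i : ℤ) (v : ℂ) (τ : ℍ) : ℂ := eta i (3 * v) (triple τ)

lemma Theta_eq (v : ℂ) (τ : ℍ) :
    Theta v τ = ∑ i : Fin 2, th (i : ℕ) v τ * eta (i : ℕ) v τ := by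
  rw [Theta, tsum_congr (ThetaTerm_eq v τ), tsum_pair (summable_norm_thTerm _ _)
    (summable_norm_thTerm _ _)]
  simp only [add_zero]
  rfl

/-- The Appell sums multiplying `R_{1,j}`. -/
def gg (j : Fin 2) (u v : ℂ) (τ : ℍ) : ℂ :=
  ∑ i : Fin 2, th (i : ℕ) v τ * hh ((i : ℕ) + (j : ℕ)) j u v τ

lemma summable_gTerm (j : Fin 2) {u : ℂ} (v : ℂ) {τ : ℍ} (hu : OffLattice τ u) :
    Summable fun k : ℤ × ℤ => thTerm (3 * v) (triple τ) k.2 *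
      hTerm j u v τ (n1 k + ((j : ℕ) : ℤ)) :=
  summable_pair (summable_norm_thTerm _ _) (summable_norm_hTerm j v hu) _

lemma gg_eq (j : Fin 2) {u : ℂ} (v : ℂ) {τ : ℍ} (hu : OffLattice τ u) :
    gg j u v τ = ∑' k : ℤ × ℤ, thTerm (3 * v) (triple τ) k.2 *
      hTerm j u v τ (n1 k + ((j : ℕ) : ℤ)) :=
  (tsum_pair (summable_norm_thTerm _ _) (summable_norm_hTerm j v hu) _).symm

lemma ThetaTerm_mul_A0 (u v : ℂ) (τ : ℍ) (k : ℤ × ℤ) : ThetaTerm v τ k * A0 (u + n1 k * τ) =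
    thTerm (3 * v) (triple τ) k.2 * hTerm 0 u v τ (n1 k + (((0 : Fin 2) : ℕ) : ℤ)) := by
  rw [ThetaTerm_eq, hTerm]
  simp [mul_assoc]

lemma summable_ThetaTerm_mul_A0 {u : ℂ} (v : ℂ) {τ : ℍ} (hu : OffLattice τ u) :
    Summable fun k => ThetaTerm v τ k * A0 (u + n1 k * τ) :=
  (summable_gTerm 0 v hu).congr fun k => (ThetaTerm_mul_A0 u v τ k).symm

lemma gg_zero_eq {u : ℂ} (v : ℂ) {τ : ℍ} (hu : OffLattice τ u) :
    gg 0 u v τ = ∑' k, ThetaTerm v τ k * A0 (u + n1 k * τ) := by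
  rw [gg_eq 0 v hu]
  exact tsum_congr fun k => (ThetaTerm_mul_A0 u v τ k).symm

/-- The reflection exchanging the two roots. -/
def reflEquiv : ℤ × ℤ ≃ ℤ × ℤ where
  toFun k := (-k.1, k.1 + k.2)
  invFun k := (-k.1, k.1 + k.2)
  left_inv k := by ext <;> simp
  right_inv k := by ext <;> simp

lemma ThetaTerm_refl (v : ℂ) (τ : ℍ) (k : ℤ × ℤ) :
    ThetaTerm v τ (reflEquiv k) = ThetaTerm v τ k := by
  simp only [ThetaTerm, reflEquiv, Equiv.coe_fn_mk]
  push_cast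
  congr 2 <;> ring

lemma n1_refl (k : ℤ × ℤ) : n1 (reflEquiv k) = n2 k := by
  simp only [n1, n2, reflEquiv, Equiv.coe_fn_mk]; ring

lemma n2_refl (k : ℤ × ℤ) : n2 (reflEquiv k) = n1 k := by
  simp only [n1, n2, reflEquiv, Equiv.coe_fn_mk]; ring

lemma summable_ThetaTerm_mul_A0' {u : ℂ} (v : ℂ) {τ : ℍ} (hu : OffLattice τ u) :
    Summable fun k => ThetaTerm v τ k * A0 (u + n2 k * τ) := by
  have := reflEquiv.summable_iff.2 (summable_ThetaTerm_mul_A0 v hu)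
  refine this.congr fun k => ?_
  simp only [Function.comp, ThetaTerm_refl, n1_refl]

lemma gg_zero_eq' {u : ℂ} (v : ℂ) {τ : ℍ} (hu : OffLattice τ u) :
    gg 0 u v τ = ∑' k, ThetaTerm v τ k * A0 (u + n2 k * τ) := by
  rw [gg_zero_eq v hu, ← reflEquiv.tsum_eq]
  exact tsum_congr fun k => by rw [ThetaTerm_refl, n1_refl]

/-- The summand of `ff`. -/
def fTerm (u v : ℂ) (τ : ℍ) (k : ℤ × ℤ) : ℂ :=
  ThetaTerm v τ k * (A0 (u + n1 k * τ) * A0 (u + n2 k * τ))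

/-- The symmetric double Appell sum. -/
def ff (u v : ℂ) (τ : ℍ) : ℂ := ∑' k, fTerm u v τ k

lemma summable_fTerm {u : ℂ} (v : ℂ) {τ : ℍ} (hu : OffLattice τ u) : Summable (fTerm u v τ) := by
  obtain ⟨C, hC, h⟩ := exists_bound_A τ u
  refine Summable.of_norm_bounded ((summable_ThetaTerm v τ).norm.mul_right (C * C)) fun k => ?_
  have h1 := h.self_of_nhds 0 (n1 k) (hu.e_ne_one _)
  have h2 := h.self_of_nhds 0 (n2 k) (hu.e_ne_one _)
  rw [fTerm, norm_mul, norm_mul]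
  rw [A_zero] at h1 h2
  gcongr

lemma differentiableAt_ff {u : ℂ} (v : ℂ) {τ : ℍ} (hu : OffLattice τ u) :
    DifferentiableAt ℂ (fun u => ff u v τ) u := by
  obtain ⟨C, hC, h⟩ := exists_bound_A τ u
  obtain ⟨s, hs, hso, hus⟩ := eventually_nhds_iff.1
    (h.and ((isOpen_offLattice τ).eventually_mem hu))
  have hd : DifferentiableOn ℂ (fun u => ∑' k, fTerm u v τ k) s := by
    refine Complex.differentiableOn_tsum_of_summable_norm
      (u := fun k => ‖ThetaTerm v τ k‖ * (C * C))
      ((summable_ThetaTerm v τ).norm.mul_right (C * C)) ?_ hso ?_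
    · intro k z hz
      have h1 := differentiableAt_A_shift (j := 0) (hs z hz).2 (n1 k)
      have h2 := differentiableAt_A_shift (j := 0) (hs z hz).2 (n2 k)
      exact ((h1.mul h2).const_mul _).differentiableWithinAt
    · intro k z hz
      have h1 := (hs z hz).1 0 (n1 k) (hu.e_ne_one _)
      have h2 := (hs z hz).1 0 (n2 k) (hu.e_ne_one _)
      rw [fTerm, norm_mul, norm_mul]
      rw [A_zero] at h1 h2
      gcongr
  exact (hd.differentiableAt (hso.mem_nhds hus))

lemma differentiableAt_gg (j : Fin 2) {u : ℂ} (v : ℂ) {τ : ℍ} (hu : OffLattice τ u) :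
    DifferentiableAt ℂ (fun u => gg j u v τ) u := by
  unfold gg
  exact DifferentiableAt.fun_sum fun i _ => (differentiableAt_hh _ j v hu).const_mul _

/-! #### The Appell-Lerch sums in terms of `ff` and `gg` -/

lemma e_u_mul (u : ℂ) (τ : ℍ) (N : ℤ) : e (u + N * τ) = e u * e (N * τ) := e_add _ _

lemma e_mul_mu21Term (u v : ℂ) (τ : ℍ) (k : ℤ × ℤ) :
    e u * mu21Term u v τ k = ThetaTerm v τ k * A0 (u + n1 k * τ) - 1 / 2 * ThetaTerm v τ k := by
  have h1 : e ((k.1 ^ 2 + k.2 ^ 2 + k.1 * k.2 + 2 * k.1 + k.2) * (τ : ℂ)) =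
      e ((k.1 ^ 2 + k.2 ^ 2 + k.1 * k.2) * (τ : ℂ)) * e (n1 k * τ) := by
    rw [← e_add]; congr 1; simp only [n1]; push_cast; ring
  have h2 : e ((2 * k.1 + k.2) * (τ : ℂ)) = e (n1 k * τ) := by
    simp only [n1]; push_cast; rfl
  rw [mu21Term, h1, h2, A0, e_u_mul, ThetaTerm]
  ring

lemma summable_mu21Term {u : ℂ} (v : ℂ) {τ : ℍ} (hu : OffLattice τ u) :
    Summable (mu21Term u v τ) := by
  have h := (summable_ThetaTerm_mul_A0 v hu).sub ((summable_ThetaTerm v τ).mul_left (1 / 2))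
  refine (summable_mul_left_iff (e_ne_zero u)).1 (h.congr fun k => (e_mul_mu21Term u v τ k).symm)

lemma e_mul_tsum_mu21Term {u : ℂ} (v : ℂ) {τ : ℍ} (hu : OffLattice τ u) :
    e u * ∑' k, mu21Term u v τ k = gg 0 u v τ - 1 / 2 * Theta v τ := by
  rw [← tsum_mul_left, tsum_congr (e_mul_mu21Term u v τ), (summable_ThetaTerm_mul_A0 v hu).tsum_sub
    ((summable_ThetaTerm v τ).mul_left (1 / 2)), tsum_mul_left, ← gg_zero_eq v hu, Theta]

/-- This explains the factor of R_{1,0} in R_{2,2}: the two halves turn the geometric quotient into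
the odd function A₀. -/
lemma Theta_mul_mu21 {u v : ℂ} {τ : ℍ} (hu : OffLattice τ u) (hv : Theta v τ ≠ 0) :
    Theta v τ * (1 / 2 + e (u / 2) * (mu21 u v τ - 1 / 2)) = gg 0 u v τ := by
  have h1 := e_mul_tsum_mu21Term v hu
  have h2 := e_half_sq u
  rw [mu21, add_sub_cancel_left]
  calc _ = 1 / 2 * Theta v τ + (e (u / 2) * e (u / 2)) * ∑' k, mu21Term u v τ k := by
        field_simp
    _ = _ := by rw [h2, h1]; ring

lemma ThetaTerm_sub_tau (v : ℂ) (τ : ℍ) (k : ℤ × ℤ) :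
    ThetaTerm (v - τ) τ (k + (0, 1)) = e (2 * v - τ) * ThetaTerm v τ k := by
  simp only [ThetaTerm, ← e_add, Prod.fst_add, Prod.snd_add]
  congr 1
  push_cast
  ring

lemma Theta_sub_tau (v : ℂ) (τ : ℍ) : Theta (v - τ) τ = e (2 * v - τ) * Theta v τ := by
  rw [Theta, ← (Equiv.addRight ((0, 1) : ℤ × ℤ)).tsum_eq, Theta, ← tsum_mul_left]
  exact tsum_congr fun k => ThetaTerm_sub_tau v τ k

lemma Theta_add_tau (v : ℂ) (τ : ℍ) : Theta (v + τ) τ = e (-(2 * v) - τ) * Theta v τ := by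
  have h := Theta_sub_tau (v + τ) τ
  rw [add_sub_cancel_right] at h
  rw [h, ← mul_assoc, ← e_add, show -(2 * v) - τ + (2 * (v + τ) - (τ : ℂ)) = 0 by ring, e_zero, one_mul]

lemma Theta_add_one (v : ℂ) (τ : ℍ) : Theta (v + 1) τ = Theta v τ := by
  refine tsum_congr fun k => ?_
  rw [ThetaTerm, ThetaTerm, add_mul, one_mul, e_add,
    show ((k.1 : ℂ) + 2 * k.2) = ((k.1 + 2 * k.2 : ℤ) : ℂ) by push_cast; rfl, e_int, mul_one]

lemma mu21Term_sub_tau (u v : ℂ) (τ : ℍ) (k : ℤ × ℤ) :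
    e (u / 2) * (e (v / 2) * e (-τ / 4)) * mu21Term u (v - τ) τ (k + (0, 1)) =
      e (2 * v - τ) * (thTerm (3 * v) (triple τ) k.2 *
        hTerm 1 u v τ (n1 k + (((1 : Fin 2) : ℕ) : ℤ))) := by
  have h1 : e u * e ((2 * ((k + (0, 1)).1 : ℤ) + ((k + (0, 1)).2 : ℤ)) * (τ : ℂ)) =
      e (u + (n1 k + (((1 : Fin 2) : ℕ) : ℤ) : ℤ) * τ) := by
    rw [← e_add]; congr 1; simp [n1]; ring_nf; simp
  rw [mu21Term, hTerm, A_one, A1, h1, ← mul_div_assoc, mul_div_assoc', mul_div_assoc', mul_div_assoc']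
  congr 1
  simp only [thTerm, ← e_add, n1, Prod.fst_add, Prod.snd_add, coe_triple]
  congr 1
  push_cast
  simp only [Fin.val_one, Nat.cast_one]
  ring

lemma Theta_mul_mu21_shift {u v : ℂ} {τ : ℍ} (hu : OffLattice τ u) (hv : Theta v τ ≠ 0) :
    Theta v τ * (e (v / 2) * e (-τ / 4) * (mu21 u (v - τ) τ - 1 / 2)) = gg 1 u v τ := by
  have h1 : e (u / 2) * (e (v / 2) * e (-τ / 4)) * ∑' k, mu21Term u (v - τ) τ k =
      e (2 * v - τ) * gg 1 u v τ := by
    rw [← (Equiv.addRight ((0, 1) : ℤ × ℤ)).tsum_eq, gg_eq 1 v hu, ← tsum_mul_left, ← tsum_mul_left]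
    exact tsum_congr fun k => mu21Term_sub_tau u v τ k
  have h3 := e_ne_zero (2 * v - τ)
  rw [mu21, add_sub_cancel_left, Theta_sub_tau]
  calc _ = (e (u / 2) * (e (v / 2) * e (-τ / 4)) * ∑' k, mu21Term u (v - τ) τ k) /
        e (2 * v - τ) := by field_simp
    _ = _ := by rw [h1]; field_simp

/-- With X and Y the two exponentials, X/(1 - X) = A₀ - 1/2 and 1/(1 - Y) = A₀ + 1/2. The two linear
sums cancel under the reflection exchanging n₁ and n₂, and the constant is offset by the 1/4 in
μ_{2,2}. -/
lemma e_mul_mu22Term {u : ℂ} (v : ℂ) {τ : ℍ} (hu : OffLattice τ u) (k : ℤ × ℤ) :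
    e u * mu22Term u v τ k = fTerm u v τ k + 1 / 2 * (ThetaTerm v τ k * A0 (u + n1 k * τ)) -
      1 / 2 * (ThetaTerm v τ k * A0 (u + n2 k * τ)) - 1 / 4 * ThetaTerm v τ k := by
  have h1 : e ((k.1 ^ 2 + k.2 ^ 2 + k.1 * k.2 + 2 * k.1 + k.2) * (τ : ℂ)) =
      e ((k.1 ^ 2 + k.2 ^ 2 + k.1 * k.2) * (τ : ℂ)) * e (n1 k * τ) := by
    rw [← e_add]; congr 1; simp only [n1]; push_cast; ring
  have h2 : e ((2 * k.1 + k.2) * (τ : ℂ)) = e (n1 k * τ) := by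
    simp only [n1]; push_cast; rfl
  have h3 : e ((k.2 - k.1) * (τ : ℂ)) = e (n2 k * τ) := by
    simp only [n2]; push_cast; rfl
  have hx : 1 - e u * e (n1 k * τ) ≠ 0 := by
    rw [← e_u_mul]; exact sub_ne_zero.2 (Ne.symm (hu.e_ne_one _))
  have hy : 1 - e u * e (n2 k * τ) ≠ 0 := by
    rw [← e_u_mul]; exact sub_ne_zero.2 (Ne.symm (hu.e_ne_one _))
  rw [mu22Term, h1, h2, h3, fTerm, A0, A0, e_u_mul, e_u_mul, ThetaTerm]
  generalize e u * e (n2 k * τ) = Y at *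
  field_simp
  ring

lemma summable_mu22Term {u : ℂ} (v : ℂ) {τ : ℍ} (hu : OffLattice τ u) :
    Summable (mu22Term u v τ) := by
  have h := (((summable_fTerm v hu).add ((summable_ThetaTerm_mul_A0 v hu).mul_left (1 / 2))).sub
    ((summable_ThetaTerm_mul_A0' v hu).mul_left (1 / 2))).sub
      ((summable_ThetaTerm v τ).mul_left (1 / 4))
  exact (summable_mul_left_iff (e_ne_zero u)).1 (h.congr fun k => (e_mul_mu22Term v hu k).symm)

lemma Theta_mul_mu22 {u v : ℂ} {τ : ℍ} (hu : OffLattice τ u) (hv : Theta v τ ≠ 0) :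
    Theta v τ * mu22 u v τ = ff u v τ := by
  have h1 := (summable_fTerm v hu).add ((summable_ThetaTerm_mul_A0 v hu).mul_left (1 / 2))
  have h2 := h1.sub ((summable_ThetaTerm_mul_A0' v hu).mul_left (1 / 2))
  have h3 : e u * ∑' k, mu22Term u v τ k = ff u v τ - 1 / 4 * Theta v τ := by
    rw [← tsum_mul_left, tsum_congr (e_mul_mu22Term v hu),
      h2.tsum_sub ((summable_ThetaTerm v τ).mul_left (1 / 4)),
      h1.tsum_sub ((summable_ThetaTerm_mul_A0' v hu).mul_left (1 / 2)),
      (summable_fTerm v hu).tsum_add ((summable_ThetaTerm_mul_A0 v hu).mul_left (1 / 2)),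
      tsum_mul_left, tsum_mul_left, tsum_mul_left, ← gg_zero_eq v hu, ← gg_zero_eq' v hu, ff, Theta]
    ring
  rw [mu22]
  calc _ = 1 / 4 * Theta v τ + e u * ∑' k, mu22Term u v τ k := by field_simp
    _ = _ := by rw [h3]; ring

/-- The completed double Appell sum `Θ μ̂_{2,2}`. -/
def FF (u v : ℂ) (τ : ℍ) : ℂ :=
  ff u v τ - 1 / 4 * Theta v τ * R2Sym (u - v) τ
    - gg 0 u v τ * rr 0 (3 * (u - v)) (triple τ) - gg 1 u v τ * rr 1 (3 * (u - v)) (triple τ)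

theorem Theta_mul_muHat22 {u v : ℂ} {τ : ℍ} (hu : OffLattice τ u) (hv : Theta v τ ≠ 0) :
    Theta v τ * muHat22 u v τ = FF u v τ := by
  have h1 := Theta_mul_mu21 hu hv
  have h2 := Theta_mul_mu21_shift hu hv
  have h3 := Theta_mul_mu22 hu hv
  rw [muHat22, R22, R2_eq_R2Sym, R1_eq, R1_eq, FF, ← h1, ← h2, ← h3]
  push_cast
  ring

theorem seriesConverge {u v : ℂ} {τ : ℍ} (hu : OffLattice τ u) : SeriesConverge u v τ where
  theta := summable_ThetaTerm v τ
  theta_shift := summable_ThetaTerm (v - τ) τ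
  mu21 := summable_mu21Term v hu
  mu21_shift := summable_mu21Term (v - τ) hu
  mu22 := summable_mu22Term v hu
  R1 j _ := (summable_rTerm j (3 * (u - v)) (triple τ)).congr fun n => (R1_eq_rr j (u - v) τ n).symm
  R2 := ⟨_, tendsto_R2Partial (u - v) τ⟩

/-! #### Translations -/

lemma rr_triple_zero_add_tau (w : ℂ) (τ : ℍ) : rr 0 (3 * (w + τ)) (triple τ) =
    e (3 * (w / 2 + τ / 4)) * rr 1 (3 * w) (triple τ) + 1 := by
  have := rr_zero_add_tau (3 * w) (triple τ)
  rw [coe_triple] at this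
  rw [mul_add, this]
  congr 3; ring

lemma rr_triple_one_add_tau (w : ℂ) (τ : ℍ) : rr 1 (3 * (w + τ)) (triple τ) =
    e (3 * (w / 2 + τ / 4)) * (rr 0 (3 * w) (triple τ) + 1) := by
  have := rr_one_add_tau (3 * w) (triple τ)
  rw [coe_triple] at this
  rw [mul_add, this]
  congr 2; ring

lemma gg_zero_add_tau {u : ℂ} (v : ℂ) {τ : ℍ} (hu : OffLattice τ u) :
    gg 0 (u + τ) v τ = e ((u - v) / 2 + τ / 4) * gg 1 u v τ + 1 / 2 * Theta v τ := by
  rw [gg, gg, Theta_eq]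
  simp only [Fin.sum_univ_two, hh_zero_add_tau _ v hu, Fin.val_zero, Fin.val_one, Nat.cast_zero,
    Nat.cast_one, add_zero]
  ring

lemma gg_one_add_tau {u : ℂ} (v : ℂ) {τ : ℍ} (hu : OffLattice τ u) :
    gg 1 (u + τ) v τ = e ((u - v) / 2 + τ / 4) * (gg 0 u v τ + 1 / 2 * Theta v τ) := by
  rw [gg, gg, Theta_eq]
  simp only [Fin.sum_univ_two, hh_one_add_tau _ v hu, Fin.val_zero, Fin.val_one, Nat.cast_zero,
    Nat.cast_one, add_zero, add_assoc, one_add_one_eq_two, hh_add_two, eta_add_two]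
  ring

end

/-! ### Translations of the completed double Appell sum by the periods -/

section

open Set

lemma OffLattice.sub_tau {τ : ℍ} {u : ℂ} (hu : OffLattice τ u) : OffLattice τ (u - τ) := by
  simpa [sub_eq_add_neg] using (offLattice_add_iff τ u (-1) 0).2 hu

lemma ff_add_one (u v : ℂ) (τ : ℍ) : ff (u + 1) v τ = ff u v τ := by
  refine tsum_congr fun k => ?_
  rw [fTerm, fTerm, add_right_comm u 1, add_right_comm u 1, A0_add_one, A0_add_one]

lemma gg_add_one (j : Fin 2) (u v : ℂ) (τ : ℍ) :
    gg j (u + 1) v τ = (-1) ^ (j : ℕ) * gg j u v τ := by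
  simp only [gg, hh_add_one, Finset.mul_sum]
  exact Finset.sum_congr rfl fun i _ => by ring

lemma rr_triple_add_one (j : Fin 2) (w : ℂ) (τ : ℍ) : rr (j : ℕ) (3 * (w + 1)) (triple τ) =
    (-1) ^ (j : ℕ) * rr (j : ℕ) (3 * w) (triple τ) := by
  have h : e (((j : ℕ) : ℤ) / 2 : ℂ) = (-1) ^ (j : ℕ) := by
    fin_cases j
    · simp [e_zero]
    · simpa using e_half
  have hsq : ((-1 : ℂ) ^ (j : ℕ)) * (-1) ^ (j : ℕ) = 1 := by
    rw [← mul_pow]; simp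
  rw [show 3 * (w + 1) = 3 * w + 1 + 1 + 1 by ring, rr_add_one, rr_add_one, rr_add_one, h,
    ← mul_assoc, ← mul_assoc, hsq, one_mul]

lemma FF_add_one (u v : ℂ) (τ : ℍ) : FF (u + 1) v τ = FF u v τ := by
  have h0 := rr_triple_add_one 0 (u - v) τ
  have h1 := rr_triple_add_one 1 (u - v) τ
  simp only [Fin.val_zero, Fin.val_one, Nat.cast_zero, Nat.cast_one, pow_zero, pow_one, one_mul]
    at h0 h1
  rw [FF, FF, show u + 1 - v = u - v + 1 by ring, ff_add_one, R2Sym_add_one, gg_add_one, gg_add_one,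
    h0, h1]
  simp

/-! #### Translation of `ff` by the period -/

/-- The shift of k by (0, -1) lowers n₁ and n₂ by one each and undoes the translation of u inside
both A₀. The change of the Θ-term is a product of two exponentials, each absorbed by `A0_mul_e_neg`,
which leads to nine sums. -/
lemma fTerm_add_tau {u : ℂ} (v : ℂ) {τ : ℍ} (hu : OffLattice τ u) (k : ℤ × ℤ) :
    fTerm (u + τ) v τ (k + (0, -1)) = e (2 * (u - v) + τ) *
      (fTerm u v τ k
        + 1 / 2 * (ThetaTerm v τ k * A0 (u + n1 k * τ))
        + 1 / 2 * (ThetaTerm v τ k * A0 (u + n2 k * τ))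
        + 1 / 2 * (ThetaTerm v τ k * A0 (u + n1 k * τ) * e (-(u + n2 k * τ)))
        + 1 / 2 * (ThetaTerm v τ k * A0 (u + n2 k * τ) * e (-(u + n1 k * τ)))
        + 1 / 4 * ThetaTerm v τ k
        + 1 / 4 * (ThetaTerm v τ k * e (-(u + n1 k * τ)))
        + 1 / 4 * (ThetaTerm v τ k * e (-(u + n2 k * τ)))
        + 1 / 4 * (ThetaTerm v τ k * e (-(u + n1 k * τ)) * e (-(u + n2 k * τ)))) := by
  have h1 := A0_mul_e_neg (hu.e_ne_one (n1 k))
  have h2 := A0_mul_e_neg (hu.e_ne_one (n2 k))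
  have hx : u + τ + n1 (k + (0, -1)) * (τ : ℂ) = u + n1 k * τ := by
    simp only [n1, Prod.fst_add, Prod.snd_add]; push_cast; ring
  have hy : u + τ + n2 (k + (0, -1)) * (τ : ℂ) = u + n2 k * τ := by
    simp only [n2, Prod.fst_add, Prod.snd_add]; push_cast; ring
  have hT : ThetaTerm v τ (k + (0, -1)) = e (2 * (u - v) + τ) *
      (ThetaTerm v τ k * e (-(u + n1 k * τ)) * e (-(u + n2 k * τ))) := by
    simp only [ThetaTerm, ← e_add, Prod.fst_add, Prod.snd_add, n1, n2]
    congr 1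
    push_cast
    ring
  rw [fTerm, hx, hy, hT, fTerm]
  calc _ = e (2 * (u - v) + τ) * (ThetaTerm v τ k * ((A0 (u + n1 k * τ) * e (-(u + n1 k * τ))) *
        (A0 (u + n2 k * τ) * e (-(u + n2 k * τ))))) := by ring
    _ = _ := by rw [h1, h2]; ring

lemma ThetaTerm_mul_e_n1 (u v : ℂ) (τ : ℍ) (k : ℤ × ℤ) : ThetaTerm v τ k * e (-(u + n1 k * τ)) =
    e (-(u - v) - τ) * ThetaTerm v τ (k + (-1, 0)) := by
  simp only [ThetaTerm, ← e_add, Prod.fst_add, Prod.snd_add, n1]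
  congr 1
  push_cast
  ring

lemma ThetaTerm_mul_e_n2 (u v : ℂ) (τ : ℍ) (k : ℤ × ℤ) : ThetaTerm v τ k * e (-(u + n2 k * τ)) =
    e (-(u - v) - τ) * ThetaTerm v τ (k + (1, -1)) := by
  simp only [ThetaTerm, ← e_add, Prod.fst_add, Prod.snd_add, n2]
  congr 1
  push_cast
  ring

lemma ThetaTerm_mul_e_n1_n2 (u v : ℂ) (τ : ℍ) (k : ℤ × ℤ) :
    ThetaTerm v τ k * e (-(u + n1 k * τ)) * e (-(u + n2 k * τ)) =
    e (-(2 * (u - v) + τ)) * ThetaTerm v τ (k + (0, -1)) := by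
  simp only [ThetaTerm, ← e_add, Prod.fst_add, Prod.snd_add, n1, n2]
  congr 1
  push_cast
  ring

lemma hasSum_ThetaTerm_shift (v : ℂ) (τ : ℍ) (d : ℤ × ℤ) :
    HasSum (fun k => ThetaTerm v τ (k + d)) (Theta v τ) :=
  (Equiv.addRight d).hasSum_iff.2 (summable_ThetaTerm v τ).hasSum

lemma gg_zero_sub_tau {u : ℂ} (v : ℂ) {τ : ℍ} (hu : OffLattice τ u) :
    gg 0 (u - τ) v τ = e (-((u - v) / 2) + τ / 4) * gg 1 u v τ - 1 / 2 * Theta v τ := by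
  have h := gg_one_add_tau v hu.sub_tau
  rw [sub_add_cancel] at h
  rw [h, ← mul_assoc, ← e_add, show -((u - v) / 2) + (τ : ℂ) / 4 + ((u - τ - v) / 2 + τ / 4) = 0 by
    ring, e_zero]
  ring

/-- The exponential in n₂ is absorbed by shifting k by (1, -1). This raises n₁ by one, which is
compensated by u ↦ u - τ. -/
lemma hasSum_cross {u : ℂ} (v : ℂ) {τ : ℍ} (hu : OffLattice τ u) :
    HasSum (fun k => ThetaTerm v τ k * A0 (u + n1 k * τ) * e (-(u + n2 k * τ)))
      (e (-(u - v) - τ) * gg 0 (u - τ) v τ) := by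
  have h := (summable_ThetaTerm_mul_A0 v hu.sub_tau).hasSum
  rw [← gg_zero_eq v hu.sub_tau] at h
  have h2 := ((Equiv.addRight ((1, -1) : ℤ × ℤ)).hasSum_iff.2 h).mul_left (e (-(u - v) - τ))
  refine hasSum_of_eq h2 fun k => ?_
  simp only [Function.comp, Equiv.coe_addRight]
  have hx : u - τ + n1 (k + (1, -1)) * (τ : ℂ) = u + n1 k * τ := by
    simp only [n1, Prod.fst_add, Prod.snd_add]; push_cast; ring
  rw [mul_right_comm, ThetaTerm_mul_e_n2, mul_assoc, hx]

lemma hasSum_cross' {u : ℂ} (v : ℂ) {τ : ℍ} (hu : OffLattice τ u) :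
    HasSum (fun k => ThetaTerm v τ k * A0 (u + n2 k * τ) * e (-(u + n1 k * τ)))
      (e (-(u - v) - τ) * gg 0 (u - τ) v τ) := by
  have h := reflEquiv.hasSum_iff.2 (hasSum_cross v hu)
  refine hasSum_of_eq h fun k => ?_
  simp only [Function.comp, ThetaTerm_refl, n1_refl, n2_refl]

theorem ff_add_tau {u : ℂ} (v : ℂ) {τ : ℍ} (hu : OffLattice τ u) : ff (u + τ) v τ =
    e (2 * (u - v) + τ) * (ff u v τ + gg 0 u v τ + e (-(3 * ((u - v) / 2 + τ / 4))) * gg 1 u v τ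
      + 1 / 4 * Theta v τ * (1 + e (-(2 * (u - v) + τ)))) := by
  have H := (((((((((summable_fTerm v hu).hasSum.add
    ((summable_ThetaTerm_mul_A0 v hu).hasSum.mul_left (1 / 2))).add
    ((summable_ThetaTerm_mul_A0' v hu).hasSum.mul_left (1 / 2))).add
    ((hasSum_cross v hu).mul_left (1 / 2))).add
    ((hasSum_cross' v hu).mul_left (1 / 2))).add
    ((summable_ThetaTerm v τ).hasSum.mul_left (1 / 4))).add
    ((hasSum_of_eq ((hasSum_ThetaTerm_shift v τ (-1, 0)).mul_left (e (-(u - v) - τ)))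
      fun k => (ThetaTerm_mul_e_n1 u v τ k).symm).mul_left (1 / 4))).add
    ((hasSum_of_eq ((hasSum_ThetaTerm_shift v τ (1, -1)).mul_left (e (-(u - v) - τ)))
      fun k => (ThetaTerm_mul_e_n2 u v τ k).symm).mul_left (1 / 4))).add
    ((hasSum_of_eq ((hasSum_ThetaTerm_shift v τ (0, -1)).mul_left (e (-(2 * (u - v) + τ))))
      fun k => (ThetaTerm_mul_e_n1_n2 u v τ k).symm).mul_left (1 / 4))).mul_left
    (e (2 * (u - v) + τ))
  have H' := hasSum_of_eq H fun k => (fTerm_add_tau v hu k).symm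
  have h4 : ∑' k : ℤ × ℤ, fTerm (u + τ) v τ (k + (0, -1)) = ff (u + τ) v τ :=
    (Equiv.addRight ((0, -1) : ℤ × ℤ)).tsum_eq (fTerm (u + τ) v τ)
  rw [← h4, H'.tsum_eq, ← gg_zero_eq v hu, ← gg_zero_eq' v hu, gg_zero_sub_tau v hu]
  have h5 : e (-(3 * ((u - v) / 2 + (τ : ℂ) / 4))) =
      e (-(u - v) - τ) * e (-((u - v) / 2) + τ / 4) := by
    rw [← e_add]; congr 1; ring
  rw [h5]
  simp only [ff, Theta]
  ring

theorem FF_add_tau {u : ℂ} (v : ℂ) {τ : ℍ} (hu : OffLattice τ u) :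
    FF (u + τ) v τ = e (2 * (u - v) + τ) * FF u v τ := by
  rw [FF, FF, show u + τ - v = u - v + τ by ring, ff_add_tau v hu, R2Sym_add_tau,
    gg_zero_add_tau v hu, gg_one_add_tau v hu, rr_triple_zero_add_tau, rr_triple_one_add_tau]
  -- Every exponential in sight is a power of e(x), so the cancellation of all error terms becomes a
  -- rational identity.
  set x := (u - v) / 2 + (τ : ℂ) / 4 with hx
  have e1 : e (2 * (u - v) + τ) = e x ^ 4 := by
    rw [← e_nsmul]; congr 1; rw [hx]; push_cast; ring
  have e2 : e (3 * x) = e x ^ 3 := by rw [← e_nsmul]; norm_num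
  have e3 : e (-(3 * x)) = (e x ^ 3)⁻¹ := by rw [e_neg, e2]
  have e4 : e (-(2 * (u - v) + τ)) = (e x ^ 4)⁻¹ := by rw [e_neg, e1]
  have e5 : e (-((u - v) / 2) - τ / 4) = (e x)⁻¹ := by rw [← e_neg]; congr 1; rw [hx]; ring
  rw [e1, e2, e3, e4, e5]
  have h0 := e_ne_zero x
  field_simp
  ring

/-! #### Diagonal translations -/

lemma FF_add_one_right (u v : ℂ) (τ : ℍ) : FF u (v + 1) τ = FF u v τ := by
  have hT : ∀ k, ThetaTerm (v + 1) τ k = ThetaTerm v τ k := fun k => by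
    rw [ThetaTerm, ThetaTerm, add_mul, one_mul, e_add,
      show ((k.1 : ℂ) + 2 * k.2) = ((k.1 + 2 * k.2 : ℤ) : ℂ) by push_cast; rfl, e_int, mul_one]
  have hf : ff u (v + 1) τ = ff u v τ := tsum_congr fun k => by rw [fTerm, fTerm, hT]
  have hth : ∀ i : ℤ, th i (v + 1) τ = e (3 * (i / 2)) * th i v τ := fun i => by
    rw [th, th, show 3 * (v + 1) = 3 * v + 1 + 1 + 1 by ring, eta_add_one, eta_add_one, eta_add_one,
      show (3 : ℂ) * (i / 2) = i / 2 + i / 2 + i / 2 by ring, e_add, e_add]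
    ring
  have hhh : ∀ (k : ℤ) (j : Fin 2), hh k j u (v + 1) τ = e (k / 2) * hh k j u v τ := fun k j => by
    rw [hh, hh, ← tsum_mul_left]
    refine tsum_congr fun n => ?_
    rw [hTerm, hTerm, ← mul_assoc, ← e_parity n k]
    congr 1
    simp only [thTerm, ← e_add]
    congr 1; ring
  have hg : ∀ j : Fin 2, gg j u (v + 1) τ = e ((j : ℕ) / 2) * gg j u v τ := fun j => by
    simp only [gg, hth, hhh, Finset.mul_sum]
    refine Finset.sum_congr rfl fun i _ => ?_
    have : e (3 * ((((i : ℕ) : ℤ) : ℂ) / 2)) * e (((((i : ℕ) : ℤ) + ((j : ℕ) : ℤ) : ℤ) : ℂ) / 2) =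
        e (((j : ℕ) : ℂ) / 2) := by
      rw [← e_add, show 3 * ((((i : ℕ) : ℤ) : ℂ) / 2) + ((((i : ℕ) : ℤ) + ((j : ℕ) : ℤ) : ℤ) : ℂ) / 2 =
        ((2 * (i : ℕ) : ℤ) : ℂ) + ((j : ℕ) : ℂ) / 2 by push_cast; ring, e_add, e_int, one_mul]
    linear_combination (th (i : ℕ) v τ * hh ((i : ℕ) + (j : ℕ)) j u v τ) * this
  have h0 := rr_triple_add_one 0 (u - v - 1) τ
  have h1 := rr_triple_add_one 1 (u - v - 1) τ
  have hR := R2Sym_add_one (u - v - 1) τ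
  simp only [Fin.val_zero, Fin.val_one, Nat.cast_zero, Nat.cast_one, pow_zero, pow_one, one_mul,
    sub_add_cancel] at h0 h1 hR
  rw [FF, FF, hf, hg, hg, Theta_add_one, show u - (v + 1) = u - v - 1 by ring, h0, h1, hR]
  have hE0 : e ((((0 : Fin 2) : ℕ) : ℂ) / 2) = 1 := by simp [e_zero]
  have hE1 : e ((((1 : Fin 2) : ℕ) : ℂ) / 2) = -1 := by
    rw [Fin.val_one, Nat.cast_one, e_half]
  rw [hE0, hE1]
  ring

/-- The corrections depend on u - v, which is unchanged, so each of `ff`, `gg` and Θ picks up the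
multiplier of Θ. -/
lemma FF_add_tau_both (u v : ℂ) (τ : ℍ) :
    FF (u + τ) (v + τ) τ = e (-(2 * v) - τ) * FF u v τ := by
  have hf : ff (u + τ) (v + τ) τ = e (-(2 * v) - τ) * ff u v τ := by
    rw [ff, ff, ← (Equiv.addRight ((0, 1) : ℤ × ℤ)).tsum_eq (fTerm u v τ), ← tsum_mul_left]
    refine tsum_congr fun k => ?_
    have hT : ThetaTerm (v + τ) τ k = e (-(2 * v) - τ) * ThetaTerm v τ (k + (0, 1)) := by
      simp only [ThetaTerm, ← e_add, Prod.fst_add, Prod.snd_add]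
      congr 1
      push_cast
      ring
    simp only [fTerm, Equiv.coe_addRight]
    rw [hT, mul_assoc]
    congr 4 <;> simp only [n1, n2, Prod.fst_add, Prod.snd_add] <;> push_cast <;> ring
  have hhh : ∀ (k : ℤ) (j : Fin 2), hh k j (u + τ) (v + τ) τ =
      e (-(v / 2) - τ / 4) * hh (k + 1) j u v τ := fun k j => by
    rw [hh, hh, ← tsum_parity_shift (fun n => hTerm j u v τ n), ← tsum_mul_left]
    refine tsum_congr fun n => ?_
    rw [hTerm, thTerm_add_tau, hTerm, mul_assoc]
    congr 3
    push_cast; ring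
  have hth : ∀ i : ℤ, th i (v + τ) τ = e (-(3 * v / 2) - 3 * τ / 4) * th (i + 1) v τ := fun i => by
    have := eta_add_tau i (3 * v) (triple τ)
    rw [coe_triple] at this
    rw [th, mul_add, this, th]
  have hg : ∀ j : Fin 2, gg j (u + τ) (v + τ) τ = e (-(2 * v) - τ) * gg j u v τ := fun j => by
    have h2 : th 2 v τ = th 0 v τ := eta_add_two 0 _ _
    have h3 : ∀ k : ℤ, hh (k + 2) j u v τ = hh k j u v τ := fun k => hh_add_two k j u v τ
    have h4 : hh (1 + ((j : ℕ) : ℤ) + 1) j u v τ = hh ((j : ℕ) : ℤ) j u v τ := by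
      rw [← h3 ((j : ℕ) : ℤ)]; congr 1; ring
    have h5 : hh (((j : ℕ) : ℤ) + 1) j u v τ = hh (1 + ((j : ℕ) : ℤ)) j u v τ := by
      congr 1; ring
    have h6 : e (-(2 * v) - (τ : ℂ)) = e (-(3 * v / 2) - 3 * τ / 4) * e (-(v / 2) - τ / 4) := by
      rw [← e_add]; congr 1; ring
    simp only [gg, hth, hhh, Fin.sum_univ_two, Fin.val_zero, Fin.val_one, Nat.cast_zero,
      Nat.cast_one, zero_add, one_add_one_eq_two, h2, h4, h5, h6]
    ring
  rw [FF, FF, hf, hg, hg, Theta_add_tau, show u + τ - (v + τ) = u - v by ring]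
  ring

end

section

open Set

/-! #### Translations by lattice vectors -/

lemma eq_e_mul_of_step {f φ : ℤ → ℂ} (h : ∀ l, f (l + 1) = e (φ (l + 1) - φ l) * f l) (l : ℤ) :
    f l = e (φ l - φ 0) * f 0 := by
  induction l using Int.induction_on with
  | zero => rw [sub_self, e_zero, one_mul]
  | succ n ih =>
    rw [h, ih, ← mul_assoc, ← e_add]
    congr 2; ring
  | pred n ih =>
    have h1 := h (-n - 1)
    rw [sub_add_cancel, ih] at h1
    have h2 := e_ne_zero (φ (-n) - φ (-n - 1))
    refine mul_left_cancel₀ h2 ?_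
    rw [← h1, ← mul_assoc, ← e_add]
    congr 2; ring

lemma Theta_add_int (v : ℂ) (τ : ℍ) (n : ℤ) : Theta (v + n) τ = Theta v τ := by
  have := eq_e_mul_of_step (f := fun n => Theta (v + n) τ) (φ := 0) (fun l => by
    simp only [Pi.zero_apply, sub_zero, e_zero, one_mul]
    rw [Int.cast_add, Int.cast_one, ← add_assoc, Theta_add_one]) n
  simpa [e_zero] using this

lemma Theta_add_int_mul_tau (v : ℂ) (τ : ℍ) (l : ℤ) :
    Theta (v + l * τ) τ = e (-(2 * l * v) - l ^ 2 * τ) * Theta v τ := by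
  have := eq_e_mul_of_step (f := fun l => Theta (v + l * τ) τ)
    (φ := fun l => -(2 * l * v) - l ^ 2 * τ) (fun l => by
    rw [show v + (l + 1 : ℤ) * (τ : ℂ) = v + l * τ + τ by push_cast; ring, Theta_add_tau]
    congr 2; push_cast; ring) l
  simpa using this

lemma FF_add_int (u v : ℂ) (τ : ℍ) (n : ℤ) : FF (u + n) v τ = FF u v τ := by
  have := eq_e_mul_of_step (f := fun n => FF (u + n) v τ) (φ := 0) (fun l => by
    simp only [Pi.zero_apply, sub_zero, e_zero, one_mul]
    rw [Int.cast_add, Int.cast_one, ← add_assoc, FF_add_one]) n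
  simpa [e_zero] using this

lemma FF_add_int_right (u v : ℂ) (τ : ℍ) (n : ℤ) : FF u (v + n) τ = FF u v τ := by
  have := eq_e_mul_of_step (f := fun n => FF u (v + n) τ) (φ := 0) (fun l => by
    simp only [Pi.zero_apply, sub_zero, e_zero, one_mul]
    rw [Int.cast_add, Int.cast_one, ← add_assoc, FF_add_one_right]) n
  simpa [e_zero] using this

lemma FF_add_int_mul_tau {u : ℂ} (v : ℂ) {τ : ℍ} (hu : OffLattice τ u) (l : ℤ) :
    FF (u + l * τ) v τ = e (l ^ 2 * τ + 2 * l * (u - v)) * FF u v τ := by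
  have := eq_e_mul_of_step (f := fun l => FF (u + l * τ) v τ)
    (φ := fun l => l ^ 2 * τ + 2 * l * (u - v)) (fun l => by
    have hu' : OffLattice τ (u + l * τ) := by
      have := (offLattice_add_iff τ u l 0).2 hu
      rwa [Int.cast_zero, add_zero] at this
    rw [show u + (l + 1 : ℤ) * (τ : ℂ) = u + l * τ + τ by push_cast; ring, FF_add_tau v hu']
    congr 2; push_cast; ring) l
  simpa using this

lemma FF_add_int_mul_tau_both (u v : ℂ) (τ : ℍ) (l : ℤ) :
    FF (u + l * τ) (v + l * τ) τ = e (-(2 * l * v) - l ^ 2 * τ) * FF u v τ := by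
  have := eq_e_mul_of_step (f := fun l => FF (u + l * τ) (v + l * τ) τ)
    (φ := fun l => -(2 * l * v) - l ^ 2 * τ) (fun l => by
    rw [show u + (l + 1 : ℤ) * (τ : ℂ) = u + l * τ + τ by push_cast; ring,
      show v + (l + 1 : ℤ) * (τ : ℂ) = v + l * τ + τ by push_cast; ring, FF_add_tau_both]
    congr 2; push_cast; ring) l
  simpa using this

lemma FF_add_lattice {u : ℂ} (v : ℂ) {τ : ℍ} (hu : OffLattice τ u) (m n : ℤ) :
    FF (u + (m * τ + n)) v τ = e (m ^ 2 * τ + 2 * m * (u - v)) * FF u v τ := by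
  rw [← add_assoc, FF_add_int, FF_add_int_mul_tau v hu]

/-! #### The antiholomorphic derivative of the completed double Appell sum -/

lemma sum_th_mul_hC (j : Fin 2) (u v : ℂ) (τ : ℍ) : ∑ i : Fin 2, th (i : ℕ) v τ * hC i j u v τ =
    gg j u v τ - 1 / 2 * Theta v τ * rr (j : ℕ) (u - v) τ := by
  simp only [hC, gg, Theta_eq, Fin.sum_univ_two]
  ring

/-- The derivatives of R₂ and of the R_{1,j} carry the same `rho`. Their coefficients Θ · `rr` and
`gg` combine to exactly the completed sums of `sum_th_mul_hC`, so differentiating the completion of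
depth two leaves completed objects of depth one. -/
theorem hasDbarAt_FF {u : ℂ} (v : ℂ) {τ : ℍ} (hu : OffLattice τ u) :
    HasDbarAt (fun u => FF u v τ) (-(3 * I / √(3 * τ.im)) *
      ∑ j : Fin 2, (∑ i : Fin 2, th (i : ℕ) v τ * hC i j u v τ) * rho (j : ℕ) (u - v) τ) u := by
  have hR1 : ∀ k : ℤ, HasDbarAt (fun u => rr k (3 * (u - v)) (triple τ))
      (3 * I / √(3 * τ.im) * rho k (u - v) τ) u := fun k => by
    have := HasDbarAt.comp_affine (f := fun w => rr k (3 * w) (triple τ)) (w := u) 1 (-v)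
      (hasDbarAt_R1 k τ _)
    simpa [← sub_eq_add_neg] using this
  have hR2 : HasDbarAt (fun u => R2Sym (u - v) τ)
      (-2 * ∑ j : Fin 2, 3 * I / √(3 * τ.im) * rho (j : ℕ) (u - v) τ * rr (j : ℕ) (u - v) τ) u := by
    have := HasDbarAt.comp_affine (f := fun w => R2Sym w τ) (w := u) 1 (-v)
      (hasDbarAt_R2Sym τ _)
    simpa only [one_mul, ← sub_eq_add_neg, map_one, mul_one] using this
  have h := (((differentiableAt_ff v hu).hasDbarAt.sub (hR2.const_mul (1 / 4 * Theta v τ))).sub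
    (HasDbarAt.holo_mul (differentiableAt_gg 0 v hu) (hR1 0))).sub
    (HasDbarAt.holo_mul (differentiableAt_gg 1 v hu) (hR1 1))
  refine h.congr ?_
  simp only [sum_th_mul_hC]
  simp only [Fin.sum_univ_two, Fin.val_zero, Fin.val_one, Nat.cast_zero, Nat.cast_one]
  ring

/-! #### The principal part at the origin -/

/-- The sum `∑_{n ≠ 0} e(3nv) q^{3n²} A₀(3nτ)`. -/
def pSum (v : ℂ) (τ : ℍ) : ℂ :=
  ∑' n : ℤ, if n = 0 then 0 else thTerm (3 * v) (triple τ) (2 * n) * A0 (n * triple τ)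

/-- The residue of the completed double Appell sum, up to normalization. -/
def pHat (v : ℂ) (τ : ℍ) : ℂ :=
  pSum v τ - 1 / 2 * ∑ j : Fin 2, th (j : ℕ) v τ * rr (j : ℕ) (-(3 * v)) (triple τ)

lemma tendsto_id_punctured : Tendsto (fun x : ℂ => x) (𝓝[≠] 0) (𝓝 0) :=
  tendsto_id.mono_left nhdsWithin_le_nhds

lemma tendsto_mul_of_continuousAt {f : ℂ → ℂ} (hf : ContinuousAt f 0) :
    Tendsto (fun u => u * f u) (𝓝[≠] 0) (𝓝 0) := by
  have := tendsto_id_punctured.mul (hf.tendsto.mono_left nhdsWithin_le_nhds)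
  rwa [zero_mul] at this

lemma continuousAt_A0_shift (τ : ℍ) {N : ℤ} (hN : N ≠ 0) :
    ContinuousAt (fun u => A0 (u + N * τ)) 0 :=
  ContinuousAt.comp (g := A 0) (f := fun u : ℂ => u + N * τ)
    (differentiableAt_A (e_int_mul_tau_ne_one τ hN)).continuousAt (by fun_prop)

lemma tendsto_A0_shift (τ : ℍ) {N : ℤ} (hN : N ≠ 0) :
    Tendsto (fun u => A0 (u + N * τ)) (𝓝[≠] 0) (𝓝 (A0 (N * τ))) := by
  have := (continuousAt_A0_shift τ hN).tendsto.mono_left (nhdsWithin_le_nhds (s := {0}ᶜ))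
  rwa [zero_add] at this

/-- The contribution of the zeros of `n1` to the residue. -/
def aTerm (v : ℂ) (τ : ℍ) (k : ℤ × ℤ) : ℂ :=
  if n1 k = 0 ∧ k ≠ 0 then ThetaTerm v τ k * A0 (n2 k * τ) else 0

lemma n1_n2_eq_zero {k : ℤ × ℤ} (h1 : n1 k = 0) (h2 : n2 k = 0) : k = 0 := by
  simp only [n1, n2] at h1 h2
  exact Prod.ext (by simp; omega) (by simp; omega)

lemma reflEquiv_eq_zero_iff (k : ℤ × ℤ) : reflEquiv k = 0 ↔ k = 0 := by
  constructor
  · intro h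
    apply n1_n2_eq_zero
    · rw [← n2_refl, h]; rfl
    · rw [← n1_refl, h]; rfl
  · rintro rfl; rfl

/-- The zeros of n₁ are the vectors (-n, 2n). On them the quadratic form is 3n² and n₂ = 3n, so the
sum lives at 3τ. -/
lemma tsum_aTerm (v : ℂ) (τ : ℍ) : ∑' k, aTerm v τ k = pSum v τ := by
  have hinj : Function.Injective fun n : ℤ => ((-n, 2 * n) : ℤ × ℤ) := fun a b h => by
    simpa using congrArg Prod.fst h
  rw [← hinj.tsum_eq]
  · refine tsum_congr fun n => ?_
    rw [aTerm]
    by_cases hn : n = 0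
    · rw [if_pos hn, if_neg (by simp [hn])]
    · rw [if_neg hn, if_pos ⟨by simp [n1], by simp [hn]⟩]
      congr 1
      · simp only [ThetaTerm, thTerm, ← e_add, coe_triple]
        congr 1
        push_cast; ring
      · simp only [n2, coe_triple]
        congr 1
        push_cast; ring
  · intro k hk
    rw [Function.mem_support, aTerm] at hk
    have h : n1 k = 0 := by
      by_contra h
      exact hk (if_neg fun h' => h h'.1)
    simp only [n1] at h
    exact ⟨-k.1, Prod.ext (by simp) (by simp; omega)⟩

lemma summable_aTerm (v : ℂ) (τ : ℍ) : Summable (aTerm v τ) := by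
  obtain ⟨C, hC, h⟩ := exists_bound_A τ 0
  refine Summable.of_norm_bounded ((summable_ThetaTerm v τ).norm.mul_right C) fun k => ?_
  rw [aTerm]
  split_ifs with hk
  · have hn : n2 k ≠ 0 := fun h2 => hk.2 (n1_n2_eq_zero hk.1 h2)
    have := h.self_of_nhds 0 (n2 k) (e_int_mul_tau_ne_one τ hn)
    rw [zero_add, A_zero] at this
    rw [norm_mul]
    gcongr
  · rw [norm_zero]; positivity

/-- The terms of `u ff(u) + 1/(4π²u)`. -/
def poleTerm (v : ℂ) (τ : ℍ) (k : ℤ × ℤ) (u : ℂ) : ℂ :=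
  u * fTerm u v τ k + if k = 0 then 1 / (4 * Real.pi ^ 2 * u) else 0

/-- Only k = 0 has a double pole, and it leaves no residue because A₀ is odd. A term with exactly
one vanishing root has a simple pole; all others are regular. -/
lemma tendsto_poleTerm (v : ℂ) (τ : ℍ) (k : ℤ × ℤ) :
    Tendsto (poleTerm v τ k) (𝓝[≠] 0)
      (𝓝 (I / (2 * Real.pi) * (aTerm v τ k + aTerm v τ (reflEquiv k)))) := by
  have hu : Tendsto (fun u => u * A0 u) (𝓝[≠] 0) (𝓝 (I / (2 * Real.pi))) := tendsto_mul_A 0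
  by_cases hk : k = 0
  · subst hk
    have h0 : aTerm v τ 0 = 0 := if_neg (by simp)
    rw [(reflEquiv_eq_zero_iff 0).2 rfl, h0, add_zero, mul_zero]
    refine tendsto_mul_A0_sq.congr fun u => ?_
    simp [poleTerm, fTerm, ThetaTerm, n1, n2, e_zero, pow_two]
  · have hk' : reflEquiv k ≠ 0 := fun h => hk ((reflEquiv_eq_zero_iff k).1 h)
    by_cases h1 : n1 k = 0
    · have h2 : n2 k ≠ 0 := fun h2 => hk (n1_n2_eq_zero h1 h2)
      have ha : aTerm v τ k = ThetaTerm v τ k * A0 (n2 k * τ) := if_pos ⟨h1, hk⟩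
      have hb : aTerm v τ (reflEquiv k) = 0 := if_neg (by rw [n1_refl]; tauto)
      rw [ha, hb, add_zero]
      have := (hu.mul (tendsto_A0_shift τ h2)).const_mul (ThetaTerm v τ k)
      rw [mul_left_comm] at this
      refine this.congr fun u => ?_
      rw [poleTerm, if_neg hk, fTerm, h1]
      push_cast
      ring_nf
    · by_cases h2 : n2 k = 0
      · have ha : aTerm v τ k = 0 := if_neg (by tauto)
        have hb : aTerm v τ (reflEquiv k) = ThetaTerm v τ k * A0 (n1 k * τ) := by
          rw [aTerm, if_pos ⟨by rw [n1_refl]; exact h2, hk'⟩, ThetaTerm_refl, n2_refl]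
        rw [ha, hb, zero_add]
        have := (hu.mul (tendsto_A0_shift τ h1)).const_mul (ThetaTerm v τ k)
        rw [mul_left_comm] at this
        refine this.congr fun u => ?_
        rw [poleTerm, if_neg hk, fTerm, h2]
        push_cast
        ring_nf
      · have ha : aTerm v τ k = 0 := if_neg (by tauto)
        have hb : aTerm v τ (reflEquiv k) = 0 := if_neg (by rw [n1_refl]; tauto)
        rw [ha, hb, add_zero, mul_zero]
        have := tendsto_mul_of_continuousAt (((continuousAt_A0_shift τ h1).mul
          (continuousAt_A0_shift τ h2)).const_mul (ThetaTerm v τ k))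
        refine this.congr fun u => ?_
        rw [poleTerm, if_neg hk, fTerm, add_zero]
        simp only [Pi.mul_apply]

end

/-! ### Residue of the double sum and constant term of the trace -/

section

open Set

lemma tsum_poleTerm {u : ℂ} (v : ℂ) {τ : ℍ} (hu : OffLattice τ u) :
    ∑' k, poleTerm v τ k u = u * ff u v τ + 1 / (4 * Real.pi ^ 2 * u) := by
  have h1 := (summable_fTerm v hu).hasSum.mul_left u
  have h2 := hasSum_ite_eq (0 : ℤ × ℤ) (1 / (4 * (Real.pi : ℂ) ^ 2 * u))
  have h3 := (h1.add h2).tsum_eq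
  simp only [poleTerm]
  rw [ff, ← h3]

lemma norm_poleTerm_le {u v : ℂ} {τ : ℍ} {C K : ℝ} (hC : 0 ≤ C) (hK : 0 ≤ K)
    (hA : ∀ N : ℤ, N ≠ 0 → ‖A0 (u + N * τ)‖ ≤ C) (hu : ‖u‖ ≤ 1) (huA : ‖u * A0 u‖ ≤ K)
    {k : ℤ × ℤ} (hk : k ≠ 0) :
    ‖poleTerm v τ k u‖ ≤ ‖ThetaTerm v τ k‖ * ((C + K) * (C + K)) := by
  rw [poleTerm, if_neg hk, add_zero, fTerm, mul_left_comm, norm_mul]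
  refine mul_le_mul_of_nonneg_left ?_ (norm_nonneg _)
  have h3 : ‖u * A0 u‖ ≤ C + K := by linarith
  have hA' : ∀ N : ℤ, N ≠ 0 → ‖A0 (u + N * τ)‖ ≤ C + K := fun N hN => by linarith [hA N hN]
  by_cases h1 : n1 k = 0
  · have h2 := hA' _ fun h2 => hk (n1_n2_eq_zero h1 h2)
    rw [h1, Int.cast_zero, zero_mul, add_zero, ← mul_assoc, norm_mul]
    exact mul_le_mul h3 h2 (norm_nonneg _) (by linarith)
  · have h5 := hA' _ h1
    by_cases h2 : n2 k = 0
    · rw [h2, Int.cast_zero, zero_mul, add_zero, mul_left_comm, norm_mul]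
      exact mul_le_mul h5 h3 (norm_nonneg _) (by linarith)
    · have h4 := hA' _ h2
      rw [← mul_assoc, norm_mul]
      refine mul_le_mul ?_ h4 (norm_nonneg _) (by linarith)
      rw [norm_mul]
      calc ‖u‖ * ‖A0 (u + n1 k * τ)‖ ≤ 1 * (C + K) :=
            mul_le_mul hu h5 (norm_nonneg _) zero_le_one
        _ = C + K := one_mul _

lemma tendsto_mul_ff (v : ℂ) (τ : ℍ) :
    Tendsto (fun u => u * ff u v τ + 1 / (4 * Real.pi ^ 2 * u)) (𝓝[≠] 0)
      (𝓝 (I / Real.pi * pSum v τ)) := by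
  obtain ⟨C, hC, h⟩ := exists_bound_A τ 0
  have hu : Tendsto (fun u => u * A0 u) (𝓝[≠] 0) (𝓝 (I / (2 * Real.pi))) := tendsto_mul_A 0
  -- The zeros of n₁ and those of n₂ contribute equally by the reflection, which doubles i/(2π).
  have hlim : ∑' k, I / (2 * Real.pi) * (aTerm v τ k + aTerm v τ (reflEquiv k)) =
      I / Real.pi * pSum v τ := by
    have h2 : Summable fun k => aTerm v τ (reflEquiv k) :=
      (summable_aTerm v τ).comp_injective reflEquiv.injective
    rw [tsum_mul_left, (summable_aTerm v τ).tsum_add h2, reflEquiv.tsum_eq (aTerm v τ), tsum_aTerm]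
    generalize pSum v τ = x
    ring
  rw [← hlim]
  refine Tendsto.congr' ((eventually_offLattice_zero τ).mono fun u hu => tsum_poleTerm v hu) ?_
  have hK0 : 0 ≤ ‖I / (2 * (Real.pi : ℂ))‖ + 1 := by positivity
  have hu1 := hu.norm.eventually (gt_mem_nhds (lt_add_one _))
  generalize ‖I / (2 * (Real.pi : ℂ))‖ + 1 = K at hK0 hu1
  have hsb : Summable fun k : ℤ × ℤ =>
      ‖ThetaTerm v τ k‖ * ((C + K) * (C + K)) + if k = 0 then 1 else 0 :=
    ((summable_ThetaTerm v τ).norm.mul_right _).add (hasSum_ite_eq (0 : ℤ × ℤ) (1 : ℝ)).summable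
  have hz : ∀ᶠ u in 𝓝[≠] (0 : ℂ), ‖poleTerm v τ 0 u‖ < 1 := by
    refine (tendsto_poleTerm v τ 0).norm.eventually (gt_mem_nhds ?_)
    have h0 : aTerm v τ 0 = 0 := if_neg (by simp)
    rw [(reflEquiv_eq_zero_iff 0).2 rfl, h0]
    simp
  have hball : Metric.ball (0 : ℂ) 1 ∈ 𝓝 (0 : ℂ) := Metric.ball_mem_nhds _ one_pos
  refine tendsto_tsum_of_dominated_convergence hsb (tendsto_poleTerm v τ) ?_
  filter_upwards [mem_nhdsWithin_of_mem_nhds h, mem_nhdsWithin_of_mem_nhds hball, hu1, hz]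
    with u hu hub huA huz k
  rw [mem_ball_zero_iff] at hub
  have hA : ∀ N : ℤ, N ≠ 0 → ‖A0 (u + N * τ)‖ ≤ C := fun N hN =>
    hu 0 N (e_int_mul_tau_ne_one τ hN)
  by_cases hk : k = 0
  · subst hk
    rw [if_pos rfl]
    have : 0 ≤ ‖ThetaTerm v τ 0‖ * ((C + K) * (C + K)) :=
      mul_nonneg (norm_nonneg _) (mul_self_nonneg _)
    linarith
  · rw [if_neg hk, add_zero]
    exact norm_poleTerm_le hC.le hK0 hA hub.le huA.le hk

/-- `u F(u) + 1/(4π²u)` tends to the residue `(i/π) pHat`. -/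
theorem tendsto_mul_FF (v : ℂ) (τ : ℍ) :
    Tendsto (fun u => u * FF u v τ + 1 / (4 * Real.pi ^ 2 * u)) (𝓝[≠] 0)
      (𝓝 (I / Real.pi * pHat v τ)) := by
  have hg : ∀ j : Fin 2, Tendsto (fun u => u * gg j u v τ) (𝓝[≠] 0)
      (𝓝 (th (j : ℕ) v τ * (I / (2 * Real.pi)))) := by
    intro j
    have h0 := tendsto_mul_hh_even j v τ
    have h1 := tendsto_mul_hh_odd j v τ
    fin_cases j
    · have := (h0.const_mul (th 0 v τ)).add (h1.const_mul (th 1 v τ))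
      rw [mul_zero, add_zero] at this
      refine this.congr fun u => ?_
      simp [gg, Fin.sum_univ_two]
      ring
    · have := (h1.const_mul (th 0 v τ)).add (h0.const_mul (th 1 v τ))
      rw [mul_zero, zero_add] at this
      refine this.congr fun u => ?_
      have h2 := hh_add_two 0 1 u v τ
      rw [zero_add] at h2
      simp [gg, Fin.sum_univ_two, one_add_one_eq_two, h2]
      ring
  have hr : ∀ k : ℤ, Tendsto (fun u => rr k (3 * (u - v)) (triple τ)) (𝓝[≠] 0)
      (𝓝 (rr k (-(3 * v)) (triple τ))) := by
    intro k
    have : Continuous fun u => rr k (3 * (u - v)) (triple τ) :=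
      (continuous_rr k (triple τ)).comp (by fun_prop : Continuous fun u : ℂ => 3 * (u - v))
    have := (this.tendsto 0).mono_left (nhdsWithin_le_nhds (s := {0}ᶜ))
    rwa [zero_sub, mul_neg] at this
  have hR2 : Tendsto (fun u => u * R2Sym (u - v) τ) (𝓝[≠] 0) (𝓝 0) := by
    refine tendsto_mul_of_continuousAt ?_
    exact ContinuousAt.comp (g := fun w => R2Sym w τ) (f := fun u : ℂ => u - v)
      (hasDbarAt_R2Sym τ _).continuousAt (by fun_prop)
  have h := (((tendsto_mul_ff v τ).sub (hR2.const_mul (1 / 4 * Theta v τ))).sub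
    ((hg 0).mul (hr 0))).sub ((hg 1).mul (hr 1))
  have hval : I / Real.pi * pHat v τ = I / Real.pi * pSum v τ - 1 / 4 * Theta v τ * 0
      - th ((0 : Fin 2) : ℕ) v τ * (I / (2 * Real.pi)) * rr 0 (-(3 * v)) (triple τ)
      - th ((1 : Fin 2) : ℕ) v τ * (I / (2 * Real.pi)) * rr 1 (-(3 * v)) (triple τ) := by
    rw [pHat]
    simp only [Fin.sum_univ_two, Fin.val_zero, Fin.val_one, Nat.cast_zero, Nat.cast_one]
    ring
  rw [hval]
  refine h.congr fun u => ?_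
  rw [FF]
  ring

/-! #### The trace of the completed Appell sums -/

/-- The terms of `hh 0 0 + hh 0 1 - i/(πu)`. -/
def traceTerm (v : ℂ) (τ : ℍ) (n : ℤ) (u : ℂ) : ℂ :=
  thTerm v τ (2 * n) * A0 (u / 2 + n * τ) - if n = 0 then I / (Real.pi * u) else 0

lemma tsum_traceTerm {u : ℂ} (v : ℂ) {τ : ℍ} (hu : OffLattice τ u) :
    ∑' n, traceTerm v τ n u = hh 0 0 u v τ + hh 0 1 u v τ - I / (Real.pi * u) := by
  have h0 := summable_hTerm_parity 0 0 v hu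
  have h1 := summable_hTerm_parity 0 1 v hu
  have h2 := hasSum_ite_eq (0 : ℤ) (I / (Real.pi * u))
  have h3 := ((h0.hasSum.add h1.hasSum).sub h2).tsum_eq
  rw [hh, hh, ← h3]
  refine tsum_congr fun n => ?_
  have h4 := A0_add_A1 (hu.e_ne_one (2 * n))
  rw [traceTerm, hTerm, hTerm, A_zero, A_one, ← mul_add, add_zero, h4]
  congr 3
  push_cast; ring

lemma tendsto_half : Tendsto (fun u : ℂ => u / 2) (𝓝[≠] 0) (𝓝[≠] 0) := by
  refine tendsto_nhdsWithin_iff.2 ⟨?_, ?_⟩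
  · have : Continuous fun u : ℂ => u / 2 := by fun_prop
    have := (this.tendsto 0).mono_left (nhdsWithin_le_nhds (s := {0}ᶜ))
    rwa [zero_div] at this
  · filter_upwards [self_mem_nhdsWithin] with u hu
    exact div_ne_zero hu two_ne_zero

lemma tendsto_traceTerm (v : ℂ) (τ : ℍ) (n : ℤ) : Tendsto (traceTerm v τ n) (𝓝[≠] 0)
    (𝓝 (if n = 0 then 0 else thTerm v τ (2 * n) * A0 (n * τ))) := by
  by_cases hn : n = 0
  · subst hn
    rw [if_pos rfl]
    refine (tendsto_A0_sub.comp tendsto_half).congr fun u => ?_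
    have h2 : I / (2 * (Real.pi : ℂ) * (u / 2)) = I / (Real.pi * u) := by congr 1; ring
    simp [traceTerm, thTerm, e_zero, h2]
  · rw [if_neg hn]
    refine (((tendsto_A0_shift τ hn).comp tendsto_half).const_mul _).congr fun u => ?_
    rw [traceTerm, if_neg hn, sub_zero, Function.comp_apply]

/-- By `A0_add_A1` the sum of the diagonal entries is a single sum of A₀(u/2 + nτ). Its polar term n
= 0 has no constant term, and at (3v, 3τ) the remaining limit is `pSum`. -/
lemma tendsto_hh_trace (v : ℂ) (τ : ℍ) :
    Tendsto (fun u => hh 0 0 u v τ + hh 0 1 u v τ - I / (Real.pi * u)) (𝓝[≠] 0)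
      (𝓝 (∑' n : ℤ, if n = 0 then 0 else thTerm v τ (2 * n) * A0 (n * τ))) := by
  obtain ⟨C, hC, h⟩ := exists_bound_A τ 0
  refine Tendsto.congr' ((eventually_offLattice_zero τ).mono fun u hu => tsum_traceTerm v hu) ?_
  have hsb : Summable fun n : ℤ => ‖thTerm v τ (2 * n)‖ * C + if n = 0 then 1 else 0 := by
    have h0 := (summable_norm_thTerm v τ).comp_injective (injective_two_mul_add 0)
    simp only [Function.comp_def, add_zero] at h0
    exact (h0.mul_right _).add (hasSum_ite_eq (0 : ℤ) (1 : ℝ)).summable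
  have hz : ∀ᶠ u in 𝓝[≠] (0 : ℂ), ‖traceTerm v τ 0 u‖ < 1 := by
    refine (tendsto_traceTerm v τ 0).norm.eventually (gt_mem_nhds ?_)
    simp
  have hb := tendsto_half.eventually (mem_nhdsWithin_of_mem_nhds h)
  refine tendsto_tsum_of_dominated_convergence hsb (tendsto_traceTerm v τ) ?_
  filter_upwards [hb, hz] with u hu huz n
  by_cases hn : n = 0
  · subst hn
    rw [if_pos rfl]
    have : 0 ≤ ‖thTerm v τ (2 * 0)‖ * C := mul_nonneg (norm_nonneg _) hC.le
    linarith
  · rw [traceTerm, if_neg hn, if_neg hn, sub_zero, add_zero, norm_mul]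
    exact mul_le_mul_of_nonneg_left (hu 0 n (e_int_mul_tau_ne_one τ hn)) (norm_nonneg _)

/-- The trace of the completed Appell sums at `3τ` has residue `i/π` and constant term `pHat`. -/
theorem tendsto_trace (v : ℂ) (τ : ℍ) :
    Tendsto (fun u => (hM u (3 * v) (triple τ)).trace - I / (Real.pi * u)) (𝓝[≠] 0)
      (𝓝 (pHat v τ)) := by
  have hr : ∀ k : ℤ, Tendsto (fun u => rr k (u - 3 * v) (triple τ)) (𝓝[≠] 0)
      (𝓝 (rr k (-(3 * v)) (triple τ))) := by
    intro k
    have : Continuous fun u => rr k (u - 3 * v) (triple τ) :=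
      (continuous_rr k (triple τ)).comp (by fun_prop : Continuous fun u : ℂ => u - 3 * v)
    have := (this.tendsto 0).mono_left (nhdsWithin_le_nhds (s := {0}ᶜ))
    rwa [zero_sub] at this
  have h := ((tendsto_hh_trace (3 * v) (triple τ)).sub ((hr 0).const_mul (1 / 2 * th 0 v τ))).sub
    ((hr 1).const_mul (1 / 2 * th 1 v τ))
  have hval : pHat v τ = pSum v τ - 1 / 2 * th 0 v τ * rr 0 (-(3 * v)) (triple τ)
      - 1 / 2 * th 1 v τ * rr 1 (-(3 * v)) (triple τ) := by
    rw [pHat]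
    simp only [Fin.sum_univ_two, Fin.val_zero, Fin.val_one, Nat.cast_zero, Nat.cast_one]
    ring
  rw [hval]
  refine h.congr fun u => ?_
  have h2 := hh_add_two 0 1 u (3 * v) (triple τ)
  rw [zero_add] at h2
  simp [Matrix.trace_fin_two, hM, hC, th, one_add_one_eq_two, h2]
  ring

end

section

open Set Matrix

/-! #### The modular transformation of the residue -/

lemma tendsto_slope_e (α β : ℂ) :
    Tendsto (fun u => (e (α * u + β * u ^ 2) - 1) / u) (𝓝[≠] 0) (𝓝 (2 * Real.pi * I * α)) := by
  have h1 : HasDerivAt (fun u : ℂ => α * u + β * u ^ 2) α 0 := by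
    have := ((hasDerivAt_id (0 : ℂ)).const_mul α).add ((hasDerivAt_pow 2 (0 : ℂ)).const_mul β)
    refine this.congr_deriv ?_
    simp
  have h2 : HasDerivAt (fun u : ℂ => e (α * u + β * u ^ 2)) (2 * Real.pi * I * α) 0 := by
    have := (hasDerivAt_e (α * 0 + β * 0 ^ 2)).comp (0 : ℂ) h1
    simpa [e_zero, Function.comp_def] using this
  refine h2.tendsto_slope.congr fun u => ?_
  simp [slope_def_field, e_zero]

lemma tendsto_div_const {j : ℂ} (hj : j ≠ 0) : Tendsto (fun u : ℂ => u / j) (𝓝[≠] 0) (𝓝[≠] 0) := by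
  refine tendsto_nhdsWithin_iff.2 ⟨?_, ?_⟩
  · have : Continuous fun u : ℂ => u / j := by fun_prop
    have := (this.tendsto 0).mono_left (nhdsWithin_le_nhds (s := {0}ᶜ))
    rwa [zero_div] at this
  · filter_upwards [self_mem_nhdsWithin] with u hu
    exact div_ne_zero hu hj

lemma tendsto_e_quadratic (α β : ℂ) :
    Tendsto (fun u => e (α * u + β * u ^ 2)) (𝓝[≠] 0) (𝓝 1) := by
  have : Continuous fun u => e (α * u + β * u ^ 2) :=
    differentiable_e.continuous.comp (by fun_prop)
  have := (this.tendsto 0).mono_left (nhdsWithin_le_nhds (s := {0}ᶜ))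
  simpa [e_zero] using this

lemma IsModular.conjTranspose_mul_self {s j : ℂ} {τ τ' : ℍ} {M : Matrix (Fin 2) (Fin 2) ℂ}
    (h : IsModular s j τ τ' M) : Mᴴ * M = (‖j‖ : ℂ) • (1 : Matrix (Fin 2) (Fin 2) ℂ) := by
  have hj : (‖j‖ : ℂ) ≠ 0 := by exact_mod_cast norm_ne_zero_iff.2 h.ne_zero
  have h1 : M * ((‖j‖ : ℂ)⁻¹ • Mᴴ) = 1 := by
    rw [Matrix.mul_smul, h.unitary, smul_smul, inv_mul_cancel₀ hj, one_smul]
  have h2 := mul_eq_one_comm.1 h1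
  rw [Matrix.smul_mul] at h2
  rw [← h2, smul_smul, mul_inv_cancel₀ hj, one_smul]

/-- Under the trace, conjugation by M reduces to the scalar MᴴM = ‖j‖. This isolates a scalar
depth-one function whose expansion contains `pHat`. -/
lemma IsModular.trace {s j : ℂ} {τ τ' : ℍ} {M : Matrix (Fin 2) (Fin 2) ℂ}
    (h : IsModular s j τ τ' M) {u : ℂ} (v : ℂ) (hu : OffLattice τ u) :
    (AppellLerch.hM (u / j) (v / j) τ').trace =
      j * e (s * (2 * u * v - u ^ 2) / 4) * (AppellLerch.hM u v τ).trace := by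
  have hj : (‖j‖ : ℂ) ≠ 0 := by exact_mod_cast norm_ne_zero_iff.2 h.ne_zero
  rw [h.hM u v hu, Matrix.trace_smul, Matrix.trace_mul_comm, ← Matrix.mul_assoc,
    h.conjTranspose_mul_self, Matrix.smul_mul, Matrix.one_mul, Matrix.trace_smul, smul_eq_mul,
    smul_eq_mul]
  field_simp

/-- The residue transforms as a quasi-Jacobi form of weight one. -/
lemma pHat_modular {s j : ℂ} {τ τ' : ℍ} {N : Matrix (Fin 2) (Fin 2) ℂ}
    (h : IsModular (s / 3) j (triple τ) (triple τ') N) (v : ℂ) :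
    pHat (v / j) τ' = j * pHat v τ - j * s * v := by
  have hj := h.ne_zero
  have hπ : (Real.pi : ℂ) ≠ 0 := by simp [Real.pi_ne_zero]
  have h1 := (tendsto_trace (v / j) τ').comp (tendsto_div_const hj)
  -- The linear term of the exponential automorphy factor meets the pole i/(πu) and yields the
  -- anomaly -jsv.
  have h2 := ((((tendsto_e_quadratic (s * v / 2) (-(s / 12))).mul (tendsto_trace v τ)).const_mul j)).add
    ((tendsto_slope_e (s * v / 2) (-(s / 12))).const_mul (j * I / Real.pi))
  have hval : j * (1 * pHat v τ) + j * I / Real.pi * (2 * Real.pi * I * (s * v / 2)) =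
      j * pHat v τ - j * s * v := by
    field_simp
    rw [I_sq]
    ring
  rw [← hval]
  refine tendsto_nhds_unique h1 (h2.congr' ?_)
  filter_upwards [eventually_offLattice_zero (triple τ), self_mem_nhdsWithin] with u hu hu0
  have hu0 : u ≠ 0 := hu0
  have h3 := h.trace (3 * v) hu
  rw [Function.comp_apply, show 3 * (v / j) = 3 * v / j by ring, h3,
    show s / 3 * (2 * u * (3 * v) - u ^ 2) / 4 = s * v / 2 * u + -(s / 12) * u ^ 2 by ring]
  generalize (hM u (3 * v) (triple τ)).trace = t
  generalize e (s * v / 2 * u + -(s / 12) * u ^ 2) = x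
  field_simp
  ring

/-! #### The modular transformation of the cubic theta function -/

lemma Theta_eq_dotProduct (v : ℂ) (τ : ℍ) :
    Theta v τ = etaV (3 * v) (triple τ) ⬝ᵥ etaV v τ := by
  rw [Theta_eq]
  rfl

/-- Θ is the dot product of the theta vectors at 3τ and τ, and NᵀM is the scalar χj. -/
lemma Theta_modular {s j χ : ℂ} {τ τ' : ℍ} (h : IsLevelThree s j χ τ τ') (v : ℂ) :
    Theta (v / j) τ' = χ * j * e (s * v ^ 2) * Theta v τ := by
  obtain ⟨M, N, hM, hN, hNM⟩ := h
  rw [Theta_eq_dotProduct, Theta_eq_dotProduct, hM.eta, show 3 * (v / j) = 3 * v / j by ring, hN.eta,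
    smul_dotProduct, dotProduct_smul, ← vecMul_transpose, ← dotProduct_mulVec, mulVec_mulVec, hNM,
    smul_mulVec, one_mulVec, dotProduct_smul]
  have he : e (s * v ^ 2) = e (s / 3 * (3 * v) ^ 2 / 4) * e (s * v ^ 2 / 4) := by
    rw [← e_add]; congr 1; ring
  simp only [smul_eq_mul]
  rw [he]
  ring

/-! #### The modular transformation of the antiholomorphic derivative -/

/-- The vector of antiholomorphic derivatives of the `R₁`. -/
def rhoV (w : ℂ) (τ : ℍ) : Fin 2 → ℂ := fun j => rho (j : ℕ) w τ

lemma sum_th_hC_rho (u v : ℂ) (τ : ℍ) :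
    ∑ j : Fin 2, (∑ i : Fin 2, th (i : ℕ) v τ * hC i j u v τ) * rho (j : ℕ) (u - v) τ =
      etaV (3 * v) (triple τ) ⬝ᵥ (hM u v τ).mulVec (rhoV (u - v) τ) := by
  rw [dotProduct_mulVec]
  rfl

lemma rhoV_modular {s j : ℂ} {τ τ' : ℍ} {N : Matrix (Fin 2) (Fin 2) ℂ}
    (h : IsModular (s / 3) j (triple τ) (triple τ') N) (w : ℂ) :
    rhoV (w / j) τ' = e (-(3 * s * w ^ 2 / 4)) • (Nᴴᵀ).mulVec (rhoV w τ) := by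
  have heta := h.eta (3 * w)
  have hg := h.gaussian (3 * w)
  have hexp : (Real.exp (-(Real.pi * (3 * w / j).im ^ 2 / (triple τ').im)) : ℂ) *
      (starRingEnd ℂ) (e (s / 3 * (3 * w) ^ 2 / 4)) =
      e (-(3 * s * w ^ 2 / 4)) * Real.exp (-(Real.pi * (3 * w).im ^ 2 / (triple τ).im)) := by
    have hx : s / 3 * (3 * w) ^ 2 / 4 = 3 * s * w ^ 2 / 4 := by ring
    have hne := e_ne_zero (3 * s * w ^ 2 / 4)
    rw [hx]
    refine mul_left_cancel₀ hne ?_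
    rw [mul_left_comm, e_mul_conj_e, ← mul_assoc, ← e_add, add_neg_cancel, e_zero, one_mul,
      ← ofReal_mul, ← Real.exp_add]
    congr 2
    have h4 : (s / 3 * (3 * w) ^ 2).im = 4 * (3 * s * w ^ 2 / 4).im := by
      rw [show s / 3 * (3 * w) ^ 2 = (4 : ℝ) * (3 * s * w ^ 2 / 4) by push_cast; ring, im_ofReal_mul]
    rw [mul_div_assoc Real.pi, mul_div_assoc Real.pi, ← hg, h4]
    ring
  funext i
  have hi := congrFun heta i
  have h5 : eta (i : ℕ) (3 * w / j) (triple τ') = e (s / 3 * (3 * w) ^ 2 / 4) *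
      N.mulVec (etaV (3 * w) (triple τ)) i := hi
  have h6 : (starRingEnd ℂ) (N.mulVec (etaV (3 * w) (triple τ)) i) =
      ∑ k : Fin 2, (starRingEnd ℂ) (N i k) * (starRingEnd ℂ) (eta (k : ℕ) (3 * w) (triple τ)) := by
    simp [mulVec, dotProduct, etaV]
  rw [rhoV, rho, show 3 * (w / j) = 3 * w / j by ring, h5, map_mul, ← mul_assoc, hexp, h6]
  simp only [Pi.smul_apply, smul_eq_mul, mulVec, dotProduct, rhoV, rho, transpose_apply,
    conjTranspose_apply, Complex.star_def, Finset.mul_sum]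
  refine Finset.sum_congr rfl fun k _ => ?_
  ring

/-- The relation NᵀM = χj is used on the left, and its conjugate transpose on the right. Together
they give |χj|² = ‖j‖², to be combined with the factor j/‖j‖ of `hM`. -/
lemma IsLevelThree.bilinear {s j χ : ℂ} {τ τ' : ℍ} (h : IsLevelThree s j χ τ τ') (hχ : ‖χ‖ = 1)
    {u : ℂ} (v : ℂ) (hu : OffLattice τ u) :
    etaV (3 * (v / j)) (triple τ') ⬝ᵥ (hM (u / j) (v / j) τ').mulVec (rhoV (u / j - v / j) τ') =
      j * ‖j‖ * e (s * (2 * u * v - u ^ 2)) *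
        (etaV (3 * v) (triple τ) ⬝ᵥ (hM u v τ).mulVec (rhoV (u - v) τ)) := by
  obtain ⟨M, N, hM, hN, hNM⟩ := h
  have hj : (‖j‖ : ℂ) ≠ 0 := by exact_mod_cast norm_ne_zero_iff.2 hM.ne_zero
  have h2 : Mᴴ * Nᴴᵀ = (starRingEnd ℂ (χ * j)) • (1 : Matrix (Fin 2) (Fin 2) ℂ) := by
    have := congrArg conjTranspose hNM
    rw [conjTranspose_mul, conjTranspose_smul, conjTranspose_one] at this
    exact this
  have h3 : χ * j * (starRingEnd ℂ) (χ * j) = ‖j‖ ^ 2 := by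
    rw [mul_conj, normSq_eq_norm_sq, norm_mul, hχ, one_mul]
    push_cast; rfl
  rw [← sub_div, rhoV_modular hN, hM.hM u v hu, show 3 * (v / j) = 3 * v / j by ring, hN.eta,
    smul_dotProduct, mulVec_smul, dotProduct_smul, smul_mulVec, dotProduct_smul,
    ← vecMul_transpose, ← dotProduct_mulVec, mulVec_mulVec, mulVec_mulVec]
  have h4 : Nᵀ * (M * AppellLerch.hM u v τ * Mᴴ) * Nᴴᵀ =
      (χ * j * (starRingEnd ℂ) (χ * j)) • AppellLerch.hM u v τ := by
    rw [← Matrix.mul_assoc, Matrix.mul_assoc _ Mᴴ, h2, ← Matrix.mul_assoc, hNM]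
    simp [smul_smul, mul_comm]
  rw [h4, h3, smul_mulVec, dotProduct_smul]
  have he : e (s * (2 * u * v - u ^ 2)) = e (s / 3 * (3 * v) ^ 2 / 4) *
      e (-(3 * s * (u - v) ^ 2 / 4)) * e (s * (2 * u * v - u ^ 2) / 4) := by
    rw [← e_add, ← e_add]; congr 1; ring
  simp only [smul_eq_mul]
  rw [he]
  generalize e (s / 3 * (3 * v) ^ 2 / 4) = x
  generalize e (-(3 * s * (u - v) ^ 2 / 4)) = y
  generalize e (s * (2 * u * v - u ^ 2) / 4) = z
  field_simp

end

section

open Set Matrix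

/-! ### The modular transformation of the completed double Appell sum -/

/-- The defect of the modular transformation law of `FF`. -/
def defect (s j v : ℂ) (τ τ' : ℍ) (u : ℂ) : ℂ :=
  e (-(2 * s * v) * u + s * u ^ 2) * FF (u / j) (v / j) τ' - j ^ 2 * FF u v τ

lemma differentiableAt_defect {s j χ : ℂ} {τ τ' : ℍ} (h : IsLevelThree s j χ τ τ') (hχ : ‖χ‖ = 1)
    {u : ℂ} (v : ℂ) (hu : OffLattice τ u) : DifferentiableAt ℂ (defect s j v τ τ') u := by
  have hbil := h.bilinear hχ v hu
  obtain ⟨M, N, hM, hN, -⟩ := h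
  have hj := hM.ne_zero
  have hj' : (‖j‖ : ℂ) ≠ 0 := by exact_mod_cast norm_ne_zero_iff.2 hj
  have hcj : (starRingEnd ℂ) j ≠ 0 := (map_ne_zero _).2 hj
  have h1 := hasDbarAt_FF (v / j) (hM.offLattice u hu)
  have h2 := HasDbarAt.comp_affine (f := fun u => FF u (v / j) τ') (w := u) j⁻¹ 0
    (by rw [add_zero, inv_mul_eq_div]; exact h1)
  simp only [add_zero, inv_mul_eq_div] at h2
  have h3 : DifferentiableAt ℂ (fun u => e (-(2 * s * v) * u + s * u ^ 2)) u :=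
    (differentiable_e _).comp u (by fun_prop)
  have h4 := (HasDbarAt.holo_mul h3 h2).sub ((hasDbarAt_FF v hu).const_mul (j ^ 2))
  refine (h4.congr ?_).differentiableAt
  rw [sum_th_hC_rho, sum_th_hC_rho, hbil]
  -- Weight count: the pairing gives j‖j‖, the normalization 1/√(3 Im τ') gives another ‖j‖, and the
  -- chain rule divides by the conjugate of j. The total is j².
  have hs : √(3 * τ.im) = √(3 * τ'.im) * ‖j‖ := by
    rw [← hM.im, ← mul_assoc, Real.sqrt_mul' _ (by positivity), Real.sqrt_sq (norm_nonneg j)]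
  have hs' : (√(3 * τ'.im) : ℂ) ≠ 0 := by
    have := τ'.im_pos
    exact_mod_cast (Real.sqrt_pos.2 (by positivity)).ne'
  have hn : (‖j‖ : ℂ) ^ 2 = j * (starRingEnd ℂ) j := by
    rw [mul_conj, normSq_eq_norm_sq]; push_cast; rfl
  have he : e (-(2 * s * v) * u + s * u ^ 2) * e (s * (2 * u * v - u ^ 2)) = 1 := by
    rw [← e_add, ← e_zero]; congr 1; ring
  rw [hs, map_inv₀]
  push_cast
  generalize etaV (3 * v) (triple τ) ⬝ᵥ (AppellLerch.hM u v τ).mulVec (rhoV (u - v) τ) = B at *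
  generalize e (-(2 * s * v) * u + s * u ^ 2) = x at *
  generalize e (s * (2 * u * v - u ^ 2)) = y at *
  generalize (starRingEnd ℂ) j = c at *
  generalize (‖j‖ : ℂ) = n at *
  generalize (√(3 * τ'.im) : ℂ) = r at *
  field_simp
  linear_combination (-3 * I * j * B * n ^ 2) * he + (-3 * I * j * B) * hn

/-- The double poles cancel. The linear term of the exponential factor turns -1/(4π²u²) into a
simple pole, which is removed by the anomaly of `pHat_modular`. -/
lemma tendsto_mul_defect {s j χ : ℂ} {τ τ' : ℍ} (h : IsLevelThree s j χ τ τ') (v : ℂ) :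
    Tendsto (fun u => u * defect s j v τ τ' u) (𝓝[≠] 0) (𝓝 0) := by
  obtain ⟨M, N, hM, hN, -⟩ := h
  have hj := hM.ne_zero
  have hπ : (Real.pi : ℂ) ≠ 0 := by simp [Real.pi_ne_zero]
  have h1 := (tendsto_mul_FF (v / j) τ').comp (tendsto_div_const hj)
  have h2 := tendsto_mul_FF v τ
  have h3 := ((((tendsto_e_quadratic (-(2 * s * v)) s).mul h1).const_mul j).sub
    (h2.const_mul (j ^ 2))).sub
      ((tendsto_slope_e (-(2 * s * v)) s).const_mul (j ^ 2 / (4 * Real.pi ^ 2)))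
  rw [pHat_modular hN] at h3
  have hval : j * (1 * (I / Real.pi * (j * pHat v τ - j * s * v))) - j ^ 2 * (I / Real.pi * pHat v τ)
      - j ^ 2 / (4 * Real.pi ^ 2) * (2 * Real.pi * I * -(2 * s * v)) = 0 := by
    field_simp
    ring
  rw [hval] at h3
  refine h3.congr' ?_
  filter_upwards [self_mem_nhdsWithin] with u hu0
  have hu0 : u ≠ 0 := hu0
  rw [defect, Function.comp_apply]
  generalize e (-(2 * s * v) * u + s * u ^ 2) = x
  field_simp
  ring

lemma legendreSym_sq_of_mem {γ : SpecialLinearGroup (Fin 2) ℤ}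
    (hγ : γ ∈ CongruenceSubgroup.Gamma0 3) : (legendreSym 3 (γ 1 1) : ℂ) ^ 2 = 1 := by
  have h3 : (3 : ℤ) ∣ γ 1 0 := by
    rw [CongruenceSubgroup.Gamma0_mem] at hγ
    exact (ZMod.intCast_zmod_eq_zero_iff_dvd _ 3).1 hγ
  have hd : ((γ 1 1 : ℤ) : ZMod 3) ≠ 0 := by
    intro h
    obtain ⟨k, hk⟩ := (ZMod.intCast_zmod_eq_zero_iff_dvd _ 3).1 h
    obtain ⟨l, hl⟩ := h3
    have hdet := SL_det γ
    rw [hk, hl] at hdet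
    push_cast at hdet
    have : 3 * (γ 0 0 * k - γ 0 1 * l) = 1 := by linarith
    omega
  exact_mod_cast legendreSym.sq_one 3 hd

lemma defect_add_one {γ : SpecialLinearGroup (Fin 2) ℤ} (hγ : γ ∈ CongruenceSubgroup.Gamma0 3)
    {u : ℂ} (v : ℂ) {τ : ℍ} (hu : OffLattice τ u) :
    defect (γ 1 0 / (γ 1 0 * τ + γ 1 1)) (γ 1 0 * τ + γ 1 1) v τ (γ • τ) (u + 1) =
      defect (γ 1 0 / (γ 1 0 * τ + γ 1 1)) (γ 1 0 * τ + γ 1 1) v τ (γ • τ) u := by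
  obtain ⟨M, N, hM, -, -⟩ := isJacobi_of_mem γ hγ τ
  have hτ' := coe_SL_smul γ τ
  have hdet : (γ 0 0 * γ 1 1 - γ 0 1 * γ 1 0 : ℂ) = 1 := by exact_mod_cast SL_det γ
  have hu' := hM.offLattice u hu
  have hj := hM.ne_zero
  set τ' := γ • τ
  set j : ℂ := γ 1 0 * τ + γ 1 1 with hjdef
  -- By det γ = 1 the period 1, divided by j, is a lattice vector for τ'. The elliptic law of `FF`
  -- applies, and the integer left in the exponent is invisible to e.
  have hinv : (1 : ℂ) / j = (-γ 1 0 : ℤ) * τ' + γ 0 0 := by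
    rw [hτ']; field_simp; push_cast; rw [hjdef]; linear_combination -hdet
  rw [defect, defect, FF_add_one, add_div, hinv, FF_add_lattice _ hu', ← mul_assoc, ← e_add]
  congr 2
  rw [show -(2 * (γ 1 0 / j) * v) * (u + 1) + γ 1 0 / j * (u + 1) ^ 2 +
    (((-γ 1 0 : ℤ) : ℂ) ^ 2 * τ' + 2 * (-γ 1 0 : ℤ) * (u / j - v / j)) =
    -(2 * (γ 1 0 / j) * v) * u + γ 1 0 / j * u ^ 2 + (γ 1 0 * γ 0 0 : ℤ) by
      push_cast at hinv ⊢
      linear_combination (γ 1 0 : ℂ) * hinv, e_add, e_int, mul_one]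

lemma defect_add_tau {γ : SpecialLinearGroup (Fin 2) ℤ} (hγ : γ ∈ CongruenceSubgroup.Gamma0 3)
    {u : ℂ} (v : ℂ) {τ : ℍ} (hu : OffLattice τ u) :
    defect (γ 1 0 / (γ 1 0 * τ + γ 1 1)) (γ 1 0 * τ + γ 1 1) v τ (γ • τ) (u + τ) =
      e (2 * (u - v) + τ) *
        defect (γ 1 0 / (γ 1 0 * τ + γ 1 1)) (γ 1 0 * τ + γ 1 1) v τ (γ • τ) u := by
  obtain ⟨M, N, hM, -, -⟩ := isJacobi_of_mem γ hγ τ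
  have hτ' := coe_SL_smul γ τ
  have hdet : (γ 0 0 * γ 1 1 - γ 0 1 * γ 1 0 : ℂ) = 1 := by exact_mod_cast SL_det γ
  have hu' := hM.offLattice u hu
  have hj := hM.ne_zero
  set τ' := γ • τ
  set j : ℂ := γ 1 0 * τ + γ 1 1 with hjdef
  have hinv : (τ : ℂ) / j = (γ 1 1 : ℤ) * τ' + (-γ 0 1 : ℤ) := by
    rw [hτ']; field_simp; push_cast; rw [hjdef]; linear_combination -(τ : ℂ) * hdet
  have hone : (γ 1 0 * τ + γ 1 1 : ℂ) / j = 1 := div_self hj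
  rw [defect, defect, FF_add_tau v hu, add_div, hinv, FF_add_lattice _ hu', ← mul_assoc, ← e_add,
    show -(2 * (γ 1 0 / j) * v) * (u + τ) + γ 1 0 / j * (u + τ) ^ 2 +
    ((γ 1 1 : ℂ) ^ 2 * τ' + 2 * γ 1 1 * (u / j - v / j)) =
    -(2 * (γ 1 0 / j) * v) * u + γ 1 0 / j * u ^ 2 + (2 * (u - v) + τ) + (γ 0 1 * γ 1 1 : ℤ) by
      push_cast at hinv ⊢
      linear_combination (-γ 1 1 : ℂ) * hinv + (2 * (u - v) + τ) * hone, e_add, e_int, mul_one, e_add]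
  ring

theorem FF_modular {γ : SpecialLinearGroup (Fin 2) ℤ} (hγ : γ ∈ CongruenceSubgroup.Gamma0 3)
    {u : ℂ} (v : ℂ) {τ : ℍ} (hu : OffLattice τ u) :
    FF (u / (γ 1 0 * τ + γ 1 1)) (v / (γ 1 0 * τ + γ 1 1)) (γ • τ) =
      (γ 1 0 * τ + γ 1 1) ^ 2 *
        e (γ 1 0 / (γ 1 0 * τ + γ 1 1) * (2 * u * v - u ^ 2)) * FF u v τ := by
  have h := isJacobi_of_mem γ hγ τ
  have hχ : ‖(legendreSym 3 (γ 1 1) : ℂ)‖ = 1 := by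
    have := congrArg norm (legendreSym_sq_of_mem hγ)
    rw [norm_pow, norm_one] at this
    exact (pow_eq_one_iff_of_nonneg (norm_nonneg _) two_ne_zero).1 this
  -- The defect acquires the multiplier e(2(u - v) + τ) under u ↦ u + τ, hence m = 1.
  have h0 := eq_zero_of_negative_index (ι := Unit) τ (m := 1) one_pos v
    (D := fun _ => defect (γ 1 0 / (γ 1 0 * τ + γ 1 1)) (γ 1 0 * τ + γ 1 1) v τ (γ • τ))
    (fun _ u hu => differentiableAt_defect h hχ v hu) (fun _ => tendsto_mul_defect h v)
    (fun u hu => by simp only [defect_add_one hγ v hu])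
    (fun u hu => by
      simp only [defect_add_tau hγ v hu, norm_mul, Finset.univ_unique, Finset.sum_singleton, norm_e]
      congr 2
      simp
      ring) () u hu
  rw [defect, sub_eq_zero] at h0
  generalize (γ 1 0 * τ + γ 1 1 : ℂ) = j at *
  have he : e (γ 1 0 / j * (2 * u * v - u ^ 2)) *
      e (-(2 * (γ 1 0 / j) * v) * u + γ 1 0 / j * u ^ 2) = 1 := by
    rw [← e_add, ← e_zero]; congr 1; ring
  rw [mul_right_comm, ← h0, mul_right_comm, mul_comm (e _) (e _), he, one_mul]

end

section

open Set Matrix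

/-! ### The Jacobi transformation laws -/

lemma Theta_modular_of_mem {γ : SpecialLinearGroup (Fin 2) ℤ}
    (hγ : γ ∈ CongruenceSubgroup.Gamma0 3) (v : ℂ) (τ : ℍ) :
    Theta (v / (γ 1 0 * τ + γ 1 1)) (γ • τ) = legendreSym 3 (γ 1 1) * (γ 1 0 * τ + γ 1 1) *
      e (γ 1 0 / (γ 1 0 * τ + γ 1 1) * v ^ 2) * Theta v τ :=
  Theta_modular (isJacobi_of_mem γ hγ τ) v

lemma domain_modular {γ : SpecialLinearGroup (Fin 2) ℤ} (hγ : γ ∈ CongruenceSubgroup.Gamma0 3)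
    {u v : ℂ} {τ : ℍ} (hu : OffLattice τ u) (hv : Theta v τ ≠ 0) :
    OffLattice (γ • τ) (u / (γ 1 0 * τ + γ 1 1)) ∧
      Theta (v / (γ 1 0 * τ + γ 1 1)) (γ • τ) ≠ 0 := by
  obtain ⟨M, N, hM, -, -⟩ := isJacobi_of_mem γ hγ τ
  refine ⟨hM.offLattice u hu, ?_⟩
  rw [Theta_modular_of_mem hγ]
  have hχ : (legendreSym 3 (γ 1 1) : ℂ) ≠ 0 := fun h => by
    have := legendreSym_sq_of_mem hγ
    rw [h] at this
    norm_num at this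
  exact mul_ne_zero (mul_ne_zero (mul_ne_zero hχ hM.ne_zero) (e_ne_zero _)) hv

/-- Divide the law of `FF` by that of Θ: the weight is 2 - 1, the exponent is 2uv - u² - v² = -(u -
v)², and χ moves to the numerator since χ² = 1. -/
theorem muHat22_modular {γ : SpecialLinearGroup (Fin 2) ℤ} (hγ : γ ∈ CongruenceSubgroup.Gamma0 3)
    {u v : ℂ} {τ : ℍ} (hu : OffLattice τ u) (hv : Theta v τ ≠ 0) :
    muHat22 (u / (γ 1 0 * τ + γ 1 1)) (v / (γ 1 0 * τ + γ 1 1)) (γ • τ) =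
      legendreSym 3 (γ 1 1) * (γ 1 0 * τ + γ 1 1) *
        e (-(γ 1 0 / (γ 1 0 * τ + γ 1 1) * (u - v) ^ 2)) * muHat22 u v τ := by
  obtain ⟨hu', hv'⟩ := domain_modular hγ hu hv
  have h1 := Theta_mul_muHat22 hu' hv'
  rw [FF_modular hγ v hu, ← Theta_mul_muHat22 hu hv] at h1
  refine mul_left_cancel₀ hv' (h1.trans ?_)
  rw [Theta_modular_of_mem hγ]
  have hχ := legendreSym_sq_of_mem hγ
  have he : e (γ 1 0 / (γ 1 0 * τ + γ 1 1) * (2 * u * v - u ^ 2)) =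
      e (γ 1 0 / (γ 1 0 * τ + γ 1 1) * v ^ 2) *
        e (-(γ 1 0 / (γ 1 0 * τ + γ 1 1) * (u - v) ^ 2)) := by
    rw [← e_add]; congr 1; ring
  rw [he]
  linear_combination (-((γ 1 0 * τ + γ 1 1) ^ 2 * e (γ 1 0 / (γ 1 0 * τ + γ 1 1) * v ^ 2) *
    e (-(γ 1 0 / (γ 1 0 * τ + γ 1 1) * (u - v) ^ 2)) * Theta v τ * muHat22 u v τ)) * hχ

lemma Theta_add_lattice (v : ℂ) (τ : ℍ) (l n : ℤ) :
    Theta (v + l * τ + n) τ = e (-(2 * l * v) - l ^ 2 * τ) * Theta v τ := by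
  rw [Theta_add_int, Theta_add_int_mul_tau]

lemma FF_add_lattices {u : ℂ} (v : ℂ) {τ : ℍ} (hu : OffLattice τ u) (k l m n : ℤ) :
    FF (u + k * τ + m) (v + l * τ + n) τ =
      e ((k - l) ^ 2 * τ + 2 * (k - l) * (u - v) + (-(2 * l * v) - l ^ 2 * τ)) * FF u v τ := by
  rw [FF_add_int, FF_add_int_right, show u + k * (τ : ℂ) = u + ((k - l : ℤ) * τ + (0 : ℤ)) + l * τ by
    push_cast; ring, FF_add_int_mul_tau_both, FF_add_lattice v hu, ← mul_assoc, ← e_add]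
  congr 2
  push_cast; ring

lemma domain_elliptic {u v : ℂ} {τ : ℍ} (hu : OffLattice τ u) (hv : Theta v τ ≠ 0) (k l m n : ℤ) :
    OffLattice τ (u + k * τ + m) ∧ Theta (v + l * τ + n) τ ≠ 0 := by
  refine ⟨?_, ?_⟩
  · rw [add_assoc]; exact (offLattice_add_iff τ u k m).2 hu
  · rw [Theta_add_lattice]
    exact mul_ne_zero (e_ne_zero _) hv

theorem muHat22_elliptic {u v : ℂ} {τ : ℍ} (hu : OffLattice τ u) (hv : Theta v τ ≠ 0)
    (k l m n : ℤ) : muHat22 (u + k * τ + m) (v + l * τ + n) τ =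
      e ((k - l) ^ 2 * τ + 2 * (k - l) * (u - v)) * muHat22 u v τ := by
  obtain ⟨hu', hv'⟩ := domain_elliptic hu hv k l m n
  have h1 := Theta_mul_muHat22 hu' hv'
  rw [FF_add_lattices v hu, ← Theta_mul_muHat22 hu hv, e_add] at h1
  refine mul_left_cancel₀ hv' (h1.trans ?_)
  rw [Theta_add_lattice]
  ring

lemma dotProduct_index (x y : Fin 2 → ℂ) :
    x ⬝ᵥ (!![-1, 1; 1, -1] : Matrix (Fin 2) (Fin 2) ℂ).mulVec y = -((x 0 - x 1) * (y 0 - y 1)) := by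
  simp [dotProduct, mulVec, Fin.sum_univ_two]
  ring

end

end AppellLerch

end

/-- The completed generalized Appell-Lerch sum `μ̂_{2,2}` is well defined on its domain and
transforms as a two-variable Jacobi form of weight `1` for `Γ₀(3)`, with multiplier `(d/3)` and
matrix-valued index `[[-1, 1], [1, -1]]`. -/
theorem mainTheorem2 :
    (∀ (u v : ℂ) (τ : UpperHalfPlane), (![u, v], τ) ∈ AppellLerch.Domain →
      AppellLerch.SeriesConverge u v τ) ∧
    AppellLerch.TransformsAsJacobiForm AppellLerch.Domain
      (fun z τ => AppellLerch.muHat22 (z 0) (z 1) τ) 1 (CongruenceSubgroup.Gamma0 3)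
      (fun γ => (legendreSym 3 (γ 1 1) : ℂ)) !![-1, 1; 1, -1] := by
  refine ⟨fun u v τ h => AppellLerch.seriesConverge h.1, ?_, ?_, ?_, ?_⟩
  · intro γ hγ z τ h
    exact AppellLerch.domain_modular hγ h.1 h.2
  · intro γ hγ z τ h
    have h1 := AppellLerch.muHat22_modular hγ h.1 h.2
    refine h1.trans ?_
    rw [AppellLerch.dotProduct_index, zpow_one]
    congr 3
    ring
  · intro l n z τ h
    exact AppellLerch.domain_elliptic h.1 h.2 _ _ _ _
  · intro l n z τ h
    have h1 := AppellLerch.muHat22_elliptic h.1 h.2 (l 0) (l 1) (n 0) (n 1)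
    refine h1.trans ?_
    rw [AppellLerch.dotProduct_index, AppellLerch.dotProduct_index]
    congr 2
    ring
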